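/- Consider the call-by-value $\lambda$-calculus with shift and reset. Terms and values, taken up to $\alpha$-conversion, are $t ::= x \mid \lambda x.t \mid t\,t \mid \mathcal{S}k.t \mid \langle t\rangle$ and $v ::= \lambda x.t \mid x$, over a countably infinite set of variables, where $\lambda x.t$ binds $x$ and $\mathcal{S}k.t$ binds $k$ in $t$. Pure contexts, evaluation contexts and general contexts are $E ::= \square \mid v\,E \mid E\,t$, $\;F ::= \square \mid v\,F \mid F\,t \mid \langle F\rangle$, $\;C ::= \square \mid \lambda x.C \mid t\,C \mid C\,t \mid \mathcal{S}k.C \mid \langle C\rangle$; filling a context may capture free variables. Reduction $\to$ is given by $F[(\lambda x.t)\,v] \to F[t\{v/x\}]$, $\;F[\langle E[\mathcal{S}k.t]\rangle] \to F[\langle t\{\lambda x.\langle E[x]\rangle/k\}\rangle]$ with $x\notin \mathrm{fv}(E)$, and $F[\langle v\rangle]\to F[v]$. Write $t\Downarrow t'$ if $t\to^* t'$ and $t'$ is irreducible. A term is control stuck if it is of the form $E[\mathcal{S}k.t]$. Contextual equivalence: $t_0\cong t_1$ if for all $C$ such that $C[t_0]$ and $C[t_1]$ are closed, $C[t_0]$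 evaluates to a value iff $C[t_1]$ does, and $C[t_0]$ evaluates to a control stuck term iff $C[t_1]$ does. A variable is fresh if it does not occur free in the terms or contexts under consideration. Put $x\bullet y = x\,y$ and $(\lambda x.t)\bullet y = t\{y/x\}$. For a relation $R$ on terms: * $v_0\,R^{r}\,v_1$ if $(v_0\bullet x)\,R\,(v_1\bullet x)$ for a fresh $x$; * $F_0\,R\,F_1$ if either $F_0=E_0$ and $F_1=E_1$ are pure with $E_0[x]\,R\,E_1[x]$ for a fresh $x$, or $F_0=F_0'[\langle E_0\rangle]$, $F_1=F_1'[\langle E_1\rangle]$ with $F_0'[x]\,R\,F_1'[x]$ and $\langle E_0[x]\rangle\,R\,\langle E_1[x]\rangle$ for a fresh $x$; * $F_0[x\,v_0]\,R^{r}\,F_1[x\,v_1]$ if $F_0\,R\,F_1$ and $v_0\,R^{r}\,v_1$; * $E_0[\mathcal{S}k.t_0]\,R^{r}\,E_1[\mathcal{S}k.t_1]$ if $\langle t_0\{\lambda x.\langle k'\,E_0[x]\rangle/k\}\rangle\,R\,\langle t_1\{\lambda x.\langle k'\,E_1[x]\rangle/k\}\rangle$ for fresh $k',x$. $R$ is a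 refined normal form simulation if $t_0\,R\,t_1$ and $t_0\Downarrow t_0'$ imply $t_1\Downarrow t_1'$ and $t_0'\,R^{r}\,t_1'$ for some $t_1'$; it is a refined bisimulation if both $R$ and $R^{-1}$ are refined simulations. Refined bisimilarity $\approx_r$ is the largest refined bisimulation. The substitutive, bisimilar and context closure $\widehat{R}$ of $R$ is the least relation such that: $t\,\widehat R\,t$; $R\subseteq\widehat R$; if $t_0\,\widehat R\,t_1$ and $v_0\,\widehat R^{\,r}\,v_1$ then $t_0\{v_0/x\}\,\widehat R\,t_1\{v_1/x\}$; if $t_0\,\widehat R\,t_1$ and $F_0\,\widehat R\,F_1$ then $F_0[t_0]\,\widehat R\,F_1[t_1]$; if $t_0\,\widehat R\,t_1$ then $\lambda x.t_0\,\widehat R\,\lambda x.t_1$ and $\mathcal{S}k.t_0\,\widehat R\,\mathcal{S}k.t_1$; and if $t_0\approx_r t_0'$, $t_0'\,\widehat R\,t_1'$ and $t_1'\approx_r t_1$ then $t_0\,\widehat R\,t_1$. **Theorem.** 1. If $R$ is a refined bisimulation, then so is $\widehat R$. 2. The relation $\approx_r$ is a congruence, i.e. an equivalence relation such that $t_0\approx_r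 t_1$ implies $C[t_0]\approx_r C[t_1]$ for every context $C$. 3. $\approx_r\,\subsetneq\,\cong$: refined bisimilarity is sound with respect to contextual equivalence, and the inclusion is strict. -/

import Mathlib

namespace ShiftReset

/-! ### Syntax

Terms up to `α`-conversion are represented with de Bruijn indices.  The term variables are the
natural numbers; at top level, `var n` is the free variable `n`.  The binders
`λ x. t` and `S k. t` that bind a *named* variable are `Tm.abs x t` and `Tm.absShift k t` below. -/

/-- Terms `t ::= x | λx.t | t t | S k.t | ⟨t⟩`. -/
inductive Tm : Type
  | var (n : ℕ)
  | lam (t : Tm)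
  | app (t s : Tm)
  | shift (t : Tm)
  | reset (t : Tm)

/-- Values `v ::= λx.t | x`. -/
inductive Val : Type
  | var (n : ℕ)
  | lam (t : Tm)

/-- Values are terms. -/
def Val.toTm : Val → Tm
  | .var n => .var n
  | .lam t => .lam t

/-- Lifting of a renaming under a binder. -/
def upRen (ρ : ℕ → ℕ) : ℕ → ℕ
  | 0 => 0
  | n + 1 => ρ n + 1

/-- Renaming of the free variables of a term. -/
def Tm.rename : (ℕ → ℕ) → Tm → Tm
  | ρ, .var n => .var (ρ n)
  | ρ, .lam t => .lam (t.rename (upRen ρ))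
  | ρ, .app t s => .app (t.rename ρ) (s.rename ρ)
  | ρ, .shift t => .shift (t.rename (upRen ρ))
  | ρ, .reset t => .reset (t.rename ρ)

/-- Renaming of the free variables of a value. -/
def Val.rename (ρ : ℕ → ℕ) : Val → Val
  | .var n => .var (ρ n)
  | .lam t => .lam (t.rename (upRen ρ))

/-- Lifting of a substitution under a binder. -/
def upSub (σ : ℕ → Val) : ℕ → Val
  | 0 => .var 0
  | n + 1 => (σ n).rename Nat.succ

/-- Simultaneous capture-avoiding substitution of values for the free variables of a term. -/
def Tm.subst : (ℕ → Val) → Tm → Tm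
  | σ, .var n => (σ n).toTm
  | σ, .lam t => .lam (t.subst (upSub σ))
  | σ, .app t s => .app (t.subst σ) (s.subst σ)
  | σ, .shift t => .shift (t.subst (upSub σ))
  | σ, .reset t => .reset (t.subst σ)

/-- If `t` is the body of a binder, `t.inst v` is the substitution of `v` for the variable bound
by it. -/
def Tm.inst (t : Tm) (v : Val) : Tm :=
  t.subst fun n => match n with
    | 0 => v
    | n + 1 => .var n

/-- `t{v/x}`, for a free variable `x`. -/
def Tm.substVar (t : Tm) (x : ℕ) (v : Val) : Tm :=
  t.subst fun n => if n = x then v else .var n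

/-- `x` is a free variable of the term. -/
def Tm.Free : ℕ → Tm → Prop
  | x, .var n => x = n
  | x, .lam t => t.Free (x + 1)
  | x, .app t s => t.Free x ∨ s.Free x
  | x, .shift t => t.Free (x + 1)
  | x, .reset t => t.Free x

/-- A term is closed if it has no free variables. -/
def Tm.Closed (t : Tm) : Prop := ∀ x, ¬ t.Free x

/-- Turn the free variable `x` of a term into the variable bound by an enclosing binder. -/
def bindRen (x n : ℕ) : ℕ := if n = x then 0 else n + 1

/-- `λ x. t`, where `x` is a named variable which may occur free in `t`. -/
def Tm.abs (x : ℕ) (t : Tm) : Tm := .lam (t.rename (bindRen x))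

/-- `S k. t`, where `k` is a named variable which may occur free in `t`. -/
def Tm.absShift (k : ℕ) (t : Tm) : Tm := .shift (t.rename (bindRen k))

/-! ### Contexts -/

/-- Pure contexts `E ::= □ | v E | E t`. -/
inductive PureCtx : Type
  | hole
  | appR (v : Val) (E : PureCtx)
  | appL (E : PureCtx) (t : Tm)

/-- Evaluation contexts `F ::= □ | v F | F t | ⟨F⟩`. -/
inductive EvalCtx : Type
  | hole
  | appR (v : Val) (F : EvalCtx)
  | appL (F : EvalCtx) (t : Tm)
  | reset (F : EvalCtx)

/-- Contexts `C ::= □ | λ x. C | t C | C t | S k. C | ⟨C⟩`. -/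
inductive Ctx : Type
  | hole
  | lam (x : ℕ) (C : Ctx)
  | appR (t : Tm) (C : Ctx)
  | appL (C : Ctx) (t : Tm)
  | shift (k : ℕ) (C : Ctx)
  | reset (C : Ctx)

def PureCtx.plug : PureCtx → Tm → Tm
  | .hole, t => t
  | .appR v E, t => .app v.toTm (E.plug t)
  | .appL E s, t => .app (E.plug t) s

def EvalCtx.plug : EvalCtx → Tm → Tm
  | .hole, t => t
  | .appR v F, t => .app v.toTm (F.plug t)
  | .appL F s, t => .app (F.plug t) s
  | .reset F, t => .reset (F.plug t)

/-- Filling a context; the binders of the context capture free variables of the term. -/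
def Ctx.plug : Ctx → Tm → Tm
  | .hole, t => t
  | .lam x C, t => .abs x (C.plug t)
  | .appR s C, t => .app s (C.plug t)
  | .appL C s, t => .app (C.plug t) s
  | .shift k C, t => .absShift k (C.plug t)
  | .reset C, t => .reset (C.plug t)

def PureCtx.rename (ρ : ℕ → ℕ) : PureCtx → PureCtx
  | .hole => .hole
  | .appR v E => .appR (v.rename ρ) (E.rename ρ)
  | .appL E t => .appL (E.rename ρ) (t.rename ρ)

/-- `x` is a free variable of the pure context. -/
def PureCtx.Free (x : ℕ) : PureCtx → Prop
  | .hole => False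
  | .appR v E => v.toTm.Free x ∨ E.Free x
  | .appL E t => E.Free x ∨ t.Free x

/-- `x` is a free variable of the evaluation context. -/
def EvalCtx.Free (x : ℕ) : EvalCtx → Prop
  | .hole => False
  | .appR v F => v.toTm.Free x ∨ F.Free x
  | .appL F t => F.Free x ∨ t.Free x
  | .reset F => F.Free x

/-- A pure context is an evaluation context. -/
def PureCtx.toEval : PureCtx → EvalCtx
  | .hole => .hole
  | .appR v E => .appR v E.toEval
  | .appL E t => .appL E.toEval t

/-- Composition of evaluation contexts: `F.comp G` is `F[G]`. -/
def EvalCtx.comp : EvalCtx → EvalCtx → EvalCtx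
  | .hole, G => G
  | .appR v F, G => .appR v (F.comp G)
  | .appL F t, G => .appL (F.comp G) t
  | .reset F, G => .reset (F.comp G)

/-! ### Reduction semantics -/

/-- The value `λ x. ⟨E[x]⟩` with `x` not free in `E`. -/
def PureCtx.reify (E : PureCtx) : Val :=
  .lam (.reset ((E.rename Nat.succ).plug (.var 0)))

/-- The value `λ x. ⟨k' E[x]⟩` with `x` distinct from `k'` and not free in `E`. -/
def PureCtx.reifyWith (k' : ℕ) (E : PureCtx) : Val :=
  (PureCtx.appR (.var k') E).reify

/-- One-step call-by-value reduction. -/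
inductive Red : Tm → Tm → Prop
  | beta (F : EvalCtx) (t : Tm) (v : Val) :
      Red (F.plug (.app (.lam t) v.toTm)) (F.plug (t.inst v))
  | shift (F : EvalCtx) (E : PureCtx) (t : Tm) :
      Red (F.plug (.reset (E.plug (.shift t)))) (F.plug (.reset (t.inst E.reify)))
  | reset (F : EvalCtx) (v : Val) :
      Red (F.plug (.reset v.toTm)) (F.plug v.toTm)

/-- Evaluation: `t` reduces in finitely many steps to the irreducible term `t'`. -/
def Eval (t t' : Tm) : Prop :=
  Relation.ReflTransGen Red t t' ∧ ∀ t'', ¬ Red t' t''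

def Tm.IsValue (t : Tm) : Prop := ∃ v : Val, t = v.toTm

def Tm.ControlStuck (t : Tm) : Prop := ∃ (E : PureCtx) (s : Tm), t = E.plug (.shift s)

/-! ### Contextual equivalence -/

/-- One half of the observations of contextual equivalence. -/
def ObsLe (p q : Tm) : Prop :=
  ((∃ p', Eval p p' ∧ p'.IsValue) → ∃ q', Eval q q' ∧ q'.IsValue) ∧
  ((∃ p', Eval p p' ∧ p'.ControlStuck) → ∃ q', Eval q q' ∧ q'.ControlStuck)

/-- Contextual equivalence. -/
def CtxEquiv (t₀ t₁ : Tm) : Prop :=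
  ∀ C : Ctx, (C.plug t₀).Closed → (C.plug t₁).Closed →
    ObsLe (C.plug t₀) (C.plug t₁) ∧ ObsLe (C.plug t₁) (C.plug t₀)

/-! ### Refined normal form bisimilarity -/

/-- The application `v • y` of a value to a variable, which is `x y` if `v = x` and `t{y/x}` if
`v = λ x. t`. -/
def Val.appVar : Val → ℕ → Tm
  | .var n, y => .app (.var n) (.var y)
  | .lam t, y => t.inst (.var y)

/-- Extension of a relation on terms to evaluation contexts. -/
inductive CtxRel (R : Tm → Tm → Prop) : EvalCtx → EvalCtx → Prop
  | pure (E₀ E₁ : PureCtx) (x : ℕ) :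
      ¬ E₀.Free x → ¬ E₁.Free x →
      R (E₀.plug (.var x)) (E₁.plug (.var x)) →
      CtxRel R E₀.toEval E₁.toEval
  | delimited (F₀ F₁ : EvalCtx) (E₀ E₁ : PureCtx) (x : ℕ) :
      ¬ F₀.Free x → ¬ F₁.Free x → ¬ E₀.Free x → ¬ E₁.Free x →
      R (F₀.plug (.var x)) (F₁.plug (.var x)) →
      R (.reset (E₀.plug (.var x))) (.reset (E₁.plug (.var x))) →
      CtxRel R (F₀.comp (.reset E₀.toEval)) (F₁.comp (.reset E₁.toEval))

/-- Extension of a relation on terms to values, by application to a fresh variable. -/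
def ValRel (R : Tm → Tm → Prop) (v₀ v₁ : Val) : Prop :=
  ∃ x : ℕ, ¬ v₀.toTm.Free x ∧ ¬ v₁.toTm.Free x ∧ R (v₀.appVar x) (v₁.appVar x)

/-- The refined extension of a relation on terms to normal forms. -/
inductive RefinedNF (R : Tm → Tm → Prop) : Tm → Tm → Prop
  | value (v₀ v₁ : Val) : ValRel R v₀ v₁ → RefinedNF R v₀.toTm v₁.toTm
  | control (E₀ E₁ : PureCtx) (t₀ t₁ : Tm) (k' : ℕ) :
      ¬ (E₀.plug (.shift t₀)).Free k' → ¬ (E₁.plug (.shift t₁)).Free k' →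
      R (.reset (t₀.inst (E₀.reifyWith k'))) (.reset (t₁.inst (E₁.reifyWith k'))) →
      RefinedNF R (E₀.plug (.shift t₀)) (E₁.plug (.shift t₁))
  | openStuck (x : ℕ) (F₀ F₁ : EvalCtx) (v₀ v₁ : Val) :
      CtxRel R F₀ F₁ → ValRel R v₀ v₁ →
      RefinedNF R (F₀.plug (.app (.var x) v₀.toTm)) (F₁.plug (.app (.var x) v₁.toTm))

/-- Refined normal form simulations. -/
def IsRefinedSimulation (R : Tm → Tm → Prop) : Prop :=
  ∀ t₀ t₁ t₀', R t₀ t₁ → Eval t₀ t₀' → ∃ t₁', Eval t₁ t₁' ∧ RefinedNF R t₀' t₁'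

/-- Refined normal form bisimulations. -/
def IsRefinedBisimulation (R : Tm → Tm → Prop) : Prop :=
  IsRefinedSimulation R ∧ IsRefinedSimulation fun t₁ t₀ => R t₀ t₁

/-- Refined normal form bisimilarity: the union of all refined bisimulations.  It is the largest
one by `refinedBisimilar_isGreatest`. -/
def RefinedBisimilar (t₀ t₁ : Tm) : Prop :=
  ∃ R : Tm → Tm → Prop, IsRefinedBisimulation R ∧ R t₀ t₁

theorem RefinedNF.mono {R S : Tm → Tm → Prop} (h : ∀ a b, R a b → S a b) {t s : Tm}
    (hts : RefinedNF R t s) : RefinedNF S t s := by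
  cases hts with
  | value v₀ v₁ hv =>
    obtain ⟨x, h0, h1, hr⟩ := hv
    exact .value _ _ ⟨x, h0, h1, h _ _ hr⟩
  | control E₀ E₁ t₀ t₁ k' h0 h1 hr => exact .control _ _ _ _ k' h0 h1 (h _ _ hr)
  | openStuck x F₀ F₁ v₀ v₁ hF hv =>
    obtain ⟨y, h0, h1, hr⟩ := hv
    refine .openStuck _ _ _ _ _ ?_ ⟨y, h0, h1, h _ _ hr⟩
    cases hF with
    | pure E₀ E₁ x a b c => exact .pure _ _ x a b (h _ _ c)
    | delimited F₀ F₁ E₀ E₁ x a b c d e f =>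
      exact .delimited _ _ _ _ x a b c d (h _ _ e) (h _ _ f)

theorem refinedBisimilar_isGreatest :
    IsGreatest {R : Tm → Tm → Prop | IsRefinedBisimulation R} RefinedBisimilar := by
  refine ⟨⟨?_, ?_⟩, fun R hR t s h => ⟨R, hR, h⟩⟩
  · rintro t₀ t₁ t₀' ⟨R, hR, h⟩ he
    obtain ⟨t₁', h1, h2⟩ := hR.1 _ _ _ h he
    exact ⟨t₁', h1, h2.mono fun a b hab => ⟨R, hR, hab⟩⟩
  · rintro t₁ t₀ t₁' ⟨R, hR, h⟩ he
    obtain ⟨t₀', h1, h2⟩ := hR.2 _ _ _ h he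
    exact ⟨t₀', h1, h2.mono fun a b hab => ⟨R, hR, hab⟩⟩

/-- The substitutive, bisimilar, and context closure of a relation.  The premises of `subst` are
those of `ValRel`, and `pureCtx` and `delimitedCtx` spell out the two cases of `CtxRel`, for the
closure itself. -/
inductive Closure (R : Tm → Tm → Prop) : Tm → Tm → Prop
  | refl (t : Tm) : Closure R t t
  | base (t₀ t₁ : Tm) : R t₀ t₁ → Closure R t₀ t₁
  | subst (t₀ t₁ : Tm) (x : ℕ) (v₀ v₁ : Val) (y : ℕ) :
      Closure R t₀ t₁ →
      ¬ v₀.toTm.Free y → ¬ v₁.toTm.Free y → Closure R (v₀.appVar y) (v₁.appVar y) →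
      Closure R (t₀.substVar x v₀) (t₁.substVar x v₁)
  | pureCtx (t₀ t₁ : Tm) (E₀ E₁ : PureCtx) (x : ℕ) :
      Closure R t₀ t₁ →
      ¬ E₀.Free x → ¬ E₁.Free x →
      Closure R (E₀.plug (.var x)) (E₁.plug (.var x)) →
      Closure R (E₀.plug t₀) (E₁.plug t₁)
  | delimitedCtx (t₀ t₁ : Tm) (F₀ F₁ : EvalCtx) (E₀ E₁ : PureCtx) (x : ℕ) :
      Closure R t₀ t₁ →
      ¬ F₀.Free x → ¬ F₁.Free x → ¬ E₀.Free x → ¬ E₁.Free x →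
      Closure R (F₀.plug (.var x)) (F₁.plug (.var x)) →
      Closure R (.reset (E₀.plug (.var x))) (.reset (E₁.plug (.var x))) →
      Closure R (F₀.plug (.reset (E₀.plug t₀))) (F₁.plug (.reset (E₁.plug t₁)))
  | lam (x : ℕ) (t₀ t₁ : Tm) : Closure R t₀ t₁ → Closure R (.abs x t₀) (.abs x t₁)
  | shift (k : ℕ) (t₀ t₁ : Tm) :
      Closure R t₀ t₁ → Closure R (.absShift k t₀) (.absShift k t₁)
  | bisim (t₀ t₀' t₁' t₁ : Tm) :
      RefinedBisimilar t₀ t₀' → Closure R t₀' t₁' → RefinedBisimilar t₁' t₁ →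
      Closure R t₀ t₁

/-- A congruence is an equivalence relation preserved by all contexts. -/
def IsCongruence (R : Tm → Tm → Prop) : Prop :=
  Equivalence R ∧ ∀ (C : Ctx) (t₀ t₁ : Tm), R t₀ t₁ → R (C.plug t₀) (C.plug t₁)

end ShiftReset

namespace ShiftReset

/-! ### Calculus of substitutions -/

-- The whole theorem reduces to one fact: bisimilarity is preserved by substitution of bisimilar
-- values and by plugging into bisimilar contexts. Given this, if `R` is a refined bisimulation,
-- every rule of `Closure R` stays inside bisimilarity; conversely the `bisim` rule around `refl`
-- already yields all of bisimilarity. So `Closure R` equals `RefinedBisimilar`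
-- (`closure_eq_refinedBisimilar`), which is a bisimulation. Congruence and soundness follow in the
-- same way, since related normal forms have the same shape.
--
-- Compatibility is proved by an abstract-machine argument. A configuration (`Conf`) is a pair of
-- bisimilar open terms, closed by related environments (`EnvClo`) and placed in related stacks of
-- frames (`Stk`). The main lemma `Conf.eval` says that if the left side evaluates, so does the
-- right, with related results. The open term is run first, without its environment; bisimilarity
-- gives a matching normal form on the right. A value is returned to the top frame, a control-stuck
-- term captures the pure part of the stack, and an open-stuck term `F[x v]` pushes `F` on the stack
-- and looks `x` up in the environment (`ValClo.apply`). The induction is lexicographic in the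
-- number of captures, the number of steps, and the height of the stack on the left.
--
-- Captures come first in the measure for the following reason. The bisimulation clause for a
-- control-stuck `E[Sk.t]` only speaks of the continuation `λx.⟨k' E[x]⟩`. Instantiating `k'` by the
-- reified surrounding context `J` gives `λx.⟨(λy.⟨J[y]⟩) E[x]⟩`, whereas reduction produces
-- `λx.⟨J[E[x]]⟩`. The two differ by administrative redexes. The relation `Adm` absorbs these: it is
-- a bisimulation, and evaluation of its left side is matched with exactly as many captures, though
-- possibly more steps. Since one capture has just been spent, the measure still drops.
--
-- Strictness is witnessed by `⟨x (λy.y)⟩ Ω` and `Ω`, with `Ω` the looping term. The first is open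
-- stuck and the second diverges, so they are not bisimilar. In a closed program a term `⟨t⟩ Ω` in
-- evaluation position can only diverge: the reset keeps captures inside, and a value returned by it
-- is followed by `Ω`. Hence no context separates the two (`HopelessEq.ctxEquiv`).

/-- Simultaneous substitution in a value. -/
def Val.subst (σ : ℕ → Val) : Val → Val
  | .var n => σ n
  | .lam t => .lam (t.subst (upSub σ))

/-- The substitution `v · σ`. -/
def scons (v : Val) (σ : ℕ → Val) : ℕ → Val
  | 0 => v
  | n + 1 => σ n

@[simp] theorem scons_zero (v : Val) (σ : ℕ → Val) : scons v σ 0 = v := rfl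
@[simp] theorem scons_succ (v : Val) (σ : ℕ → Val) (n : ℕ) : scons v σ (n + 1) = σ n := rfl
@[simp] theorem upSub_zero (σ : ℕ → Val) : upSub σ 0 = .var 0 := rfl
@[simp] theorem upSub_succ (σ : ℕ → Val) (n : ℕ) :
    upSub σ (n + 1) = (σ n).rename Nat.succ := rfl
@[simp] theorem upRen_succ (ρ : ℕ → ℕ) (n : ℕ) : upRen ρ (n + 1) = ρ n + 1 := rfl

theorem Tm.inst_eq (t : Tm) (v : Val) : t.inst v = t.subst (scons v .var) := by
  unfold Tm.inst; congr 1

@[simp] theorem Val.toTm_var (n : ℕ) : (Val.var n).toTm = .var n := rfl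
@[simp] theorem Val.toTm_lam (t : Tm) : (Val.lam t).toTm = .lam t := rfl

@[simp] theorem Val.toTm_inj {v w : Val} : v.toTm = w.toTm ↔ v = w := by
  cases v <;> cases w <;> simp [Val.toTm]

theorem Val.toTm_rename (v : Val) (ρ : ℕ → ℕ) : (v.rename ρ).toTm = v.toTm.rename ρ := by
  cases v <;> rfl

theorem Val.toTm_subst (v : Val) (σ : ℕ → Val) : (v.subst σ).toTm = v.toTm.subst σ := by
  cases v <;> rfl

theorem upRen_comp (ρ ξ : ℕ → ℕ) : upRen ξ ∘ upRen ρ = upRen (ξ ∘ ρ) := by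
  funext n; cases n <;> rfl

theorem Tm.rename_rename (t : Tm) (ρ ξ : ℕ → ℕ) :
    (t.rename ρ).rename ξ = t.rename (ξ ∘ ρ) := by
  induction t generalizing ρ ξ with
  | var n => rfl
  | lam t ih => simp [Tm.rename, ih, upRen_comp]
  | app t s iht ihs => simp [Tm.rename, iht, ihs]
  | shift t ih => simp [Tm.rename, ih, upRen_comp]
  | reset t ih => simp [Tm.rename, ih]

theorem Val.rename_rename (v : Val) (ρ ξ : ℕ → ℕ) :
    (v.rename ρ).rename ξ = v.rename (ξ ∘ ρ) := by
  rw [← Val.toTm_inj]; simp only [Val.toTm_rename, Tm.rename_rename]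

theorem upSub_var_comp (ρ : ℕ → ℕ) : upSub (Val.var ∘ ρ) = Val.var ∘ upRen ρ := by
  funext n; cases n <;> rfl

theorem Tm.rename_eq_subst (t : Tm) (ρ : ℕ → ℕ) : t.rename ρ = t.subst (Val.var ∘ ρ) := by
  induction t generalizing ρ with
  | var n => rfl
  | lam t ih => simp [Tm.rename, Tm.subst, ih, upSub_var_comp]
  | app t s iht ihs => simp [Tm.rename, Tm.subst, iht, ihs]
  | shift t ih => simp [Tm.rename, Tm.subst, ih, upSub_var_comp]
  | reset t ih => simp [Tm.rename, Tm.subst, ih]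

theorem Val.rename_eq_subst (v : Val) (ρ : ℕ → ℕ) : v.rename ρ = v.subst (Val.var ∘ ρ) := by
  rw [← Val.toTm_inj]; simp only [Val.toTm_rename, Val.toTm_subst, Tm.rename_eq_subst]

theorem upSub_comp_upRen (σ : ℕ → Val) (ρ : ℕ → ℕ) : upSub σ ∘ upRen ρ = upSub (σ ∘ ρ) := by
  funext n; cases n <;> rfl

theorem Tm.subst_rename (t : Tm) (ρ : ℕ → ℕ) (σ : ℕ → Val) :
    (t.rename ρ).subst σ = t.subst (σ ∘ ρ) := by
  induction t generalizing ρ σ with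
  | var n => rfl
  | lam t ih => simp [Tm.rename, Tm.subst, ih, upSub_comp_upRen]
  | app t s iht ihs => simp [Tm.rename, Tm.subst, iht, ihs]
  | shift t ih => simp [Tm.rename, Tm.subst, ih, upSub_comp_upRen]
  | reset t ih => simp [Tm.rename, Tm.subst, ih]

theorem Val.subst_rename (v : Val) (ρ : ℕ → ℕ) (σ : ℕ → Val) :
    (v.rename ρ).subst σ = v.subst (σ ∘ ρ) := by
  rw [← Val.toTm_inj]; simp only [Val.toTm_rename, Val.toTm_subst, Tm.subst_rename]

theorem rename_comp_upSub (σ : ℕ → Val) (ρ : ℕ → ℕ) :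
    (fun n => (upSub σ n).rename (upRen ρ)) = upSub fun n => (σ n).rename ρ := by
  funext n
  cases n with
  | zero => rfl
  | succ n => simp only [upSub_succ, Val.rename_rename]; rfl

theorem Tm.rename_subst (t : Tm) (σ : ℕ → Val) (ρ : ℕ → ℕ) :
    (t.subst σ).rename ρ = t.subst fun n => (σ n).rename ρ := by
  induction t generalizing ρ σ with
  | var n => simp [Tm.subst, Val.toTm_rename]
  | lam t ih => simp [Tm.rename, Tm.subst, ih, rename_comp_upSub]
  | app t s iht ihs => simp [Tm.rename, Tm.subst, iht, ihs]
  | shift t ih => simp [Tm.rename, Tm.subst, ih, rename_comp_upSub]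
  | reset t ih => simp [Tm.rename, Tm.subst, ih]

theorem Val.rename_subst (v : Val) (σ : ℕ → Val) (ρ : ℕ → ℕ) :
    (v.subst σ).rename ρ = v.subst fun n => (σ n).rename ρ := by
  rw [← Val.toTm_inj]; simp only [Val.toTm_rename, Val.toTm_subst, Tm.rename_subst]

theorem subst_comp_upSub (σ τ : ℕ → Val) :
    (fun n => (upSub σ n).subst (upSub τ)) = upSub fun n => (σ n).subst τ := by
  funext n
  cases n with
  | zero => rfl
  | succ n =>
    simp only [upSub_succ, Val.subst_rename, Val.rename_subst]; rfl

theorem Tm.subst_subst (t : Tm) (σ τ : ℕ → Val) :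
    (t.subst σ).subst τ = t.subst fun n => (σ n).subst τ := by
  induction t generalizing σ τ with
  | var n => simp [Tm.subst, Val.toTm_subst]
  | lam t ih => simp [Tm.subst, ih, subst_comp_upSub]
  | app t s iht ihs => simp [Tm.subst, iht, ihs]
  | shift t ih => simp [Tm.subst, ih, subst_comp_upSub]
  | reset t ih => simp [Tm.subst, ih]

theorem Val.subst_subst (v : Val) (σ τ : ℕ → Val) :
    (v.subst σ).subst τ = v.subst fun n => (σ n).subst τ := by
  rw [← Val.toTm_inj]; simp only [Val.toTm_subst, Tm.subst_subst]

theorem upSub_var : upSub Val.var = Val.var := by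
  funext n; cases n <;> rfl

@[simp] theorem Tm.subst_var (t : Tm) : t.subst .var = t := by
  induction t with
  | var n => rfl
  | lam t ih => simp [Tm.subst, upSub_var, ih]
  | app t s iht ihs => simp [Tm.subst, iht, ihs]
  | shift t ih => simp [Tm.subst, upSub_var, ih]
  | reset t ih => simp [Tm.subst, ih]

@[simp] theorem Val.subst_var (v : Val) : v.subst .var = v := by
  rw [← Val.toTm_inj]; simp [Val.toTm_subst]

theorem Tm.inst_subst (t : Tm) (v : Val) (σ : ℕ → Val) :
    (t.inst v).subst σ = (t.subst (upSub σ)).inst (v.subst σ) := by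
  simp only [Tm.inst_eq, Tm.subst_subst]
  congr 1; funext n
  cases n with
  | zero => rfl
  | succ n =>
    simp only [scons_succ, upSub_succ, Val.subst_rename]
    exact (Val.subst_var _).symm

theorem Tm.inst_upSub (t : Tm) (v : Val) (σ : ℕ → Val) :
    (t.subst (upSub σ)).inst v = t.subst (scons v σ) := by
  simp only [Tm.inst_eq, Tm.subst_subst]
  congr 1; funext n
  cases n with
  | zero => rfl
  | succ n =>
    simp only [scons_succ, upSub_succ, Val.subst_rename]
    exact Val.subst_var _

/-! ### Contexts -/

def PureCtx.subst (σ : ℕ → Val) : PureCtx → PureCtx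
  | .hole => .hole
  | .appR v E => .appR (v.subst σ) (E.subst σ)
  | .appL E t => .appL (E.subst σ) (t.subst σ)

def EvalCtx.subst (σ : ℕ → Val) : EvalCtx → EvalCtx
  | .hole => .hole
  | .appR v F => .appR (v.subst σ) (F.subst σ)
  | .appL F t => .appL (F.subst σ) (t.subst σ)
  | .reset F => .reset (F.subst σ)

def EvalCtx.rename (ρ : ℕ → ℕ) : EvalCtx → EvalCtx
  | .hole => .hole
  | .appR v F => .appR (v.rename ρ) (F.rename ρ)
  | .appL F t => .appL (F.rename ρ) (t.rename ρ)
  | .reset F => .reset (F.rename ρ)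

/-- Composition of pure contexts: `E.comp G` is `E[G]`. -/
def PureCtx.comp : PureCtx → PureCtx → PureCtx
  | .hole, G => G
  | .appR v E, G => .appR v (E.comp G)
  | .appL E t, G => .appL (E.comp G) t

theorem PureCtx.rename_eq_subst (E : PureCtx) (ρ : ℕ → ℕ) :
    E.rename ρ = E.subst (Val.var ∘ ρ) := by
  induction E with
  | hole => rfl
  | appR v E ih => simp [PureCtx.rename, PureCtx.subst, ih, Val.rename_eq_subst]
  | appL E t ih => simp [PureCtx.rename, PureCtx.subst, ih, Tm.rename_eq_subst]

theorem EvalCtx.rename_eq_subst (F : EvalCtx) (ρ : ℕ → ℕ) :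
    F.rename ρ = F.subst (Val.var ∘ ρ) := by
  induction F with
  | hole => rfl
  | appR v F ih => simp [EvalCtx.rename, EvalCtx.subst, ih, Val.rename_eq_subst]
  | appL F t ih => simp [EvalCtx.rename, EvalCtx.subst, ih, Tm.rename_eq_subst]
  | reset F ih => simp [EvalCtx.rename, EvalCtx.subst, ih]

theorem PureCtx.subst_subst (E : PureCtx) (σ τ : ℕ → Val) :
    (E.subst σ).subst τ = E.subst fun n => (σ n).subst τ := by
  induction E with
  | hole => rfl
  | appR v E ih => simp [PureCtx.subst, ih, Val.subst_subst]
  | appL E t ih => simp [PureCtx.subst, ih, Tm.subst_subst]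

theorem EvalCtx.subst_subst (F : EvalCtx) (σ τ : ℕ → Val) :
    (F.subst σ).subst τ = F.subst fun n => (σ n).subst τ := by
  induction F with
  | hole => rfl
  | appR v F ih => simp [EvalCtx.subst, ih, Val.subst_subst]
  | appL F t ih => simp [EvalCtx.subst, ih, Tm.subst_subst]
  | reset F ih => simp [EvalCtx.subst, ih]

@[simp] theorem PureCtx.subst_var (E : PureCtx) : E.subst .var = E := by
  induction E with
  | hole => rfl
  | appR v E ih => simp [PureCtx.subst, ih]
  | appL E t ih => simp [PureCtx.subst, ih]

@[simp] theorem EvalCtx.subst_var (F : EvalCtx) : F.subst .var = F := by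
  induction F with
  | hole => rfl
  | appR v F ih => simp [EvalCtx.subst, ih]
  | appL F t ih => simp [EvalCtx.subst, ih]
  | reset F ih => simp [EvalCtx.subst, ih]

theorem PureCtx.plug_subst (E : PureCtx) (t : Tm) (σ : ℕ → Val) :
    (E.plug t).subst σ = (E.subst σ).plug (t.subst σ) := by
  induction E with
  | hole => rfl
  | appR v E ih => simp [PureCtx.plug, PureCtx.subst, Tm.subst, ih, Val.toTm_subst]
  | appL E t ih => simp [PureCtx.plug, PureCtx.subst, Tm.subst, ih]

theorem EvalCtx.plug_subst (F : EvalCtx) (t : Tm) (σ : ℕ → Val) :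
    (F.plug t).subst σ = (F.subst σ).plug (t.subst σ) := by
  induction F with
  | hole => rfl
  | appR v F ih => simp [EvalCtx.plug, EvalCtx.subst, Tm.subst, ih, Val.toTm_subst]
  | appL F t ih => simp [EvalCtx.plug, EvalCtx.subst, Tm.subst, ih]
  | reset F ih => simp [EvalCtx.plug, EvalCtx.subst, Tm.subst, ih]

theorem PureCtx.plug_comp (E G : PureCtx) (t : Tm) : (E.comp G).plug t = E.plug (G.plug t) := by
  induction E with
  | hole => rfl
  | appR v E ih => simp [PureCtx.comp, PureCtx.plug, ih]
  | appL E t ih => simp [PureCtx.comp, PureCtx.plug, ih]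

theorem EvalCtx.plug_comp (F G : EvalCtx) (t : Tm) : (F.comp G).plug t = F.plug (G.plug t) := by
  induction F with
  | hole => rfl
  | appR v F ih => simp [EvalCtx.comp, EvalCtx.plug, ih]
  | appL F t ih => simp [EvalCtx.comp, EvalCtx.plug, ih]
  | reset F ih => simp [EvalCtx.comp, EvalCtx.plug, ih]

theorem PureCtx.comp_subst (E G : PureCtx) (σ : ℕ → Val) :
    (E.comp G).subst σ = (E.subst σ).comp (G.subst σ) := by
  induction E with
  | hole => rfl
  | appR v E ih => simp [PureCtx.comp, PureCtx.subst, ih]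
  | appL E t ih => simp [PureCtx.comp, PureCtx.subst, ih]

theorem EvalCtx.comp_subst (F G : EvalCtx) (σ : ℕ → Val) :
    (F.comp G).subst σ = (F.subst σ).comp (G.subst σ) := by
  induction F with
  | hole => rfl
  | appR v F ih => simp [EvalCtx.comp, EvalCtx.subst, ih]
  | appL F t ih => simp [EvalCtx.comp, EvalCtx.subst, ih]
  | reset F ih => simp [EvalCtx.comp, EvalCtx.subst, ih]

@[simp] theorem EvalCtx.comp_hole (F : EvalCtx) : F.comp .hole = F := by
  induction F with
  | hole => rfl
  | appR v F ih => simp [EvalCtx.comp, ih]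
  | appL F t ih => simp [EvalCtx.comp, ih]
  | reset F ih => simp [EvalCtx.comp, ih]

theorem EvalCtx.comp_assoc (F G H : EvalCtx) : (F.comp G).comp H = F.comp (G.comp H) := by
  induction F with
  | hole => rfl
  | appR v F ih => simp [EvalCtx.comp, ih]
  | appL F t ih => simp [EvalCtx.comp, ih]
  | reset F ih => simp [EvalCtx.comp, ih]

@[simp] theorem PureCtx.plug_toEval (E : PureCtx) (t : Tm) : E.toEval.plug t = E.plug t := by
  induction E with
  | hole => rfl
  | appR v E ih => simp [PureCtx.toEval, PureCtx.plug, EvalCtx.plug, ih]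
  | appL E t ih => simp [PureCtx.toEval, PureCtx.plug, EvalCtx.plug, ih]

theorem PureCtx.toEval_comp (E G : PureCtx) : (E.comp G).toEval = E.toEval.comp G.toEval := by
  induction E with
  | hole => rfl
  | appR v E ih => simp [PureCtx.toEval, PureCtx.comp, EvalCtx.comp, ih]
  | appL E t ih => simp [PureCtx.toEval, PureCtx.comp, EvalCtx.comp, ih]

theorem PureCtx.toEval_subst (E : PureCtx) (σ : ℕ → Val) :
    (E.subst σ).toEval = E.toEval.subst σ := by
  induction E with
  | hole => rfl
  | appR v E ih => simp [PureCtx.toEval, PureCtx.subst, EvalCtx.subst, ih]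
  | appL E t ih => simp [PureCtx.toEval, PureCtx.subst, EvalCtx.subst, ih]

/-! ### Application to a fresh variable

With de Bruijn indices the fresh variable is `0`, the other variables being shifted. -/

/-- `v • x` for the fresh variable `x`. -/
def Val.body : Val → Tm
  | .var n => .app (.var (n + 1)) (.var 0)
  | .lam t => t

/-- `E[x]` for the fresh variable `x`. -/
def PureCtx.body (E : PureCtx) : Tm := (E.rename Nat.succ).plug (.var 0)

/-- `F[x]` for the fresh variable `x`. -/
def EvalCtx.body (F : EvalCtx) : Tm := (F.rename Nat.succ).plug (.var 0)

/-- `⟨t{λx.⟨k' E[x]⟩/k}⟩` for the fresh variable `k'`. -/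
def ctrlBody (E : PureCtx) (t : Tm) : Tm :=
  .reset ((t.rename (upRen Nat.succ)).inst ((E.rename Nat.succ).reifyWith 0))

theorem PureCtx.reify_eq (E : PureCtx) : E.reify = .lam (.reset E.body) := rfl

/-- This turns plugging into substitution: returning a value to a frame is the same as extending the
environment of the frame's body. It is how a stack frame becomes a term under evaluation in
`Stk.pop`. -/
theorem PureCtx.body_subst_scons (E : PureCtx) (v : Val) (σ : ℕ → Val) :
    E.body.subst (scons v σ) = (E.subst σ).plug v.toTm := by
  simp only [PureCtx.body, PureCtx.plug_subst, PureCtx.rename_eq_subst, PureCtx.subst_subst]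
  rfl

theorem EvalCtx.body_subst_scons (F : EvalCtx) (v : Val) (σ : ℕ → Val) :
    F.body.subst (scons v σ) = (F.subst σ).plug v.toTm := by
  simp only [EvalCtx.body, EvalCtx.plug_subst, EvalCtx.rename_eq_subst, EvalCtx.subst_subst]
  rfl

theorem PureCtx.body_subst_upSub (E : PureCtx) (σ : ℕ → Val) :
    E.body.subst (upSub σ) = (E.subst σ).body := by
  simp only [PureCtx.body, PureCtx.plug_subst, PureCtx.rename_eq_subst, PureCtx.subst_subst,
    Tm.subst, upSub_zero, Val.toTm_var]
  congr 2; funext n; exact Val.rename_eq_subst _ _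

theorem EvalCtx.body_subst_upSub (F : EvalCtx) (σ : ℕ → Val) :
    F.body.subst (upSub σ) = (F.subst σ).body := by
  simp only [EvalCtx.body, EvalCtx.plug_subst, EvalCtx.rename_eq_subst, EvalCtx.subst_subst,
    Tm.subst, upSub_zero, Val.toTm_var]
  congr 2; funext n; exact Val.rename_eq_subst _ _

theorem PureCtx.reify_subst (E : PureCtx) (σ : ℕ → Val) :
    E.reify.subst σ = (E.subst σ).reify := by
  simp only [PureCtx.reify_eq, Val.subst, Tm.subst, PureCtx.body_subst_upSub]

theorem PureCtx.reifyWith_subst (E : PureCtx) (k : ℕ) (σ : ℕ → Val) :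
    (E.reifyWith k).subst σ = (PureCtx.appR (σ k) (E.subst σ)).reify := by
  rw [PureCtx.reifyWith, PureCtx.reify_subst]; rfl

/-- `E[v]` is an instance of the body of `E`. -/
theorem PureCtx.body_inst (E : PureCtx) (v : Val) : E.body.inst v = E.plug v.toTm := by
  rw [Tm.inst_eq, PureCtx.body_subst_scons, PureCtx.subst_var]

/-- The fresh `k'` of the control-stuck clause is a place holder for the rest of the continuation.
Instantiating it by a value `v` amounts to capturing the context `v E`. -/
theorem ctrlBody_subst_scons (E : PureCtx) (t : Tm) (v : Val) (σ : ℕ → Val) :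
    (ctrlBody E t).subst (scons v σ) =
      .reset ((t.subst (upSub σ)).inst (PureCtx.appR v (E.subst σ)).reify) := by
  simp only [ctrlBody, Tm.subst, Tm.inst_subst, PureCtx.reifyWith_subst, Tm.subst_rename,
    PureCtx.rename_eq_subst, PureCtx.subst_subst, upSub_comp_upRen, scons_zero]
  rfl

theorem ctrlBody_subst_upSub (E : PureCtx) (t : Tm) (σ : ℕ → Val) :
    (ctrlBody E t).subst (upSub σ) = ctrlBody (E.subst σ) (t.subst (upSub σ)) := by
  have h : (E.rename Nat.succ).subst (upSub σ) = (E.subst σ).rename Nat.succ := by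
    simp only [PureCtx.rename_eq_subst, PureCtx.subst_subst]
    congr 1; funext n; exact Val.rename_eq_subst _ _
  rw [ctrlBody, Tm.subst, Tm.inst_subst, PureCtx.reifyWith_subst, h, Tm.subst_rename,
    upSub_comp_upRen, ctrlBody, Tm.rename_subst, rename_comp_upSub]
  rfl

/-! ### Decomposition of terms -/

/-- The result of looking for a redex in a term. -/
inductive Decomp : Type
  | val (v : Val)
  | ctrl (E : PureCtx) (t : Tm)
  | opn (F : EvalCtx) (x : ℕ) (v : Val)
  | red (c : ℕ) (t : Tm)

/-- The decomposition of `t s` from the decompositions of `t` and `s`. -/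
def Decomp.app (t s : Tm) : Decomp → Decomp → Decomp
  | .red c t', _ => .red c (.app t' s)
  | .ctrl E b, _ => .ctrl (.appL E s) b
  | .opn F x v, _ => .opn (.appL F s) x v
  | .val _, .red c s' => .red c (.app t s')
  | .val v, .ctrl E b => .ctrl (.appR v E) b
  | .val v, .opn F x u => .opn (.appR v F) x u
  | .val (.lam b), .val u => .red 0 (b.inst u)
  | .val (.var x), .val u => .opn .hole x u

/-- The decomposition of `⟨t⟩` from the decomposition of `t`. -/
def Decomp.reset : Decomp → Decomp
  | .red c t' => .red c (.reset t')
  | .ctrl E b => .red 1 (.reset (b.inst E.reify))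
  | .opn F x v => .opn (.reset F) x v
  | .val v => .red 0 v.toTm

/-- A term is a value, control stuck, open stuck, or reduces in a unique way; the reductions
which capture a context carry the label `1`, the other ones `0`. -/
def decomp : Tm → Decomp
  | .var n => .val (.var n)
  | .lam t => .val (.lam t)
  | .shift t => .ctrl .hole t
  | .app t s => Decomp.app t s (decomp t) (decomp s)
  | .reset t => (decomp t).reset

/-- Labelled reduction. -/
def Step (c : ℕ) (t t' : Tm) : Prop := decomp t = .red c t'

@[simp] theorem decomp_val (v : Val) : decomp v.toTm = .val v := by cases v <;> rfl

theorem decomp_ctrl (E : PureCtx) (t : Tm) : decomp (E.plug (.shift t)) = .ctrl E t := by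
  induction E with
  | hole => rfl
  | appR v E ih => simp [PureCtx.plug, decomp, ih, Decomp.app]
  | appL E t ih => simp [PureCtx.plug, decomp, ih, Decomp.app]

theorem decomp_opn (F : EvalCtx) (x : ℕ) (v : Val) :
    decomp (F.plug (.app (.var x) v.toTm)) = .opn F x v := by
  induction F with
  | hole => simp [EvalCtx.plug, decomp, Decomp.app]
  | appR v E ih => simp [EvalCtx.plug, decomp, ih, Decomp.app]
  | appL E t ih => simp [EvalCtx.plug, decomp, ih, Decomp.app]
  | reset E ih => simp [EvalCtx.plug, decomp, ih, Decomp.reset]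

theorem decomp_plug_red {c : ℕ} {t t' : Tm} (F : EvalCtx) (h : Step c t t') :
    Step c (F.plug t) (F.plug t') := by
  unfold Step at *
  induction F with
  | hole => exact h
  | appR v E ih => simp [EvalCtx.plug, decomp, ih, Decomp.app]
  | appL E t ih => simp [EvalCtx.plug, decomp, ih, Decomp.app]
  | reset E ih => simp [EvalCtx.plug, decomp, ih, Decomp.reset]

/-- The term described by a decomposition. -/
def Decomp.Spec (t : Tm) : Decomp → Prop
  | .val v => t = v.toTm
  | .ctrl E b => t = E.plug (.shift b)
  | .opn F x v => t = F.plug (.app (.var x) v.toTm)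
  | .red c t' =>
    (∃ F b v, c = 0 ∧ t = EvalCtx.plug F (.app (.lam b) (Val.toTm v)) ∧ t' = F.plug (b.inst v)) ∨
    (∃ F E b, c = 1 ∧ t = EvalCtx.plug F (.reset (PureCtx.plug E (.shift b))) ∧
      t' = F.plug (.reset (b.inst E.reify))) ∨
    (∃ F v, c = 0 ∧ t = EvalCtx.plug F (.reset (Val.toTm v)) ∧ t' = F.plug v.toTm)

theorem Decomp.Spec.plug {c : ℕ} {t t' : Tm} (G : EvalCtx) (h : (Decomp.red c t').Spec t) :
    (Decomp.red c (G.plug t')).Spec (G.plug t) := by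
  rcases h with ⟨F, b, v, rfl, rfl, rfl⟩ | ⟨F, E, b, rfl, rfl, rfl⟩ | ⟨F, v, rfl, rfl, rfl⟩
  · exact .inl ⟨G.comp F, b, v, rfl, by simp [EvalCtx.plug_comp], by simp [EvalCtx.plug_comp]⟩
  · exact .inr (.inl ⟨G.comp F, E, b, rfl, by simp [EvalCtx.plug_comp],
      by simp [EvalCtx.plug_comp]⟩)
  · exact .inr (.inr ⟨G.comp F, v, rfl, by simp [EvalCtx.plug_comp], by simp [EvalCtx.plug_comp]⟩)

/-- Soundness of the functional decomposition. With the computation rules for `decomp` it makes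
unique decomposition, and therefore determinism, a matter of rewriting. -/
theorem decomp_spec (t : Tm) : (decomp t).Spec t := by
  induction t with
  | var n => rfl
  | lam t => rfl
  | shift t => rfl
  | app t s iht ihs =>
    simp only [decomp]
    cases ht : decomp t with
    | red c t' => rw [ht] at iht; exact iht.plug (.appL .hole s)
    | ctrl E b => rw [ht] at iht; simp only [Decomp.Spec] at iht; subst iht; rfl
    | opn F x v => rw [ht] at iht; simp only [Decomp.Spec] at iht; subst iht; rfl
    | val v =>
      rw [ht] at iht; simp only [Decomp.Spec] at iht; subst iht
      cases hs : decomp s with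
      | red c t' => rw [hs] at ihs; exact ihs.plug (.appR v .hole)
      | ctrl E b => rw [hs] at ihs; simp only [Decomp.Spec] at ihs; subst ihs; rfl
      | opn F x v => rw [hs] at ihs; simp only [Decomp.Spec] at ihs; subst ihs; rfl
      | val u =>
        rw [hs] at ihs; simp only [Decomp.Spec] at ihs; subst ihs
        cases v with
        | var n => rfl
        | lam b => exact .inl ⟨.hole, b, u, rfl, rfl, rfl⟩
  | reset t ih =>
    simp only [decomp]
    cases ht : decomp t with
    | red c t' => rw [ht] at ih; exact ih.plug (.reset .hole)
    | ctrl E b =>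
      rw [ht] at ih; simp only [Decomp.Spec] at ih; subst ih
      exact .inr (.inl ⟨.hole, E, b, rfl, rfl, rfl⟩)
    | opn F x v => rw [ht] at ih; simp only [Decomp.Spec] at ih; subst ih; rfl
    | val v =>
      rw [ht] at ih; simp only [Decomp.Spec] at ih; subst ih
      exact .inr (.inr ⟨.hole, v, rfl, rfl, rfl⟩)

theorem eq_of_decomp_val {t : Tm} {v : Val} (h : decomp t = .val v) : t = v.toTm := by
  have := decomp_spec t; rwa [h] at this

theorem eq_of_decomp_ctrl {t b : Tm} {E : PureCtx} (h : decomp t = .ctrl E b) :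
    t = E.plug (.shift b) := by
  have := decomp_spec t; rwa [h] at this

theorem eq_of_decomp_opn {t : Tm} {F : EvalCtx} {x : ℕ} {v : Val} (h : decomp t = .opn F x v) :
    t = F.plug (.app (.var x) v.toTm) := by
  have := decomp_spec t; rwa [h] at this

theorem Step.beta (t : Tm) (v : Val) : Step 0 (.app (.lam t) v.toTm) (t.inst v) := by
  simp [Step, decomp, Decomp.app]

theorem Step.capture (E : PureCtx) (t : Tm) :
    Step 1 (.reset (E.plug (.shift t))) (.reset (t.inst E.reify)) := by
  simp [Step, decomp, Decomp.reset, decomp_ctrl]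

theorem Step.resetVal (v : Val) : Step 0 (.reset v.toTm) v.toTm := by
  simp [Step, decomp, Decomp.reset]

theorem red_iff_step {t t' : Tm} : Red t t' ↔ ∃ c, Step c t t' := by
  constructor
  · rintro (⟨F, b, v⟩ | ⟨F, E, b⟩ | ⟨F, v⟩)
    · exact ⟨0, decomp_plug_red F (.beta b v)⟩
    · exact ⟨1, decomp_plug_red F (.capture E b)⟩
    · exact ⟨0, decomp_plug_red F (.resetVal v)⟩
  · rintro ⟨c, h⟩
    have hs := decomp_spec t
    rw [h] at hs
    rcases hs with ⟨F, b, v, rfl, rfl, rfl⟩ | ⟨F, E, b, rfl, rfl, rfl⟩ | ⟨F, v, rfl, rfl, rfl⟩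
    · exact .beta F b v
    · exact .shift F E b
    · exact .reset F v

/-- Only values are substituted, so redexes remain redexes of the same kind and evaluation contexts
remain evaluation contexts. -/
theorem Step.subst {c : ℕ} {t t' : Tm} (h : Step c t t') (σ : ℕ → Val) :
    Step c (t.subst σ) (t'.subst σ) := by
  have hs := decomp_spec t
  rw [h] at hs
  rcases hs with ⟨F, b, v, rfl, rfl, rfl⟩ | ⟨F, E, b, rfl, rfl, rfl⟩ | ⟨F, v, rfl, rfl, rfl⟩
  · simp only [EvalCtx.plug_subst, Tm.inst_subst, Tm.subst, ← Val.toTm_subst]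
    exact decomp_plug_red _ (.beta _ _)
  · simp only [EvalCtx.plug_subst, PureCtx.plug_subst, Tm.inst_subst, Tm.subst,
      PureCtx.reify_subst]
    exact decomp_plug_red _ (.capture _ _)
  · simp only [EvalCtx.plug_subst, Tm.subst, ← Val.toTm_subst]
    exact decomp_plug_red _ (.resetVal _)

theorem Step.det {c d : ℕ} {t t₁ t₂ : Tm} (h₁ : Step c t t₁) (h₂ : Step d t t₂) :
    c = d ∧ t₁ = t₂ := by
  unfold Step at *; rw [h₁] at h₂; simpa using h₂

theorem step_app_inv {c : ℕ} {t s r : Tm} (h : Step c (.app t s) r) :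
    (∃ t', Step c t t' ∧ r = .app t' s) ∨
    (∃ v s', t = Val.toTm v ∧ Step c s s' ∧ r = .app t s') ∨
    (∃ b v, t = .lam b ∧ s = Val.toTm v ∧ c = 0 ∧ r = b.inst v) := by
  simp only [Step, decomp] at h
  cases ht : decomp t with
  | red c' t' =>
    simp only [ht, Decomp.app, Decomp.red.injEq] at h
    obtain ⟨rfl, rfl⟩ := h
    exact .inl ⟨t', ht, rfl⟩
  | ctrl E b => simp [ht, Decomp.app] at h
  | opn F x v => simp [ht, Decomp.app] at h
  | val v =>
    have ht' := eq_of_decomp_val ht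
    cases hs : decomp s with
    | red c' s' =>
      simp only [ht, hs, Decomp.app, Decomp.red.injEq] at h
      obtain ⟨rfl, rfl⟩ := h
      exact .inr (.inl ⟨v, s', ht', hs, rfl⟩)
    | ctrl E b => simp [ht, hs, Decomp.app] at h
    | opn F x v => simp [ht, hs, Decomp.app] at h
    | val u =>
      cases v with
      | var n => simp [ht, hs, Decomp.app] at h
      | lam b =>
        simp only [ht, hs, Decomp.app, Decomp.red.injEq] at h
        exact .inr (.inr ⟨b, u, ht', eq_of_decomp_val hs, h.1.symm, h.2.symm⟩)

theorem step_reset_inv {c : ℕ} {t r : Tm} (h : Step c (.reset t) r) :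
    (∃ t', Step c t t' ∧ r = .reset t') ∨
    (∃ E b, t = PureCtx.plug E (.shift b) ∧ c = 1 ∧ r = .reset (b.inst E.reify)) ∨
    (∃ v, t = Val.toTm v ∧ c = 0 ∧ r = t) := by
  simp only [Step, decomp] at h
  cases ht : decomp t with
  | red c' t' =>
    simp only [ht, Decomp.reset, Decomp.red.injEq] at h
    obtain ⟨rfl, rfl⟩ := h
    exact .inl ⟨t', ht, rfl⟩
  | ctrl E b =>
    simp only [ht, Decomp.reset, Decomp.red.injEq] at h
    exact .inr (.inl ⟨E, b, eq_of_decomp_ctrl ht, h.1.symm, h.2.symm⟩)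
  | opn F x v => simp [ht, Decomp.reset] at h
  | val v =>
    simp only [ht, Decomp.reset, Decomp.red.injEq] at h
    have := eq_of_decomp_val ht
    exact .inr (.inr ⟨v, this, h.1.symm, this ▸ h.2.symm⟩)

/-! ### Reduction sequences -/

/-- `Steps s n t t'`: the term `t` reduces to `t'` in `n` steps, among which `s` steps capture a
context. -/
inductive Steps : ℕ → ℕ → Tm → Tm → Prop
  | refl (t : Tm) : Steps 0 0 t t
  | head {c s n : ℕ} {t u w : Tm} :
      Step c t u → Steps s n u w → Steps (c + s) (n + 1) t w

/-- Irreducible terms. -/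
def Nf (t : Tm) : Prop := ∀ c t', ¬ Step c t t'

theorem Steps.single {c : ℕ} {t t' : Tm} (h : Step c t t') : Steps c 1 t t' :=
  .head h (.refl _)

theorem Steps.trans {s₁ n₁ s₂ n₂ : ℕ} {t₁ t₂ t₃ : Tm} (h₁ : Steps s₁ n₁ t₁ t₂)
    (h₂ : Steps s₂ n₂ t₂ t₃) : Steps (s₁ + s₂) (n₁ + n₂) t₁ t₃ := by
  induction h₁ with
  | refl t => simpa using h₂
  | @head c s n _ _ _ h _ ih =>
    rw [show c + s + s₂ = c + (s + s₂) by ring, show n + 1 + n₂ = n + n₂ + 1 by ring]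
    exact .head h (ih h₂)

theorem Steps.plug {s n : ℕ} {t t' : Tm} (F : EvalCtx) (h : Steps s n t t') :
    Steps s n (F.plug t) (F.plug t') := by
  induction h with
  | refl t => exact .refl _
  | head h _ ih => exact .head (decomp_plug_red F h) ih

theorem Steps.subst {s n : ℕ} {t t' : Tm} (h : Steps s n t t') (σ : ℕ → Val) :
    Steps s n (t.subst σ) (t'.subst σ) := by
  induction h with
  | refl t => exact .refl _
  | head h _ ih => exact .head (h.subst σ) ih

/-- A reduction sequence to an irreducible term starts with any other reduction sequence. -/
theorem Steps.cancel {s₁ n₁ s₂ n₂ : ℕ} {t t₁ t₂ : Tm} (h₁ : Steps s₁ n₁ t t₁)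
    (h₂ : Steps s₂ n₂ t t₂) (hn : Nf t₂) :
    ∃ s n, Steps s n t₁ t₂ ∧ s₂ = s₁ + s ∧ n₂ = n₁ + n := by
  induction h₁ generalizing s₂ n₂ with
  | refl t => exact ⟨s₂, n₂, h₂, by simp⟩
  | @head c s n _ _ _ h _ ih =>
    cases h₂ with
    | refl => exact absurd h (hn _ _)
    | head h' h₂' =>
      obtain ⟨rfl, rfl⟩ := h.det h'
      obtain ⟨s', n', h1, rfl, rfl⟩ := ih h₂'
      exact ⟨s', n', h1, by ring, by ring⟩

theorem Steps.nf_unique {s₁ n₁ s₂ n₂ : ℕ} {t t₁ t₂ : Tm} (h₁ : Steps s₁ n₁ t t₁) (hn₁ : Nf t₁)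
    (h₂ : Steps s₂ n₂ t t₂) (hn₂ : Nf t₂) : t₁ = t₂ := by
  obtain ⟨s, n, h, -, -⟩ := h₁.cancel h₂ hn₂
  cases h with
  | refl => rfl
  | head h' _ => exact absurd h' (hn₁ _ _)

theorem reflTransGen_red_iff {t t' : Tm} :
    Relation.ReflTransGen Red t t' ↔ ∃ s n, Steps s n t t' := by
  constructor
  · intro h
    induction h using Relation.ReflTransGen.head_induction_on with
    | refl => exact ⟨0, 0, .refl _⟩
    | head h _ ih =>
      obtain ⟨s, n, hs⟩ := ih
      obtain ⟨c, hc⟩ := red_iff_step.1 h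
      exact ⟨_, _, .head hc hs⟩
  · rintro ⟨s, n, h⟩
    induction h with
    | refl => exact .refl
    | head h _ ih => exact .head (red_iff_step.2 ⟨_, h⟩) ih

theorem nf_iff {t : Tm} : Nf t ↔ ∀ t', ¬ Red t t' := by
  simp only [red_iff_step, not_exists, Nf]
  exact ⟨fun h t' c => h c t', fun h c t' => h t' c⟩

theorem eval_iff {t t' : Tm} : Eval t t' ↔ (∃ s n, Steps s n t t') ∧ Nf t' := by
  rw [Eval, reflTransGen_red_iff, nf_iff]

theorem Steps.eval {s n : ℕ} {t t' t'' : Tm} (h : Steps s n t t') (h' : Eval t' t'') :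
    Eval t t'' := by
  rw [eval_iff] at *
  obtain ⟨⟨s', n', h1⟩, h2⟩ := h'
  exact ⟨⟨_, _, h.trans h1⟩, h2⟩

theorem Eval.unique {t t₁ t₂ : Tm} (h₁ : Eval t t₁) (h₂ : Eval t t₂) : t₁ = t₂ := by
  rw [eval_iff] at *
  obtain ⟨⟨_, _, a⟩, b⟩ := h₁
  obtain ⟨⟨_, _, c⟩, d⟩ := h₂
  exact a.nf_unique b c d

theorem Nf.eval {t : Tm} (h : Nf t) : Eval t t := eval_iff.2 ⟨⟨_, _, .refl t⟩, h⟩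

/-- If the image of a term under a map that preserves reduction evaluates, then so does the
term. -/
theorem Steps.reflect {f : Tm → Tm} (hf : ∀ c t t', Step c t t' → Step c (f t) (f t'))
    {s n : ℕ} {t u : Tm} (h : Steps s n (f t) u) (hu : Nf u) :
    ∃ s₁ n₁ s₂ n₂ t', Steps s₁ n₁ t t' ∧ Nf t' ∧ Steps s₂ n₂ (f t') u ∧ s = s₁ + s₂ ∧
      n = n₁ + n₂ := by
  induction n using Nat.strong_induction_on generalizing s t with
  | _ n ih =>
    by_cases ht : Nf t
    · exact ⟨0, 0, s, n, t, .refl _, ht, h, by simp⟩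
    · simp only [Nf, not_forall, not_not] at ht
      obtain ⟨c, t', ht'⟩ := ht
      obtain ⟨s', n', h', rfl, rfl⟩ := (Steps.single (hf _ _ _ ht')).cancel h hu
      obtain ⟨s₁, n₁, s₂, n₂, t'', a, b, c, rfl, rfl⟩ := ih n' (by omega) h'
      exact ⟨_, _, _, _, t'', .head ht' a, b, c, by ring, by ring⟩

theorem nf_of_decomp {t : Tm} {d : Decomp} (h : decomp t = d) (hd : ∀ c t', d ≠ .red c t') :
    Nf t := fun c t' hs => hd c t' (h ▸ hs)

theorem nf_val (v : Val) : Nf v.toTm := nf_of_decomp (decomp_val v) (by simp)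

theorem nf_ctrl (E : PureCtx) (t : Tm) : Nf (E.plug (.shift t)) :=
  nf_of_decomp (decomp_ctrl E t) (by simp)

theorem nf_opn (F : EvalCtx) (x : ℕ) (v : Val) : Nf (F.plug (.app (.var x) v.toTm)) :=
  nf_of_decomp (decomp_opn F x v) (by simp)

theorem Nf.cases {t : Tm} (h : Nf t) :
    (∃ v, t = Val.toTm v) ∨ (∃ E b, t = PureCtx.plug E (.shift b)) ∨
      ∃ F x v, t = EvalCtx.plug F (.app (.var x) (Val.toTm v)) := by
  cases ht : decomp t with
  | val v => exact .inl ⟨v, eq_of_decomp_val ht⟩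
  | ctrl E b => exact .inr (.inl ⟨E, b, eq_of_decomp_ctrl ht⟩)
  | opn F x v => exact .inr (.inr ⟨F, x, v, eq_of_decomp_opn ht⟩)
  | red c t' => exact absurd ht (h c t')

theorem Nf.rename {t : Tm} (h : Nf t) (ρ : ℕ → ℕ) : Nf (t.rename ρ) := by
  rw [Tm.rename_eq_subst]
  rcases h.cases with ⟨v, rfl⟩ | ⟨E, b, rfl⟩ | ⟨F, x, v, rfl⟩
  · rw [← Val.toTm_subst]; exact nf_val _
  · rw [PureCtx.plug_subst]; exact nf_ctrl _ _
  · rw [EvalCtx.plug_subst]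
    simp only [Tm.subst, ← Val.toTm_subst]
    exact nf_opn _ _ _

/-! ### Normal form relations with a canonical fresh variable -/

/-- The decomposition of an evaluation context at its innermost reset. -/
def EvalCtx.split : EvalCtx → Option EvalCtx × PureCtx
  | .hole => (none, .hole)
  | .appR v F => match F.split with
    | (none, E) => (none, .appR v E)
    | (some G, E) => (some (.appR v G), E)
  | .appL F t => match F.split with
    | (none, E) => (none, .appL E t)
    | (some G, E) => (some (.appL G t), E)
  | .reset F => match F.split with
    | (none, E) => (some .hole, E)
    | (some G, E) => (some (.reset G), E)

theorem PureCtx.split_toEval (E : PureCtx) : E.toEval.split = (none, E) := by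
  induction E with
  | hole => rfl
  | appR v E ih => simp [PureCtx.toEval, EvalCtx.split, ih]
  | appL E t ih => simp [PureCtx.toEval, EvalCtx.split, ih]

theorem EvalCtx.split_comp (F : EvalCtx) (E : PureCtx) :
    (F.comp (.reset E.toEval)).split = (some F, E) := by
  induction F with
  | hole => simp [EvalCtx.comp, EvalCtx.split, PureCtx.split_toEval]
  | appR v F ih => simp [EvalCtx.comp, EvalCtx.split, ih]
  | appL F t ih => simp [EvalCtx.comp, EvalCtx.split, ih]
  | reset F ih => simp [EvalCtx.comp, EvalCtx.split, ih]

theorem EvalCtx.pure_or_delimited (F : EvalCtx) :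
    (∃ E, F = PureCtx.toEval E) ∨ ∃ G E, F = EvalCtx.comp G (.reset (PureCtx.toEval E)) := by
  induction F with
  | hole => exact .inl ⟨.hole, rfl⟩
  | appR v F ih =>
    rcases ih with ⟨E, rfl⟩ | ⟨G, E, rfl⟩
    · exact .inl ⟨.appR v E, rfl⟩
    · exact .inr ⟨.appR v G, E, rfl⟩
  | appL F t ih =>
    rcases ih with ⟨E, rfl⟩ | ⟨G, E, rfl⟩
    · exact .inl ⟨.appL E t, rfl⟩
    · exact .inr ⟨.appL G t, E, rfl⟩
  | reset F ih =>
    rcases ih with ⟨E, rfl⟩ | ⟨G, E, rfl⟩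
    · exact .inr ⟨.hole, E, rfl⟩
    · exact .inr ⟨.reset G, E, rfl⟩

/-- `CtxRel` with a canonical fresh variable. -/
def CtxR (R : Tm → Tm → Prop) (F₀ F₁ : EvalCtx) : Prop :=
  match F₀.split, F₁.split with
  | (none, E₀), (none, E₁) => R E₀.body E₁.body
  | (some G₀, E₀), (some G₁, E₁) => R G₀.body G₁.body ∧ R (.reset E₀.body) (.reset E₁.body)
  | _, _ => False

/-- `RefinedNF` with a canonical fresh variable. -/
def NF (R : Tm → Tm → Prop) (p q : Tm) : Prop :=
  match decomp p, decomp q with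
  | .val v₀, .val v₁ => R v₀.body v₁.body
  | .ctrl E₀ t₀, .ctrl E₁ t₁ => R (ctrlBody E₀ t₀) (ctrlBody E₁ t₁)
  | .opn F₀ x₀ v₀, .opn F₁ x₁ v₁ => x₀ = x₁ ∧ CtxR R F₀ F₁ ∧ R v₀.body v₁.body
  | _, _ => False

theorem ctxR_iff {R : Tm → Tm → Prop} {F₀ F₁ : EvalCtx} : CtxR R F₀ F₁ ↔
    (∃ E₀ E₁, F₀ = PureCtx.toEval E₀ ∧ F₁ = PureCtx.toEval E₁ ∧ R E₀.body E₁.body) ∨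
    (∃ G₀ G₁ E₀ E₁, F₀ = EvalCtx.comp G₀ (.reset (PureCtx.toEval E₀)) ∧
      F₁ = EvalCtx.comp G₁ (.reset (PureCtx.toEval E₁)) ∧ R G₀.body G₁.body ∧
      R (.reset E₀.body) (.reset E₁.body)) := by
  constructor
  · intro h
    rcases F₀.pure_or_delimited with ⟨E₀, rfl⟩ | ⟨G₀, E₀, rfl⟩ <;>
    rcases F₁.pure_or_delimited with ⟨E₁, rfl⟩ | ⟨G₁, E₁, rfl⟩ <;>
    simp only [CtxR, PureCtx.split_toEval, EvalCtx.split_comp] at h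
    · exact .inl ⟨_, _, rfl, rfl, h⟩
    · exact .inr ⟨_, _, _, _, rfl, rfl, h.1, h.2⟩
  · rintro (⟨E₀, E₁, rfl, rfl, h⟩ | ⟨G₀, G₁, E₀, E₁, rfl, rfl, h⟩)
    · simpa only [CtxR, PureCtx.split_toEval] using h
    · simpa only [CtxR, EvalCtx.split_comp] using h

/-- `NF` is defined by matching on decompositions, which suits composition of relations; this is the
inductive reading, which suits case analysis. -/
theorem nf_rel_iff {R : Tm → Tm → Prop} {p q : Tm} : NF R p q ↔
    (∃ v₀ v₁, p = Val.toTm v₀ ∧ q = Val.toTm v₁ ∧ R v₀.body v₁.body) ∨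
    (∃ E₀ E₁ t₀ t₁, p = PureCtx.plug E₀ (.shift t₀) ∧ q = PureCtx.plug E₁ (.shift t₁) ∧
      R (ctrlBody E₀ t₀) (ctrlBody E₁ t₁)) ∨
    (∃ F₀ F₁ x v₀ v₁, p = EvalCtx.plug F₀ (.app (.var x) (Val.toTm v₀)) ∧
      q = EvalCtx.plug F₁ (.app (.var x) (Val.toTm v₁)) ∧ CtxR R F₀ F₁ ∧
      R v₀.body v₁.body) := by
  constructor
  · intro h
    unfold NF at h
    cases hp : decomp p <;> cases hq : decomp q <;> simp only [hp, hq] at h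
    · exact .inl ⟨_, _, eq_of_decomp_val hp, eq_of_decomp_val hq, h⟩
    · exact .inr (.inl ⟨_, _, _, _, eq_of_decomp_ctrl hp, eq_of_decomp_ctrl hq, h⟩)
    · obtain ⟨rfl, h⟩ := h
      exact .inr (.inr ⟨_, _, _, _, _, eq_of_decomp_opn hp, eq_of_decomp_opn hq, h⟩)
  · rintro (⟨v₀, v₁, rfl, rfl, h⟩ | ⟨E₀, E₁, t₀, t₁, rfl, rfl, h⟩ |
      ⟨F₀, F₁, x, v₀, v₁, rfl, rfl, h⟩)
    · simpa only [NF, decomp_val] using h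
    · simpa only [NF, decomp_ctrl] using h
    · simpa only [NF, decomp_opn, true_and] using h

theorem NF.val {R : Tm → Tm → Prop} {v₀ v₁ : Val} (h : R v₀.body v₁.body) :
    NF R v₀.toTm v₁.toTm := nf_rel_iff.2 (.inl ⟨_, _, rfl, rfl, h⟩)

theorem NF.ctrl {R : Tm → Tm → Prop} {E₀ E₁ : PureCtx} {t₀ t₁ : Tm}
    (h : R (ctrlBody E₀ t₀) (ctrlBody E₁ t₁)) :
    NF R (E₀.plug (.shift t₀)) (E₁.plug (.shift t₁)) :=
  nf_rel_iff.2 (.inr (.inl ⟨_, _, _, _, rfl, rfl, h⟩))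

theorem NF.opn {R : Tm → Tm → Prop} {F₀ F₁ : EvalCtx} {x : ℕ} {v₀ v₁ : Val}
    (hF : CtxR R F₀ F₁) (hv : R v₀.body v₁.body) :
    NF R (F₀.plug (.app (.var x) v₀.toTm)) (F₁.plug (.app (.var x) v₁.toTm)) :=
  nf_rel_iff.2 (.inr (.inr ⟨_, _, _, _, _, rfl, rfl, hF, hv⟩))

theorem NF.mono {R S : Tm → Tm → Prop} (h : ∀ a b, R a b → S a b) {p q : Tm}
    (hn : NF R p q) : NF S p q := by
  unfold NF at *
  split at hn
  · exact h _ _ hn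
  · exact h _ _ hn
  · refine ⟨hn.1, ?_, h _ _ hn.2.2⟩
    have := hn.2.1
    unfold CtxR at *
    split at this
    · exact h _ _ this
    · exact ⟨h _ _ this.1, h _ _ this.2⟩
    · exact this
  · exact hn

theorem NF.flip {R : Tm → Tm → Prop} {p q : Tm} (hn : NF R p q) :
    NF (fun a b => R b a) q p := by
  rcases nf_rel_iff.1 hn with ⟨v₀, v₁, rfl, rfl, h⟩ | ⟨E₀, E₁, t₀, t₁, rfl, rfl, h⟩ |
      ⟨F₀, F₁, x, v₀, v₁, rfl, rfl, hF, hv⟩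
  · exact .val h
  · exact .ctrl h
  · refine .opn ?_ hv
    rcases ctxR_iff.1 hF with ⟨E₀, E₁, rfl, rfl, h⟩ | ⟨G₀, G₁, E₀, E₁, rfl, rfl, h⟩
    · exact ctxR_iff.2 (.inl ⟨_, _, rfl, rfl, h⟩)
    · exact ctxR_iff.2 (.inr ⟨_, _, _, _, rfl, rfl, h⟩)

theorem CtxR.trans {R S : Tm → Tm → Prop} {F G H : EvalCtx} (h₁ : CtxR R F G)
    (h₂ : CtxR S G H) : CtxR (fun a c => ∃ b, R a b ∧ S b c) F H := by
  unfold CtxR at *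
  rcases hF : F.split with ⟨_ | F', E₁⟩ <;> rcases hG : G.split with ⟨_ | G', E₂⟩ <;>
    simp only [hF, hG] at h₁ <;> rcases hH : H.split with ⟨_ | H', E₃⟩ <;>
    simp only [hG, hH] at h₂ ⊢
  · exact ⟨_, h₁, h₂⟩
  · exact ⟨⟨_, h₁.1, h₂.1⟩, ⟨_, h₁.2, h₂.2⟩⟩

/-- The middle term has a single decomposition, and its context a single split at the innermost
reset, so the two witnesses must agree on them. -/
theorem NF.trans {R S : Tm → Tm → Prop} {p q r : Tm} (h₁ : NF R p q) (h₂ : NF S q r) :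
    NF (fun a c => ∃ b, R a b ∧ S b c) p r := by
  unfold NF at *
  cases hp : decomp p <;> cases hq : decomp q <;> simp only [hp, hq] at h₁ <;>
    cases hr : decomp r <;> simp only [hq, hr] at h₂ ⊢
  · exact ⟨_, h₁, h₂⟩
  · exact ⟨_, h₁, h₂⟩
  · exact ⟨h₁.1.trans h₂.1, h₁.2.1.trans h₂.2.1, _, h₁.2.2, h₂.2.2⟩

theorem NF.refl {R : Tm → Tm → Prop} (hR : ∀ t, R t t) {p : Tm} (hp : Nf p) : NF R p p := by
  rcases hp.cases with ⟨v, rfl⟩ | ⟨E, b, rfl⟩ | ⟨F, x, v, rfl⟩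
  · exact .val (hR _)
  · exact .ctrl (hR _)
  · refine .opn ?_ (hR _)
    rcases F.pure_or_delimited with ⟨E, rfl⟩ | ⟨G, E, rfl⟩
    · exact ctxR_iff.2 (.inl ⟨_, _, rfl, rfl, hR _⟩)
    · exact ctxR_iff.2 (.inr ⟨_, _, _, _, rfl, rfl, hR _, hR _⟩)

/-! ### Free variables -/

theorem Tm.rename_congr (t : Tm) {ρ ξ : ℕ → ℕ} (h : ∀ x, t.Free x → ρ x = ξ x) :
    t.rename ρ = t.rename ξ := by
  have key : ∀ (t : Tm) (ρ ξ : ℕ → ℕ), (∀ x, t.Free (x + 1) → ρ x = ξ x) →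
      ∀ x, t.Free x → upRen ρ x = upRen ξ x := by
    intro t ρ ξ h x hx
    cases x with
    | zero => rfl
    | succ x => simp [h x hx]
  induction t generalizing ρ ξ with
  | var n => simp [Tm.rename, h n rfl]
  | lam t ih => simp only [Tm.rename]; rw [ih (key t ρ ξ h)]
  | shift t ih => simp only [Tm.rename]; rw [ih (key t ρ ξ h)]
  | reset t ih => simp only [Tm.rename]; rw [ih h]
  | app t s iht ihs =>
    simp only [Tm.rename]
    rw [iht fun x hx => h x (.inl hx), ihs fun x hx => h x (.inr hx)]

theorem Tm.exists_fresh (t : Tm) : ∃ N, ∀ x, N ≤ x → ¬ t.Free x := by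
  induction t with
  | var n => exact ⟨n + 1, fun x hx h => by simp only [Tm.Free] at h; omega⟩
  | lam t ih => obtain ⟨N, h⟩ := ih; exact ⟨N, fun x hx => h (x + 1) (by omega)⟩
  | shift t ih => obtain ⟨N, h⟩ := ih; exact ⟨N, fun x hx => h (x + 1) (by omega)⟩
  | reset t ih => exact ih
  | app t s iht ihs =>
    obtain ⟨N, h⟩ := iht
    obtain ⟨M, h'⟩ := ihs
    exact ⟨max N M, fun x hx hf => hf.elim (h x (by omega)) (h' x (by omega))⟩

theorem exists_fresh_pair (t s : Tm) : ∃ x, ¬ t.Free x ∧ ¬ s.Free x := by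
  obtain ⟨N, h⟩ := t.exists_fresh
  obtain ⟨M, h'⟩ := s.exists_fresh
  exact ⟨max N M, h _ (by omega), h' _ (by omega)⟩

theorem PureCtx.free_plug (E : PureCtx) (t : Tm) (x : ℕ) :
    (E.plug t).Free x ↔ E.Free x ∨ t.Free x := by
  induction E with
  | hole => simp [PureCtx.plug, PureCtx.Free]
  | appR v E ih => simp [PureCtx.plug, PureCtx.Free, Tm.Free, ih, or_assoc]
  | appL E t ih => simp only [PureCtx.plug, PureCtx.Free, Tm.Free, ih]; tauto

theorem EvalCtx.free_plug (F : EvalCtx) (t : Tm) (x : ℕ) :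
    (F.plug t).Free x ↔ F.Free x ∨ t.Free x := by
  induction F with
  | hole => simp [EvalCtx.plug, EvalCtx.Free]
  | appR v F ih => simp [EvalCtx.plug, EvalCtx.Free, Tm.Free, ih, or_assoc]
  | appL F t ih => simp only [EvalCtx.plug, EvalCtx.Free, Tm.Free, ih]; tauto
  | reset F ih => simp only [EvalCtx.plug, EvalCtx.Free, Tm.Free, ih]

theorem PureCtx.plug_rename (E : PureCtx) (t : Tm) (ρ : ℕ → ℕ) :
    (E.plug t).rename ρ = (E.rename ρ).plug (t.rename ρ) := by
  simp only [Tm.rename_eq_subst, PureCtx.rename_eq_subst, PureCtx.plug_subst]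

theorem EvalCtx.plug_rename (F : EvalCtx) (t : Tm) (ρ : ℕ → ℕ) :
    (F.plug t).rename ρ = (F.rename ρ).plug (t.rename ρ) := by
  simp only [Tm.rename_eq_subst, EvalCtx.rename_eq_subst, EvalCtx.plug_subst]

theorem Val.rename_congr (v : Val) {ρ ξ : ℕ → ℕ} (h : ∀ x, v.toTm.Free x → ρ x = ξ x) :
    v.rename ρ = v.rename ξ := by
  rw [← Val.toTm_inj, Val.toTm_rename, Val.toTm_rename, Tm.rename_congr _ h]

theorem PureCtx.rename_congr (E : PureCtx) {ρ ξ : ℕ → ℕ} (h : ∀ x, E.Free x → ρ x = ξ x) :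
    E.rename ρ = E.rename ξ := by
  induction E with
  | hole => rfl
  | appR v E ih =>
    simp only [PureCtx.rename]
    rw [ih fun x hx => h x (.inr hx), Val.rename_congr v fun x hx => h x (.inl hx)]
  | appL E t ih =>
    simp only [PureCtx.rename]
    rw [ih fun x hx => h x (.inl hx), Tm.rename_congr t fun x hx => h x (.inr hx)]

theorem EvalCtx.rename_congr (F : EvalCtx) {ρ ξ : ℕ → ℕ} (h : ∀ x, F.Free x → ρ x = ξ x) :
    F.rename ρ = F.rename ξ := by
  induction F with
  | hole => rfl
  | appR v F ih =>
    simp only [EvalCtx.rename]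
    rw [ih fun x hx => h x (.inr hx), Val.rename_congr v fun x hx => h x (.inl hx)]
  | appL F t ih =>
    simp only [EvalCtx.rename]
    rw [ih fun x hx => h x (.inl hx), Tm.rename_congr t fun x hx => h x (.inr hx)]
  | reset F ih => simp only [EvalCtx.rename]; rw [ih h]

theorem bindRen_self (x : ℕ) : bindRen x x = 0 := by simp [bindRen]

theorem bindRen_of_ne {x n : ℕ} (h : n ≠ x) : bindRen x n = n + 1 := by simp [bindRen, h]

/-- The renaming that replaces the fresh variable by `x`. -/
def unbindRen (x : ℕ) : ℕ → ℕ
  | 0 => x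
  | n + 1 => n

theorem PureCtx.plug_var_rename_bindRen {E : PureCtx} {x : ℕ} (h : ¬ E.Free x) :
    (E.plug (.var x)).rename (bindRen x) = E.body := by
  rw [PureCtx.plug_rename, PureCtx.body,
    E.rename_congr (ξ := Nat.succ) fun y hy => bindRen_of_ne (by rintro rfl; exact h hy)]
  simp [Tm.rename, bindRen_self]

theorem EvalCtx.plug_var_rename_bindRen {F : EvalCtx} {x : ℕ} (h : ¬ F.Free x) :
    (F.plug (.var x)).rename (bindRen x) = F.body := by
  rw [EvalCtx.plug_rename, EvalCtx.body,
    F.rename_congr (ξ := Nat.succ) fun y hy => bindRen_of_ne (by rintro rfl; exact h hy)]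
  simp [Tm.rename, bindRen_self]

theorem Tm.inst_var (t : Tm) (x : ℕ) : t.inst (.var x) = t.rename (unbindRen x) := by
  rw [Tm.inst_eq, Tm.rename_eq_subst]; congr 1; funext n; cases n <;> rfl

theorem Tm.rename_id (t : Tm) : t.rename id = t := by
  rw [Tm.rename_eq_subst]; exact t.subst_var

theorem Val.appVar_rename_bindRen {v : Val} {x : ℕ} (h : ¬ v.toTm.Free x) :
    (v.appVar x).rename (bindRen x) = v.body := by
  cases v with
  | var n =>
    have : n ≠ x := fun e => h e.symm
    simp [Val.appVar, Tm.rename, Val.body, bindRen_self, bindRen_of_ne this]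
  | lam t =>
    rw [Val.appVar, Tm.inst_var, Tm.rename_rename, Val.body]
    conv_rhs => rw [← t.rename_id]
    apply Tm.rename_congr
    intro y hy
    cases y with
    | zero => simp [unbindRen, bindRen_self]
    | succ y =>
      have : y ≠ x := by rintro rfl; exact h hy
      simp [unbindRen, bindRen_of_ne this]

theorem ctrlBody_eq_rename_bindRen {E : PureCtx} {t : Tm} {k : ℕ}
    (h : ¬ (E.plug (.shift t)).Free k) :
    (Tm.reset (t.inst (E.reifyWith k))).rename (bindRen k) = ctrlBody E t := by
  rw [PureCtx.free_plug, not_or] at h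
  have hE : E.rename (bindRen k) = E.rename Nat.succ :=
    E.rename_congr fun y hy => bindRen_of_ne (by rintro rfl; exact h.1 hy)
  have ht : t.rename (upRen (bindRen k)) = t.rename (upRen Nat.succ) := by
    apply Tm.rename_congr
    intro y hy
    cases y with
    | zero => rfl
    | succ y =>
      have : y ≠ k := by rintro rfl; exact h.2 hy
      simp [bindRen_of_ne this]
  rw [Tm.rename_eq_subst, Tm.subst, Tm.inst_subst, PureCtx.reifyWith_subst, upSub_var_comp,
    ← Tm.rename_eq_subst, ← PureCtx.rename_eq_subst, hE, ht, Function.comp_apply, bindRen_self]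
  rfl

theorem PureCtx.body_rename_unbindRen (E : PureCtx) (x : ℕ) :
    E.body.rename (unbindRen x) = E.plug (.var x) := by
  rw [← Tm.inst_var, PureCtx.body_inst]; rfl

theorem EvalCtx.body_rename_unbindRen (F : EvalCtx) (x : ℕ) :
    F.body.rename (unbindRen x) = F.plug (.var x) := by
  rw [← Tm.inst_var, Tm.inst_eq, EvalCtx.body_subst_scons, EvalCtx.subst_var]; rfl

theorem Val.body_rename_unbindRen (v : Val) (x : ℕ) :
    v.body.rename (unbindRen x) = v.appVar x := by
  cases v with
  | var n => rfl
  | lam t => exact (Tm.inst_var t x).symm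

theorem ctrlBody_rename_unbindRen (E : PureCtx) (t : Tm) (k : ℕ) :
    (ctrlBody E t).rename (unbindRen k) = .reset (t.inst (E.reifyWith k)) := by
  rw [← Tm.inst_var, Tm.inst_eq, ctrlBody_subst_scons, upSub_var, Tm.subst_var, PureCtx.subst_var]
  rfl

/-! ### Relations closed under renaming -/

def RenClosed (R : Tm → Tm → Prop) : Prop :=
  ∀ a b ρ, R a b → R (a.rename ρ) (b.rename ρ)

/-- The closure of a relation under renaming. -/
def RenC (R : Tm → Tm → Prop) (a b : Tm) : Prop :=
  ∃ a' b' ρ, R a' b' ∧ a = a'.rename ρ ∧ b = b'.rename ρ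

theorem renC_renClosed (R : Tm → Tm → Prop) : RenClosed (RenC R) := by
  rintro _ _ ξ ⟨a, b, ρ, h, rfl, rfl⟩
  exact ⟨a, b, ξ ∘ ρ, h, Tm.rename_rename _ _ _, Tm.rename_rename _ _ _⟩

/-- A fresh variable chosen by name is moved to index `0` by the renaming `bindRen x`, which shifts
all other variables; hence the closure of `R` under renaming. -/
theorem RefinedNF.toNF {R : Tm → Tm → Prop} {p q : Tm} (h : RefinedNF R p q) :
    NF (RenC R) p q := by
  have hv : ∀ v₀ v₁, ValRel R v₀ v₁ → RenC R v₀.body v₁.body := by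
    rintro v₀ v₁ ⟨x, h0, h1, h⟩
    exact ⟨_, _, bindRen x, h, (Val.appVar_rename_bindRen h0).symm,
      (Val.appVar_rename_bindRen h1).symm⟩
  cases h with
  | value v₀ v₁ h => exact .val (hv _ _ h)
  | control E₀ E₁ t₀ t₁ k h0 h1 h =>
    exact .ctrl ⟨_, _, bindRen k, h, (ctrlBody_eq_rename_bindRen h0).symm,
      (ctrlBody_eq_rename_bindRen h1).symm⟩
  | openStuck x F₀ F₁ v₀ v₁ hF h =>
    refine .opn ?_ (hv _ _ h)
    cases hF with
    | pure E₀ E₁ x h0 h1 h =>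
      exact ctxR_iff.2 (.inl ⟨_, _, rfl, rfl, _, _, bindRen x, h,
        (PureCtx.plug_var_rename_bindRen h0).symm, (PureCtx.plug_var_rename_bindRen h1).symm⟩)
    | delimited F₀ F₁ E₀ E₁ x h0 h1 h2 h3 h h' =>
      refine ctxR_iff.2 (.inr ⟨_, _, _, _, rfl, rfl, ⟨_, _, bindRen x, h,
        (EvalCtx.plug_var_rename_bindRen h0).symm, (EvalCtx.plug_var_rename_bindRen h1).symm⟩,
        ⟨_, _, bindRen x, h', ?_, ?_⟩⟩)
      · rw [Tm.rename, PureCtx.plug_var_rename_bindRen h2]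
      · rw [Tm.rename, PureCtx.plug_var_rename_bindRen h3]

/-- Conversely, index `0` is renamed to a name avoiding the finitely many free variables on both
sides. -/
theorem NF.toRefinedNF {R : Tm → Tm → Prop} (hR : RenClosed R) {p q : Tm} (hn : NF R p q) :
    RefinedNF R p q := by
  have hv : ∀ v₀ v₁, R v₀.body v₁.body → ValRel R v₀ v₁ := by
    intro v₀ v₁ h
    obtain ⟨x, h0, h1⟩ := exists_fresh_pair v₀.toTm v₁.toTm
    refine ⟨x, h0, h1, ?_⟩
    rw [← Val.body_rename_unbindRen, ← Val.body_rename_unbindRen]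
    exact hR _ _ _ h
  rcases nf_rel_iff.1 hn with ⟨v₀, v₁, rfl, rfl, h⟩ | ⟨E₀, E₁, t₀, t₁, rfl, rfl, h⟩ |
      ⟨F₀, F₁, x, v₀, v₁, rfl, rfl, hF, h⟩
  · exact .value _ _ (hv _ _ h)
  · obtain ⟨k, h0, h1⟩ := exists_fresh_pair (E₀.plug (.shift t₀)) (E₁.plug (.shift t₁))
    refine .control _ _ _ _ k h0 h1 ?_
    rw [← ctrlBody_rename_unbindRen, ← ctrlBody_rename_unbindRen]
    exact hR _ _ _ h
  · refine .openStuck _ _ _ _ _ ?_ (hv _ _ h)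
    rcases ctxR_iff.1 hF with ⟨E₀, E₁, rfl, rfl, h⟩ | ⟨G₀, G₁, E₀, E₁, rfl, rfl, h, h'⟩
    · obtain ⟨x, h0, h1⟩ := exists_fresh_pair (E₀.plug (.lam (.var 0))) (E₁.plug (.lam (.var 0)))
      rw [PureCtx.free_plug, not_or] at h0 h1
      refine .pure _ _ x h0.1 h1.1 ?_
      rw [← PureCtx.body_rename_unbindRen, ← PureCtx.body_rename_unbindRen]
      exact hR _ _ _ h
    · obtain ⟨x, h0, h1⟩ := exists_fresh_pair (G₀.plug (E₀.plug (.var 0)))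
        (G₁.plug (E₁.plug (.var 0)))
      rw [EvalCtx.free_plug, PureCtx.free_plug, not_or, not_or] at h0 h1
      refine .delimited _ _ _ _ x h0.1 h1.1 h0.2.1 h1.2.1 ?_ ?_
      · rw [← EvalCtx.body_rename_unbindRen, ← EvalCtx.body_rename_unbindRen]
        exact hR _ _ _ h
      · rw [← PureCtx.body_rename_unbindRen, ← PureCtx.body_rename_unbindRen]
        exact hR _ _ (unbindRen x) h'

theorem Val.body_rename (v : Val) (ρ : ℕ → ℕ) : (v.rename ρ).body = v.body.rename (upRen ρ) := by
  cases v <;> rfl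

theorem NF.rename {R : Tm → Tm → Prop} (hR : RenClosed R) {p q : Tm} (hn : NF R p q)
    (ρ : ℕ → ℕ) : NF R (p.rename ρ) (q.rename ρ) := by
  have up : ∀ a b, R a b → R (a.subst (upSub (Val.var ∘ ρ))) (b.subst (upSub (Val.var ∘ ρ))) := by
    intro a b h
    rw [upSub_var_comp, ← Tm.rename_eq_subst, ← Tm.rename_eq_subst]
    exact hR _ _ _ h
  rcases nf_rel_iff.1 hn with ⟨v₀, v₁, rfl, rfl, h⟩ | ⟨E₀, E₁, t₀, t₁, rfl, rfl, h⟩ |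
      ⟨F₀, F₁, x, v₀, v₁, rfl, rfl, hF, hv⟩
  · rw [← Val.toTm_rename, ← Val.toTm_rename]
    refine .val ?_
    rw [Val.body_rename, Val.body_rename]; exact hR _ _ _ h
  · simp only [Tm.rename_eq_subst, PureCtx.plug_subst, Tm.subst]
    refine .ctrl ?_
    rw [← ctrlBody_subst_upSub, ← ctrlBody_subst_upSub]; exact up _ _ h
  · simp only [EvalCtx.plug_rename, Tm.rename, ← Val.toTm_rename]
    refine .opn ?_ ?_
    · simp only [EvalCtx.rename_eq_subst]
      rcases ctxR_iff.1 hF with ⟨E₀, E₁, rfl, rfl, h⟩ | ⟨G₀, G₁, E₀, E₁, rfl, rfl, h, h'⟩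
      · refine ctxR_iff.2 (.inl ⟨_, _, (PureCtx.toEval_subst _ _).symm,
          (PureCtx.toEval_subst _ _).symm, ?_⟩)
        rw [← PureCtx.body_subst_upSub, ← PureCtx.body_subst_upSub]; exact up _ _ h
      · simp only [EvalCtx.comp_subst, EvalCtx.subst, ← PureCtx.toEval_subst]
        refine ctxR_iff.2 (.inr ⟨_, _, _, _, rfl, rfl, ?_, ?_⟩)
        · rw [← EvalCtx.body_subst_upSub, ← EvalCtx.body_subst_upSub]; exact up _ _ h
        · rw [← PureCtx.body_subst_upSub, ← PureCtx.body_subst_upSub]; exact up _ _ h'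
    · rw [Val.body_rename, Val.body_rename]; exact hR _ _ _ hv

/-! ### Bisimilarity is an equivalence relation closed under renaming -/

theorem isRefinedBisimulation_of_renClosed {R : Tm → Tm → Prop} (hR : RenClosed R)
    (h₁ : ∀ p q p', R p q → Eval p p' → ∃ q', Eval q q' ∧ NF R p' q')
    (h₂ : ∀ p q q', R p q → Eval q q' → ∃ p', Eval p p' ∧ NF R p' q') :
    IsRefinedBisimulation R := by
  refine ⟨fun p q p' h he => ?_, fun q p q' h he => ?_⟩
  · obtain ⟨q', hq, hn⟩ := h₁ p q p' h he
    exact ⟨q', hq, hn.toRefinedNF hR⟩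
  · obtain ⟨p', hp, hn⟩ := h₂ p q q' h he
    have hR' : RenClosed fun a b => R b a := fun a b ρ h => hR _ _ _ h
    exact ⟨p', hp, hn.flip.toRefinedNF hR'⟩

theorem RefinedBisimilar.symm {p q : Tm} (h : RefinedBisimilar p q) : RefinedBisimilar q p := by
  obtain ⟨R, hR, h⟩ := h
  exact ⟨fun a b => R b a, ⟨hR.2, hR.1⟩, h⟩

/-- Renaming reflects evaluation. -/
theorem Eval.reflect_rename {t u : Tm} {ρ : ℕ → ℕ} (h : Eval (t.rename ρ) u) :
    ∃ t', Eval t t' ∧ u = t'.rename ρ := by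
  obtain ⟨⟨s, n, hs⟩, hn⟩ := eval_iff.1 h
  have hf : ∀ c t t', Step c t t' → Step c (t.rename ρ) (t'.rename ρ) := by
    intro c t t' h
    simp only [Tm.rename_eq_subst]
    exact h.subst _
  obtain ⟨s₁, n₁, s₂, n₂, t', h1, h2, h3, -, -⟩ := hs.reflect hf hn
  exact ⟨t', eval_iff.2 ⟨⟨_, _, h1⟩, h2⟩, h3.nf_unique hn (.refl _) (h2.rename ρ)⟩

theorem Eval.rename {t u : Tm} (h : Eval t u) (ρ : ℕ → ℕ) :
    Eval (t.rename ρ) (u.rename ρ) := by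
  obtain ⟨⟨s, n, hs⟩, hn⟩ := eval_iff.1 h
  refine eval_iff.2 ⟨⟨s, n, ?_⟩, hn.rename ρ⟩
  simp only [Tm.rename_eq_subst]
  exact hs.subst _

/-- The closure of bisimilarity under renaming is itself a refined bisimulation. The point is that
renaming, even when not injective, replaces variables by variables: it creates no redex, so every
evaluation of a renamed term is a renamed evaluation. From here on the choice of fresh variable is
immaterial and `NF` can replace `RefinedNF`. -/
theorem refinedBisimilar_renClosed : RenClosed RefinedBisimilar := by
  have key : ∀ p q p', RenC RefinedBisimilar p q → Eval p p' →
      ∃ q', Eval q q' ∧ NF (RenC RefinedBisimilar) p' q' := by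
    rintro _ _ p' ⟨p, q, ρ, h, rfl, rfl⟩ he
    obtain ⟨p', hp, rfl⟩ := he.reflect_rename
    obtain ⟨q', hq, hn⟩ := refinedBisimilar_isGreatest.1.1 _ _ _ h hp
    exact ⟨_, hq.rename ρ, hn.toNF.rename (renC_renClosed _) ρ⟩
  have hs : ∀ p q, RenC RefinedBisimilar p q → RenC RefinedBisimilar q p := by
    rintro _ _ ⟨p, q, ρ, h, rfl, rfl⟩
    exact ⟨q, p, ρ, h.symm, rfl, rfl⟩
  intro a b ρ h
  refine ⟨RenC RefinedBisimilar, isRefinedBisimulation_of_renClosed (renC_renClosed _) key ?_,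
    a, b, ρ, h, rfl, rfl⟩
  intro p q q' h he
  obtain ⟨p', hp, hn⟩ := key q p q' (hs _ _ h) he
  exact ⟨p', hp, hn.flip.mono fun a b h => hs _ _ h⟩

theorem RefinedBisimilar.eval {p q p' : Tm} (h : RefinedBisimilar p q) (he : Eval p p') :
    ∃ q', Eval q q' ∧ NF RefinedBisimilar p' q' := by
  obtain ⟨q', hq, hn⟩ := refinedBisimilar_isGreatest.1.1 _ _ _ h he
  refine ⟨q', hq, hn.toNF.mono ?_⟩
  rintro _ _ ⟨a, b, ρ, h, rfl, rfl⟩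
  exact refinedBisimilar_renClosed _ _ _ h

theorem RefinedBisimilar.of_symmetric {R : Tm → Tm → Prop} (hR : RenClosed R)
    (hs : ∀ p q, R p q → R q p)
    (h : ∀ p q p', R p q → Eval p p' → ∃ q', Eval q q' ∧ NF R p' q') {p q : Tm} (hpq : R p q) :
    RefinedBisimilar p q := by
  refine ⟨R, isRefinedBisimulation_of_renClosed hR h ?_, hpq⟩
  intro p q q' hpq he
  obtain ⟨p', hp, hn⟩ := h q p q' (hs _ _ hpq) he
  exact ⟨p', hp, hn.flip.mono fun a b h => hs _ _ h⟩

theorem RefinedBisimilar.refl (t : Tm) : RefinedBisimilar t t :=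
  .of_symmetric (R := Eq) (by rintro a _ ρ rfl; rfl) (fun _ _ h => h.symm)
    (by rintro p _ p' rfl he; exact ⟨p', he, .refl (fun _ => rfl) (eval_iff.1 he).2⟩) rfl

theorem RefinedBisimilar.trans {p q r : Tm} (h₁ : RefinedBisimilar p q)
    (h₂ : RefinedBisimilar q r) : RefinedBisimilar p r := by
  refine .of_symmetric (R := fun a c => ∃ b, RefinedBisimilar a b ∧ RefinedBisimilar b c)
    ?_ ?_ ?_ ⟨q, h₁, h₂⟩
  · rintro a c ρ ⟨b, h, h'⟩
    exact ⟨_, refinedBisimilar_renClosed _ _ ρ h, refinedBisimilar_renClosed _ _ ρ h'⟩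
  · rintro a c ⟨b, h, h'⟩
    exact ⟨b, h'.symm, h.symm⟩
  · rintro a c a' ⟨b, h, h'⟩ he
    obtain ⟨b', hb, hn⟩ := h.eval he
    obtain ⟨c', hc, hn'⟩ := h'.eval hb
    exact ⟨c', hc, hn.trans hn'⟩

/-- Irreducible terms related by the normal form relation of bisimilarity are bisimilar. -/
theorem RefinedBisimilar.of_nf {p q : Tm} (hp : Nf p) (hq : Nf q)
    (h : NF RefinedBisimilar p q) : RefinedBisimilar p q := by
  let R : Tm → Tm → Prop := fun a b => RefinedBisimilar a b ∨
    (Nf a ∧ Nf b ∧ NF RefinedBisimilar a b)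
  have hmono : ∀ a b, RefinedBisimilar a b → R a b := fun _ _ h => .inl h
  refine .of_symmetric (R := R) ?_ ?_ ?_ (.inr ⟨hp, hq, h⟩)
  · rintro a b ρ (h | ⟨ha, hb, h⟩)
    · exact .inl (refinedBisimilar_renClosed _ _ _ h)
    · exact .inr ⟨ha.rename ρ, hb.rename ρ, h.rename refinedBisimilar_renClosed ρ⟩
  · rintro a b (h | ⟨ha, hb, h⟩)
    · exact .inl h.symm
    · exact .inr ⟨hb, ha, h.flip.mono fun _ _ h => h.symm⟩
  · rintro a b a' (h | ⟨ha, hb, h⟩) he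
    · obtain ⟨b', hb, hn⟩ := h.eval he
      exact ⟨b', hb, hn.mono hmono⟩
    · obtain rfl := he.unique ha.eval
      exact ⟨b, hb.eval, h.mono hmono⟩

/-! ### Administrative reductions

Capturing a context piece by piece differs from capturing it at once by administrative redexes:
`⟨E[t]⟩` corresponds to `⟨(λx.⟨E[x]⟩) t⟩`, and `⟨t⟩` to `⟨⟨t⟩⟩`. -/

/-- Terms equal up to administrative redexes on the right-hand side. -/
inductive Adm : Tm → Tm → Prop
  | var (n : ℕ) : Adm (.var n) (.var n)
  | lam {t s : Tm} : Adm t s → Adm (.lam t) (.lam s)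
  | app {t s t' s' : Tm} : Adm t s → Adm t' s' → Adm (.app t t') (.app s s')
  | shift {t s : Tm} : Adm t s → Adm (.shift t) (.shift s)
  | reset {t s : Tm} : Adm t s → Adm (.reset t) (.reset s)
  -- If `t` were a value, the left side could step using `E` and `t` together. That case is covered
  -- by `expand` and `double` instead (see `delay_any`).
  | delay {E : PureCtx} {e t s : Tm} : Adm E.body e → Adm t s → ¬ t.IsValue →
      Adm (.reset (E.plug t)) (.reset (.app (.lam (.reset e)) s))
  | double {t q : Tm} : Adm (.reset t) q → Adm (.reset t) (.reset q)
  -- Only label `0` is allowed, so administrative steps never change the number of captures.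
  | expand {p q q' : Tm} : Step 0 q q' → Adm p q' → Adm p q

namespace Adm

theorem refl (t : Tm) : Adm t t := by
  induction t with
  | var n => exact .var n
  | lam t ih => exact .lam ih
  | app t s iht ihs => exact .app iht ihs
  | shift t ih => exact .shift ih
  | reset t ih => exact .reset ih

theorem expands {s n : ℕ} {p q q' : Tm} (h : Steps s n q q') (hs : s = 0) (hp : Adm p q') :
    Adm p q := by
  induction h with
  | refl => exact hp
  | @head c s n _ _ _ h _ ih =>
    obtain rfl : c = 0 := by omega
    exact .expand h (ih (by omega) hp)

theorem _root_.ShiftReset.Tm.isValue_of_subst {t : Tm} {σ : ℕ → Val} (h : (t.subst σ).IsValue) :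
    t.IsValue := by
  obtain ⟨v, hv⟩ := h
  cases t with
  | var n => exact ⟨.var n, rfl⟩
  | lam t => exact ⟨.lam t, rfl⟩
  | app t s => cases v <;> simp [Tm.subst, Val.toTm] at hv
  | shift t => cases v <;> simp [Tm.subst, Val.toTm] at hv
  | reset t => cases v <;> simp [Tm.subst, Val.toTm] at hv

/-- The hypothesis ranges over all renamings so that it survives passing under a binder. Closure
under renaming is then a special case, after which the extra quantifier can be dropped. -/
theorem subst_of_forall_rename {t s : Tm} (h : Adm t s) {σ τ : ℕ → Val}
    (hσ : ∀ n ρ, Adm ((σ n).rename ρ).toTm ((τ n).rename ρ).toTm) :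
    Adm (t.subst σ) (s.subst τ) := by
  have up : ∀ σ τ : ℕ → Val, (∀ n ρ, Adm ((σ n).rename ρ).toTm ((τ n).rename ρ).toTm) →
      ∀ n ρ, Adm ((upSub σ n).rename ρ).toTm ((upSub τ n).rename ρ).toTm := by
    intro σ τ h n ρ
    cases n with
    | zero => exact .var _
    | succ n => simp only [upSub_succ, Val.rename_rename]; exact h _ _
  induction h generalizing σ τ with
  | var n =>
    have := hσ n id
    simp only [Val.toTm_rename, Tm.rename_id] at this
    exact this
  | lam _ ih => exact .lam (ih (up _ _ hσ))
  | app _ _ ih ih' => exact .app (ih hσ) (ih' hσ)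
  | shift _ ih => exact .shift (ih (up _ _ hσ))
  | reset _ ih => exact .reset (ih hσ)
  | delay _ _ hv ih ih' =>
    simp only [Tm.subst, PureCtx.plug_subst]
    refine .delay ?_ (ih' hσ) fun h => hv (Tm.isValue_of_subst h)
    rw [← PureCtx.body_subst_upSub]
    exact ih (up _ _ hσ)
  | double _ ih => exact .double (ih hσ)
  | expand h _ ih => exact .expand (h.subst τ) (ih hσ)

theorem rename {t s : Tm} (h : Adm t s) (ρ : ℕ → ℕ) : Adm (t.rename ρ) (s.rename ρ) := by
  simp only [Tm.rename_eq_subst]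
  exact h.subst_of_forall_rename fun n ρ => refl _

theorem subst {t s : Tm} (h : Adm t s) {σ τ : ℕ → Val} (hσ : ∀ n, Adm (σ n).toTm (τ n).toTm) :
    Adm (t.subst σ) (s.subst τ) :=
  h.subst_of_forall_rename fun n ρ => by
    simp only [Val.toTm_rename]; exact (hσ n).rename ρ

theorem inst {t s : Tm} {v w : Val} (h : Adm t s) (hv : Adm v.toTm w.toTm) :
    Adm (t.inst v) (s.inst w) := by
  simp only [Tm.inst_eq]
  refine h.subst fun n => ?_
  cases n with
  | zero => exact hv
  | succ n => exact .var n

theorem var_inv {x : ℕ} {q : Tm} (h : Adm (.var x) q) : ∃ n, Steps 0 n q (.var x) := by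
  generalize hp : Tm.var x = p at h
  induction h with
  | var n => exact ⟨0, hp ▸ .refl _⟩
  | expand h _ ih => obtain ⟨n, hn⟩ := ih hp; exact ⟨_, .head h hn⟩
  | _ => cases hp

theorem lam_inv {t q : Tm} (h : Adm (.lam t) q) :
    ∃ t' n, Steps 0 n q (.lam t') ∧ Adm t t' := by
  generalize hp : Tm.lam t = p at h
  induction h with
  | lam h _ => cases hp; exact ⟨_, 0, .refl _, h⟩
  | expand h _ ih => obtain ⟨t', n, hn, ht⟩ := ih hp; exact ⟨_, _, .head h hn, ht⟩
  | _ => cases hp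

theorem val_inv {v : Val} {q : Tm} (h : Adm v.toTm q) :
    ∃ v' n, Steps 0 n q (Val.toTm v') ∧ Adm v.toTm v'.toTm := by
  cases v with
  | var x => obtain ⟨n, hn⟩ := var_inv h; exact ⟨.var x, n, hn, .var x⟩
  | lam t => obtain ⟨t', n, hn, ht⟩ := lam_inv h; exact ⟨.lam t', n, hn, .lam ht⟩

theorem body_of_val {v v' : Val} (h : Adm v.toTm v'.toTm) : Adm v.body v'.body := by
  cases v with
  | var x =>
    obtain ⟨n, hn⟩ := var_inv h
    have := hn.nf_unique (nf_val (.var x)) (.refl _) (nf_val _)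
    rw [← Val.toTm_var, Val.toTm_inj] at this
    subst this
    exact refl _
  | lam t =>
    obtain ⟨t', n, hn, ht⟩ := lam_inv h
    have := hn.nf_unique (nf_val (.lam t')) (.refl _) (nf_val _)
    rw [← Val.toTm_lam, Val.toTm_inj] at this
    subst this
    exact ht

theorem delay_any {E : PureCtx} {e t s : Tm} (hE : Adm E.body e) (ht : Adm t s) :
    Adm (.reset (E.plug t)) (.reset (.app (.lam (.reset e)) s)) := by
  by_cases hv : t.IsValue
  · obtain ⟨v, rfl⟩ := hv
    obtain ⟨v', n, hs, hv⟩ := val_inv ht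
    have h1 := hs.plug (.reset (.appR (.lam (.reset e)) .hole))
    have h2 : Step 0 _ _ := decomp_plug_red (.reset .hole) (.beta (.reset e) v')
    -- The administrative redex fires and leaves `⟨⟨e{v'}⟩⟩`, one reset too many, which `double`
    -- allows.
    refine expands (h1.trans (.single h2)) rfl (.double (.reset ?_))
    rw [← PureCtx.body_inst]
    exact hE.inst hv
  · exact .delay hE ht hv

theorem _root_.ShiftReset.PureCtx.body_comp (E G : PureCtx) :
    (E.comp G).body = (E.rename Nat.succ).plug G.body := by
  simp only [PureCtx.body, PureCtx.rename_eq_subst, PureCtx.comp_subst, PureCtx.plug_comp]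

theorem _root_.ShiftReset.PureCtx.body_rename (E : PureCtx) (ρ : ℕ → ℕ) :
    (E.rename ρ).body = E.body.rename (upRen ρ) := by
  rw [PureCtx.rename_eq_subst, ← PureCtx.body_subst_upSub, upSub_var_comp, Tm.rename_eq_subst]

theorem _root_.ShiftReset.EvalCtx.body_comp (F G : EvalCtx) :
    (F.comp G).body = (F.rename Nat.succ).plug G.body := by
  simp only [EvalCtx.body, EvalCtx.rename_eq_subst, EvalCtx.comp_subst, EvalCtx.plug_comp]

theorem body_appR {v v' : Val} {E E' : PureCtx} (hv : Adm v.toTm v'.toTm)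
    (h : Adm E.body E'.body) : Adm (PureCtx.appR v E).body (PureCtx.appR v' E').body := by
  refine .app ?_ h
  simp only [Val.toTm_rename]
  exact hv.rename _

theorem body_appL {t t' : Tm} {E E' : PureCtx} (ht : Adm t t')
    (h : Adm E.body E'.body) : Adm (PureCtx.appL E t).body (PureCtx.appL E' t').body :=
  .app h (ht.rename _)

/-- `delay` and `double` relate only resets, which a control-stuck term is not. So the right side
has the same shape once its administrative redexes are unfolded. -/
theorem ctrl_inv {E : PureCtx} {b q : Tm} (h : Adm (E.plug (.shift b)) q) :
    ∃ E' b' n, Steps 0 n q (PureCtx.plug E' (.shift b')) ∧ Adm E.body E'.body ∧ Adm b b' := by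
  generalize hp : E.plug (.shift b) = p at h
  induction h generalizing E with
  | shift h _ =>
    cases E <;> simp only [PureCtx.plug, reduceCtorEq, Tm.shift.injEq] at hp
    subst hp
    exact ⟨.hole, _, 0, .refl _, refl _, h⟩
  | @app t s t' s' h h' ih ih' =>
    cases E with
    | hole => cases hp
    | appR v E =>
      simp only [PureCtx.plug, Tm.app.injEq] at hp
      obtain ⟨rfl, hp⟩ := hp
      obtain ⟨v', n, hs, hv⟩ := val_inv h
      obtain ⟨E', b', m, hs', hE, hb⟩ := ih' hp
      exact ⟨.appR v' E', b', _, (hs.plug (.appL .hole s')).trans (hs'.plug (.appR v' .hole)),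
        body_appR hv hE, hb⟩
    | appL E t =>
      simp only [PureCtx.plug, Tm.app.injEq] at hp
      obtain ⟨hp, rfl⟩ := hp
      obtain ⟨E', b', m, hs', hE, hb⟩ := ih hp
      exact ⟨.appL E' s', b', _, hs'.plug (.appL .hole s'), body_appL h' hE, hb⟩
  | expand h _ ih =>
    obtain ⟨E', b', n, hn, ht⟩ := ih hp
    exact ⟨_, _, _, .head h hn, ht⟩
  | _ => cases E <;> cases hp

/-- Reduction is simulated, with the same number of captures. -/
theorem step {p q p' : Tm} {c : ℕ} (h : Adm p q) (hp : Step c p p') :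
    ∃ q' n, Steps c (n + 1) q q' ∧ Adm p' q' := by
  induction h generalizing p' c with
  | var n => cases hp
  | lam h => cases hp
  | shift h => cases hp
  | @app t s t' s' h h' ih ih' =>
    rcases step_app_inv hp with ⟨r, hr, rfl⟩ | ⟨v, r, rfl, hr, rfl⟩ | ⟨b, v, rfl, rfl, rfl, rfl⟩
    · obtain ⟨q, n, hq, ha⟩ := ih hr
      exact ⟨_, _, hq.plug (.appL .hole s'), .app ha h'⟩
    · obtain ⟨v', m, hs, hv⟩ := val_inv h
      obtain ⟨q, n, hq, ha⟩ := ih' hr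
      have := (hs.plug (.appL .hole s')).trans (hq.plug (.appR v' .hole))
      rw [zero_add, ← add_assoc] at this
      exact ⟨_, _, this, .app hv ha⟩
    · obtain ⟨b', m, hs, hb⟩ := lam_inv h
      obtain ⟨v', m', hs', hv⟩ := val_inv h'
      exact ⟨_, _, ((hs.plug (.appL .hole s')).trans (hs'.plug (.appR (.lam b') .hole))).trans
        (.single (.beta b' v')), hb.inst hv⟩
  | @reset t s h ih =>
    rcases step_reset_inv hp with ⟨r, hr, rfl⟩ | ⟨E, b, rfl, rfl, rfl⟩ | ⟨v, rfl, rfl, rfl⟩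
    · obtain ⟨q, n, hq, ha⟩ := ih hr
      exact ⟨_, _, hq.plug (.reset .hole), .reset ha⟩
    · obtain ⟨E', b', m, hs, hE, hb⟩ := ctrl_inv h
      have := (hs.plug (.reset .hole)).trans (.single (.capture E' b'))
      exact ⟨_, _, this, .reset (hb.inst (.lam (.reset hE)))⟩
    · obtain ⟨v', m, hs, hv⟩ := val_inv h
      exact ⟨_, _, (hs.plug (.reset .hole)).trans (.single (.resetVal v')), hv⟩
  | @delay E e t s hE h hv ihE ih =>
    by_cases ht : Nf t
    · rcases ht.cases with ⟨v, rfl⟩ | ⟨G, b, rfl⟩ | ⟨F, x, v, rfl⟩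
      · exact absurd ⟨v, rfl⟩ hv
      · obtain ⟨G', b', m, hs, hG, hb⟩ := ctrl_inv h
        have hp' := Step.capture (E.comp G) b
        rw [PureCtx.plug_comp] at hp'
        obtain ⟨rfl, rfl⟩ := hp.det hp'
        have := (hs.plug (.reset (.appR (.lam (.reset e)) .hole))).trans
          (.single (.capture (.appR (.lam (.reset e)) G') b'))
        refine ⟨_, _, this, .reset (hb.inst (.lam ?_))⟩
        -- The left captures `E[G]` at once; the right captures `G'` together with the pending call
        -- to the reified `E`. The continuations are again related by a delay.
        change Adm (.reset (E.comp G).body) _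
        rw [PureCtx.body_comp]
        refine delay_any (e := e.rename (upRen Nat.succ)) ?_ hG
        rw [PureCtx.body_rename]
        exact hE.rename _
      · refine absurd hp ?_
        have := nf_opn ((EvalCtx.reset E.toEval).comp F) x v
        rw [EvalCtx.plug_comp, EvalCtx.plug, PureCtx.plug_toEval] at this
        exact this _ _
    · simp only [Nf, not_forall, not_not] at ht
      obtain ⟨d, t', ht⟩ := ht
      have hp' := decomp_plug_red (.reset E.toEval) ht
      simp only [EvalCtx.plug, PureCtx.plug_toEval] at hp'
      obtain ⟨rfl, rfl⟩ := hp.det hp'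
      obtain ⟨q, n, hq, ha⟩ := ih ht
      exact ⟨_, _, hq.plug (.reset (.appR (.lam (.reset e)) .hole)), delay_any hE ha⟩
  | double h ih =>
    obtain ⟨q', n, hq, ha⟩ := ih hp
    have hq' := hq.plug (.reset .hole)
    rcases step_reset_inv hp with ⟨r, hr, rfl⟩ | ⟨E, b, rfl, rfl, rfl⟩ | ⟨v, rfl, rfl, rfl⟩
    · exact ⟨_, _, hq', .double ha⟩
    · exact ⟨_, _, hq', .double ha⟩
    · obtain ⟨v', m, hs, hv⟩ := val_inv ha
      exact ⟨_, _, (hq'.trans (hs.plug (.reset .hole))).trans (.single (.resetVal v')), hv⟩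
  | expand h _ ih =>
    obtain ⟨q', n, hq, ha⟩ := ih hp
    have := Steps.head h hq
    rw [zero_add] at this
    exact ⟨q', _, this, ha⟩

theorem ctxR_appR {v v' : Val} {F F' : EvalCtx} (hv : Adm v.toTm v'.toTm)
    (hR : CtxR Adm F F') : CtxR Adm (.appR v F) (.appR v' F') := by
  rcases ctxR_iff.1 hR with ⟨E₀, E₁, rfl, rfl, h⟩ | ⟨G₀, G₁, E₀, E₁, rfl, rfl, h, h'⟩
  · exact ctxR_iff.2 (.inl ⟨.appR v E₀, .appR v' E₁, rfl, rfl, body_appR hv h⟩)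
  · refine ctxR_iff.2 (.inr ⟨.appR v G₀, .appR v' G₁, E₀, E₁, rfl, rfl, .app ?_ h, h'⟩)
    simp only [Val.toTm_rename]
    exact hv.rename _

theorem ctxR_appL {t t' : Tm} {F F' : EvalCtx} (ht : Adm t t')
    (hR : CtxR Adm F F') : CtxR Adm (.appL F t) (.appL F' t') := by
  rcases ctxR_iff.1 hR with ⟨E₀, E₁, rfl, rfl, h⟩ | ⟨G₀, G₁, E₀, E₁, rfl, rfl, h, h'⟩
  · exact ctxR_iff.2 (.inl ⟨.appL E₀ t, .appL E₁ t', rfl, rfl, body_appL ht h⟩)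
  · exact ctxR_iff.2 (.inr ⟨.appL G₀ t, .appL G₁ t', E₀, E₁, rfl, rfl, .app h (ht.rename _), h'⟩)

theorem ctxR_reset {F F' : EvalCtx} (hR : CtxR Adm F F') : CtxR Adm (.reset F) (.reset F') := by
  rcases ctxR_iff.1 hR with ⟨E₀, E₁, rfl, rfl, h⟩ | ⟨G₀, G₁, E₀, E₁, rfl, rfl, h, h'⟩
  · exact ctxR_iff.2 (.inr ⟨.hole, .hole, E₀, E₁, rfl, rfl, .var 0, .reset h⟩)
  · exact ctxR_iff.2 (.inr ⟨.reset G₀, .reset G₁, E₀, E₁, rfl, rfl, .reset h, h'⟩)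

/-- If the hole lies under no further reset, the delay affects the innermost delimited part;
otherwise it affects the outer context, and the innermost part is unchanged. -/
theorem ctxR_delay {E : PureCtx} {e : Tm} {F F' : EvalCtx} (hE : Adm E.body e)
    (hR : CtxR Adm F F') :
    CtxR Adm (.reset (E.toEval.comp F)) (.reset (.appR (.lam (.reset e)) F')) := by
  have hE' : Adm (E.rename Nat.succ).body (e.rename (upRen Nat.succ)) := by
    rw [PureCtx.body_rename]
    exact hE.rename _
  rcases ctxR_iff.1 hR with ⟨E₀, E₁, rfl, rfl, h⟩ | ⟨G₀, G₁, E₀, E₁, rfl, rfl, h, h'⟩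
  · refine ctxR_iff.2 (.inr ⟨.hole, .hole, E.comp E₀, .appR (.lam (.reset e)) E₁, ?_, rfl,
      .var 0, ?_⟩)
    · rw [PureCtx.toEval_comp]; rfl
    · rw [PureCtx.body_comp]
      exact delay_any hE' h
  · refine ctxR_iff.2 (.inr ⟨.reset (E.toEval.comp G₀), .reset (.appR (.lam (.reset e)) G₁),
      E₀, E₁, ?_, rfl, ?_, h'⟩)
    · rw [EvalCtx.comp, EvalCtx.comp_assoc]
    · change Adm (.reset (E.toEval.comp G₀).body) _
      rw [EvalCtx.body_comp, EvalCtx.rename_eq_subst, ← PureCtx.toEval_subst,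
        ← PureCtx.rename_eq_subst, PureCtx.plug_toEval]
      exact delay_any hE' h

theorem ctxR_double {F F' : EvalCtx} (hR : CtxR Adm (.reset F) F') :
    CtxR Adm (.reset F) (.reset F') := by
  rcases ctxR_iff.1 hR with ⟨E₀, E₁, hF, rfl, h⟩ | ⟨G₀, G₁, E₀, E₁, hF, rfl, h, h'⟩
  · cases E₀ <;> cases hF
  · refine ctxR_iff.2 (.inr ⟨G₀, .reset G₁, E₀, E₁, hF, rfl, ?_, h'⟩)
    cases G₀ with
    | hole =>
      -- The left context has a single reset here, so the outer part on the right sends the variable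
      -- to itself; the extra reset around it is then removed.
      obtain ⟨n, hn⟩ := var_inv h
      exact expands ((hn.plug (.reset .hole)).trans (.single (.resetVal (.var 0)))) rfl (.var 0)
    | appR v G => cases hF
    | appL G t => cases hF
    | reset G => exact .double h

/-- An evaluation context around an application of a variable extends any pure context around a
term that is not a value. -/
theorem _root_.ShiftReset.EvalCtx.eq_comp_of_plug_eq {F : EvalCtx} {E : PureCtx} {x : ℕ} {v : Val}
    {t : Tm} (h : F.plug (.app (.var x) v.toTm) = E.plug t) (ht : ¬ t.IsValue) :
    ∃ G, F = E.toEval.comp G ∧ t = G.plug (.app (.var x) v.toTm) := by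
  induction E generalizing F with
  | hole => exact ⟨F, rfl, h.symm⟩
  | appR w E ih =>
    cases F with
    | hole =>
      simp only [EvalCtx.plug, PureCtx.plug, Tm.app.injEq] at h
      cases E with
      | hole => exact absurd ⟨v, h.2.symm⟩ ht
      | appR _ _ => cases v <;> cases h.2
      | appL _ _ => cases v <;> cases h.2
    | appR u F =>
      simp only [EvalCtx.plug, PureCtx.plug, Tm.app.injEq, Val.toTm_inj] at h
      obtain ⟨rfl, h⟩ := h
      obtain ⟨G, rfl, hG⟩ := ih h
      exact ⟨G, rfl, hG⟩
    | appL F u =>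
      simp only [EvalCtx.plug, PureCtx.plug, Tm.app.injEq] at h
      have := congrArg decomp h.1
      rw [decomp_opn, decomp_val] at this
      cases this
    | reset F => cases h
  | appL E u ih =>
    have key : ∀ w : Val, w.toTm ≠ E.plug t := by
      intro w hw
      cases E with
      | hole => exact ht ⟨w, hw.symm⟩
      | appR _ _ => cases w <;> cases hw
      | appL _ _ => cases w <;> cases hw
    cases F with
    | hole =>
      simp only [EvalCtx.plug, PureCtx.plug, Tm.app.injEq] at h
      exact absurd h.1 (key (.var x))
    | appR u F =>
      simp only [EvalCtx.plug, PureCtx.plug, Tm.app.injEq] at h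
      exact absurd h.1 (key u)
    | appL F u =>
      simp only [EvalCtx.plug, PureCtx.plug, Tm.app.injEq] at h
      obtain ⟨h, rfl⟩ := h
      obtain ⟨G, rfl, hG⟩ := ih h
      exact ⟨G, rfl, hG⟩
    | reset F => cases h

theorem opn_inv {F : EvalCtx} {x : ℕ} {v : Val} {q : Tm}
    (h : Adm (F.plug (.app (.var x) v.toTm)) q) :
    ∃ F' v' n, Steps 0 n q (EvalCtx.plug F' (.app (.var x) (Val.toTm v'))) ∧ CtxR Adm F F' ∧
      Adm v.toTm v'.toTm := by
  generalize hp : F.plug (.app (.var x) v.toTm) = p at h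
  induction h generalizing F with
  | var n => cases F <;> cases hp
  | lam h => cases F <;> cases hp
  | shift h => cases F <;> cases hp
  | @app t s t' s' h h' ih ih' =>
    cases F with
    | hole =>
      cases hp
      obtain ⟨n, hs⟩ := var_inv h
      obtain ⟨v', m, hs', hv⟩ := val_inv h'
      exact ⟨.hole, v', _, (hs.plug (.appL .hole s')).trans (hs'.plug (.appR (.var x) .hole)),
        ctxR_iff.2 (.inl ⟨.hole, .hole, rfl, rfl, .var 0⟩), hv⟩
    | appR w F =>
      simp only [EvalCtx.plug, Tm.app.injEq] at hp
      obtain ⟨rfl, hp⟩ := hp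
      obtain ⟨w', n, hs, hw⟩ := val_inv h
      obtain ⟨F', v', m, hs', hF, hv⟩ := ih' hp
      exact ⟨.appR w' F', v', _, (hs.plug (.appL .hole s')).trans (hs'.plug (.appR w' .hole)),
        ctxR_appR hw hF, hv⟩
    | appL F t =>
      simp only [EvalCtx.plug, Tm.app.injEq] at hp
      obtain ⟨hp, rfl⟩ := hp
      obtain ⟨F', v', m, hs', hF, hv⟩ := ih hp
      exact ⟨.appL F' s', v', _, hs'.plug (.appL .hole s'), ctxR_appL h' hF, hv⟩
    | reset F => cases hp
  | reset h ih =>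
    cases F <;> simp only [EvalCtx.plug, reduceCtorEq, Tm.reset.injEq] at hp
    obtain ⟨F', v', m, hs', hF, hv⟩ := ih hp
    exact ⟨.reset F', v', _, hs'.plug (.reset .hole), ctxR_reset hF, hv⟩
  | @delay E e t s hE h ht ihE ih =>
    cases F <;> simp only [EvalCtx.plug, reduceCtorEq, Tm.reset.injEq] at hp
    -- As `t` is not a value, the stuck application lies inside it, and its context factors through
    -- `E`.
    obtain ⟨G, rfl, hG⟩ := EvalCtx.eq_comp_of_plug_eq hp ht
    obtain ⟨F', v', m, hs', hF, hv⟩ := ih hG.symm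
    exact ⟨.reset (.appR (.lam (.reset e)) F'), v', _,
      hs'.plug (.reset (.appR (.lam (.reset e)) .hole)), ctxR_delay hE hF, hv⟩
  | double h ih =>
    obtain ⟨F', v', m, hs', hF, hv⟩ := ih hp
    cases F <;> simp only [EvalCtx.plug, reduceCtorEq, Tm.reset.injEq] at hp
    exact ⟨.reset F', v', _, hs'.plug (.reset .hole), ctxR_double hF, hv⟩
  | expand h _ ih =>
    obtain ⟨F', v', m, hs', hF, hv⟩ := ih hp
    exact ⟨F', v', _, .head h hs', hF, hv⟩

theorem nf {p q : Tm} (h : Adm p q) (hp : Nf p) :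
    ∃ q' n, Steps 0 n q q' ∧ Nf q' ∧ NF Adm p q' := by
  rcases hp.cases with ⟨v, rfl⟩ | ⟨E, b, rfl⟩ | ⟨F, x, v, rfl⟩
  · obtain ⟨v', n, hs, hv⟩ := val_inv h
    exact ⟨_, n, hs, nf_val _, .val (body_of_val hv)⟩
  · obtain ⟨E', b', n, hs, hE, hb⟩ := ctrl_inv h
    refine ⟨_, n, hs, nf_ctrl _ _, .ctrl (.reset ((hb.rename _).inst (.lam (.reset ?_))))⟩
    refine body_appR (.var 0) ?_
    rw [PureCtx.body_rename, PureCtx.body_rename]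
    exact hE.rename _
  · obtain ⟨F', v', n, hs, hF, hv⟩ := opn_inv h
    exact ⟨_, n, hs, nf_opn _ _ _, .opn hF (body_of_val hv)⟩

theorem steps {p q p' : Tm} {s n : ℕ} (h : Adm p q) (hp : Steps s n p p') :
    ∃ q' m, Steps s m q q' ∧ Adm p' q' := by
  induction hp generalizing q with
  | refl t => exact ⟨q, 0, .refl _, h⟩
  | head hs _ ih =>
    obtain ⟨q₁, m, hq, h⟩ := h.step hs
    obtain ⟨q₂, m', hq', h⟩ := ih h
    exact ⟨q₂, _, hq.trans hq', h⟩

theorem eval {p q p' : Tm} {s n : ℕ} (h : Adm p q) (hp : Steps s n p p') (hn : Nf p') :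
    ∃ q' m, Steps s m q q' ∧ Nf q' ∧ NF Adm p' q' := by
  obtain ⟨q₁, m, hq, h⟩ := h.steps hp
  obtain ⟨q', k, hq', hn', h⟩ := h.nf hn
  exact ⟨q', _, hq.trans hq', hn', h⟩

/-- Every step on the left costs at least one on the right, so termination on the right bounds the
left. This gives the second half of bisimulation without inverting `Adm` from the right. -/
theorem eval_left {p q q' : Tm} {s n : ℕ} (h : Adm p q) (hq : Steps s n q q') (hn : Nf q') :
    ∃ p', Eval p p' := by
  induction n using Nat.strong_induction_on generalizing p q s with
  | _ n ih =>
    by_cases hp : Nf p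
    · exact ⟨p, hp.eval⟩
    · simp only [Nf, not_forall, not_not] at hp
      obtain ⟨c, p₁, hp⟩ := hp
      obtain ⟨q₁, m, hq₁, h⟩ := h.step hp
      obtain ⟨s', n', hs, -, hn'⟩ := hq₁.cancel hq hn
      obtain ⟨p', he⟩ := ih n' (by omega) h hs
      exact ⟨p', (Steps.single hp).eval he⟩

theorem refinedBisimilar {p q : Tm} (h : Adm p q) : RefinedBisimilar p q := by
  refine ⟨Adm, isRefinedBisimulation_of_renClosed (fun a b ρ h => h.rename ρ) ?_ ?_, h⟩
  · intro p q p' h he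
    obtain ⟨⟨s, n, hs⟩, hn⟩ := eval_iff.1 he
    obtain ⟨q', m, hq, hn', hN⟩ := h.eval hs hn
    exact ⟨q', eval_iff.2 ⟨⟨_, _, hq⟩, hn'⟩, hN⟩
  · intro p q q' h he
    obtain ⟨⟨s, n, hs⟩, hn⟩ := eval_iff.1 he
    obtain ⟨p', hp⟩ := h.eval_left hs hn
    obtain ⟨⟨s', n', hs'⟩, hn'⟩ := eval_iff.1 hp
    -- The forward simulation is applied to the evaluation just found; determinism identifies its
    -- result with the given one.
    obtain ⟨q'', m, hq, hn'', hN⟩ := h.eval hs' hn'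
    obtain rfl := hq.nf_unique hn'' hs hn
    exact ⟨p', hp, hN⟩

end Adm

/-! ### Related closures, continuations, and stacks -/

mutual

/-- Values generated from bisimilar values by nested substitutions and by the reification of
related continuations. -/
inductive ValClo : Val → Val → Prop
  | var (n : ℕ) : ValClo (.var n) (.var n)
  | clo (v₀ v₁ : Val) (σ₀ σ₁ : ℕ → Val) : RefinedBisimilar v₀.body v₁.body →
      (∀ n, ValClo (σ₀ n) (σ₁ n)) → ValClo (v₀.subst σ₀) (v₁.subst σ₁)
  | cont (E₀ E₁ : PureCtx) : ContClo E₀ E₁ → ValClo E₀.reify E₁.reify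

/-- Delimited pure contexts generated from bisimilar contexts. -/
inductive ContClo : PureCtx → PureCtx → Prop
  | base (E₀ E₁ : PureCtx) (σ₀ σ₁ : ℕ → Val) :
      RefinedBisimilar (.reset E₀.body) (.reset E₁.body) →
      (∀ n, ValClo (σ₀ n) (σ₁ n)) → ContClo (E₀.subst σ₀) (E₁.subst σ₁)
  | push (E₀ E₁ G₀ G₁ : PureCtx) (σ₀ σ₁ : ℕ → Val) : ContClo E₀ E₁ →
      RefinedBisimilar G₀.body G₁.body → (∀ n, ValClo (σ₀ n) (σ₁ n)) →
      ContClo (E₀.comp (G₀.subst σ₀)) (E₁.comp (G₁.subst σ₁))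

end

/-- Substitutions that are pointwise related. -/
abbrev EnvClo (σ₀ σ₁ : ℕ → Val) : Prop := ∀ n, ValClo (σ₀ n) (σ₁ n)

/-- Terms that cannot become control stuck. -/
def Safe (t : Tm) : Prop := t.IsValue ∨ ∃ s, t = .reset s

/-- Stacks of related frames.  If the flag is `false`, then only terms that cannot become control
stuck may be plugged. -/
inductive Stk : ℕ → Bool → EvalCtx → EvalCtx → Prop
  | nil : Stk 0 true .hole .hole
  | pure {k : ℕ} {F₀ F₁ : EvalCtx} (E₀ E₁ : PureCtx) (σ₀ σ₁ : ℕ → Val) : Stk k true F₀ F₁ →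
      RefinedBisimilar E₀.body E₁.body → EnvClo σ₀ σ₁ →
      Stk (k + 1) true (F₀.comp (E₀.subst σ₀).toEval) (F₁.comp (E₁.subst σ₁).toEval)
  -- Bisimilarity of `G₀[x]` and `G₁[x]` says nothing about where the resets of the two contexts
  -- lie. So a capture must never reach such a frame: only safe terms may be plugged, until a
  -- `delim` frame supplies a reset.
  | gen {k : ℕ} {b : Bool} {F₀ F₁ : EvalCtx} (G₀ G₁ : EvalCtx) (σ₀ σ₁ : ℕ → Val) :
      Stk k b F₀ F₁ → RefinedBisimilar G₀.body G₁.body →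
      (b = false → Safe G₀.body ∧ Safe G₁.body) → EnvClo σ₀ σ₁ →
      Stk (k + 1) false (F₀.comp (G₀.subst σ₀)) (F₁.comp (G₁.subst σ₁))
  | delim {k : ℕ} {F₀ F₁ : EvalCtx} (E₀ E₁ : PureCtx) (σ₀ σ₁ : ℕ → Val) : Stk k false F₀ F₁ →
      RefinedBisimilar (.reset E₀.body) (.reset E₁.body) → EnvClo σ₀ σ₁ →
      Stk (k + 1) true (F₀.comp (.reset (E₀.subst σ₀).toEval))
        (F₁.comp (.reset (E₁.subst σ₁).toEval))

/-- Related configurations: closures of bisimilar terms in related stacks. -/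
def Conf (k : ℕ) (p q : Tm) : Prop :=
  ∃ b F₀ F₁ t₀ t₁ σ₀ σ₁, Stk k b F₀ F₁ ∧ RefinedBisimilar t₀ t₁ ∧
    (b = false → Safe t₀ ∧ Safe t₁) ∧ EnvClo σ₀ σ₁ ∧ p = F₀.plug (t₀.subst σ₀) ∧
    q = F₁.plug (t₁.subst σ₁)

/-- Configurations up to bisimilarity. -/
def ConfB (p q : Tm) : Prop :=
  ∃ k a b, RefinedBisimilar p a ∧ Conf k a b ∧ RefinedBisimilar b q

/-! ### Renaming and symmetry -/

theorem PureCtx.rename_subst (E : PureCtx) (σ : ℕ → Val) (ρ : ℕ → ℕ) :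
    (E.subst σ).rename ρ = E.subst fun n => (σ n).rename ρ := by
  simp only [PureCtx.rename_eq_subst, PureCtx.subst_subst, Val.rename_eq_subst]

theorem EvalCtx.rename_subst (F : EvalCtx) (σ : ℕ → Val) (ρ : ℕ → ℕ) :
    (F.subst σ).rename ρ = F.subst fun n => (σ n).rename ρ := by
  simp only [EvalCtx.rename_eq_subst, EvalCtx.subst_subst, Val.rename_eq_subst]

theorem PureCtx.comp_rename (E G : PureCtx) (ρ : ℕ → ℕ) :
    (E.comp G).rename ρ = (E.rename ρ).comp (G.rename ρ) := by
  simp only [PureCtx.rename_eq_subst, PureCtx.comp_subst]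

theorem EvalCtx.comp_rename (F G : EvalCtx) (ρ : ℕ → ℕ) :
    (F.comp G).rename ρ = (F.rename ρ).comp (G.rename ρ) := by
  simp only [EvalCtx.rename_eq_subst, EvalCtx.comp_subst]

theorem PureCtx.toEval_rename (E : PureCtx) (ρ : ℕ → ℕ) :
    E.toEval.rename ρ = (E.rename ρ).toEval := by
  simp only [EvalCtx.rename_eq_subst, PureCtx.rename_eq_subst, PureCtx.toEval_subst]

theorem PureCtx.reify_rename (E : PureCtx) (ρ : ℕ → ℕ) :
    E.reify.rename ρ = (E.rename ρ).reify := by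
  simp only [Val.rename_eq_subst, PureCtx.rename_eq_subst, PureCtx.reify_subst]

mutual

theorem ValClo.rename {v₀ v₁ : Val} (ρ : ℕ → ℕ) :
    ValClo v₀ v₁ → ValClo (v₀.rename ρ) (v₁.rename ρ)
  | .var n => .var _
  | .clo v₀ v₁ σ₀ σ₁ h hσ => by
    rw [Val.rename_subst, Val.rename_subst]
    exact .clo _ _ _ _ h fun n => (hσ n).rename ρ
  | .cont E₀ E₁ h => by
    rw [PureCtx.reify_rename, PureCtx.reify_rename]
    exact .cont _ _ (h.rename ρ)

theorem ContClo.rename {E₀ E₁ : PureCtx} (ρ : ℕ → ℕ) :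
    ContClo E₀ E₁ → ContClo (E₀.rename ρ) (E₁.rename ρ)
  | .base E₀ E₁ σ₀ σ₁ h hσ => by
    rw [PureCtx.rename_subst, PureCtx.rename_subst]
    exact .base _ _ _ _ h fun n => (hσ n).rename ρ
  | .push E₀ E₁ G₀ G₁ σ₀ σ₁ hE h hσ => by
    rw [PureCtx.comp_rename, PureCtx.comp_rename, PureCtx.rename_subst, PureCtx.rename_subst]
    exact .push _ _ _ _ _ _ (hE.rename ρ) h fun n => (hσ n).rename ρ

end

mutual

theorem ValClo.symm {v₀ v₁ : Val} : ValClo v₀ v₁ → ValClo v₁ v₀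
  | .var n => .var _
  | .clo _ _ _ _ h hσ => .clo _ _ _ _ h.symm fun n => (hσ n).symm
  | .cont _ _ h => .cont _ _ h.symm

theorem ContClo.symm {E₀ E₁ : PureCtx} : ContClo E₀ E₁ → ContClo E₁ E₀
  | .base _ _ _ _ h hσ => .base _ _ _ _ h.symm fun n => (hσ n).symm
  | .push _ _ _ _ _ _ hE h hσ => .push _ _ _ _ _ _ hE.symm h.symm fun n => (hσ n).symm

end

theorem EnvClo.var : EnvClo Val.var Val.var := fun n => .var n

theorem EnvClo.scons {v₀ v₁ : Val} {σ₀ σ₁ : ℕ → Val} (hv : ValClo v₀ v₁) (hσ : EnvClo σ₀ σ₁) :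
    EnvClo (scons v₀ σ₀) (scons v₁ σ₁)
  | 0 => hv
  | n + 1 => hσ n

theorem EnvClo.rename {σ₀ σ₁ : ℕ → Val} (hσ : EnvClo σ₀ σ₁) (ρ : ℕ → ℕ) :
    EnvClo (fun n => (σ₀ n).rename ρ) (fun n => (σ₁ n).rename ρ) := fun n => (hσ n).rename ρ

theorem EnvClo.symm {σ₀ σ₁ : ℕ → Val} (hσ : EnvClo σ₀ σ₁) : EnvClo σ₁ σ₀ := fun n => (hσ n).symm

theorem Stk.rename {k : ℕ} {b : Bool} {F₀ F₁ : EvalCtx} (h : Stk k b F₀ F₁) (ρ : ℕ → ℕ) :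
    Stk k b (F₀.rename ρ) (F₁.rename ρ) := by
  induction h with
  | nil => exact .nil
  | pure E₀ E₁ σ₀ σ₁ _ h hσ ih =>
    simp only [EvalCtx.comp_rename, PureCtx.toEval_rename, PureCtx.rename_subst]
    exact .pure _ _ _ _ ih h (hσ.rename ρ)
  | gen G₀ G₁ σ₀ σ₁ _ h hs hσ ih =>
    simp only [EvalCtx.comp_rename, EvalCtx.rename_subst]
    exact .gen _ _ _ _ ih h hs (hσ.rename ρ)
  | delim E₀ E₁ σ₀ σ₁ _ h hσ ih =>
    simp only [EvalCtx.comp_rename, EvalCtx.rename, PureCtx.toEval_rename, PureCtx.rename_subst]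
    exact .delim _ _ _ _ ih h (hσ.rename ρ)

theorem Stk.symm {k : ℕ} {b : Bool} {F₀ F₁ : EvalCtx} (h : Stk k b F₀ F₁) : Stk k b F₁ F₀ := by
  induction h with
  | nil => exact .nil
  | pure E₀ E₁ σ₀ σ₁ _ h hσ ih => exact .pure _ _ _ _ ih h.symm hσ.symm
  | gen G₀ G₁ σ₀ σ₁ _ h hs hσ ih => exact .gen _ _ _ _ ih h.symm (fun hb => (hs hb).symm) hσ.symm
  | delim E₀ E₁ σ₀ σ₁ _ h hσ ih => exact .delim _ _ _ _ ih h.symm hσ.symm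

theorem confB_renClosed : RenClosed ConfB := by
  rintro p q ρ ⟨k, _, _, hp, ⟨b, F₀, F₁, t₀, t₁, σ₀, σ₁, hF, ht, hs, hσ, rfl, rfl⟩, hq⟩
  refine ⟨k, _, _, refinedBisimilar_renClosed _ _ ρ hp, ?_, refinedBisimilar_renClosed _ _ ρ hq⟩
  simp only [EvalCtx.plug_rename, Tm.rename_subst]
  exact ⟨b, _, _, t₀, t₁, _, _, hF.rename ρ, ht, hs, hσ.rename ρ, rfl, rfl⟩

theorem ConfB.symm {p q : Tm} (h : ConfB p q) : ConfB q p := by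
  obtain ⟨k, _, _, hp, ⟨b, F₀, F₁, t₀, t₁, σ₀, σ₁, hF, ht, hs, hσ, rfl, rfl⟩, hq⟩ := h
  exact ⟨k, _, _, hq.symm, ⟨b, _, _, _, _, _, _, hF.symm, ht.symm, fun hb => (hs hb).symm,
    hσ.symm, rfl, rfl⟩, hp.symm⟩

theorem Conf.confB {k : ℕ} {p q : Tm} (h : Conf k p q) : ConfB p q :=
  ⟨k, _, _, .refl _, h, .refl _⟩

/-! ### Operations on stacks -/

/-- Invoking a captured continuation reinstates its frames one by one on top of the current stack,
under a new reset. -/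
theorem ContClo.stk {E₀ E₁ : PureCtx} {k : ℕ} {F₀ F₁ : EvalCtx} (hF : Stk k false F₀ F₁) :
    ContClo E₀ E₁ → ∃ k', Stk k' true (F₀.comp (.reset E₀.toEval)) (F₁.comp (.reset E₁.toEval))
  | .base _ _ _ _ h hσ => ⟨_, .delim _ _ _ _ hF h hσ⟩
  | .push _ _ _ _ _ _ hE h hσ => by
    obtain ⟨k', hk⟩ := hE.stk hF
    have := Stk.pure _ _ _ _ hk h hσ
    simp only [EvalCtx.comp_assoc, EvalCtx.comp, ← PureCtx.toEval_comp] at this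
    exact ⟨_, this⟩

/-- A reset stays a reset, even when a capture happens directly under it, until it returns a value.
-/
theorem Safe.step {c : ℕ} {t t' : Tm} (h : Safe t) (hs : Step c t t') : Safe t' := by
  rcases h with ⟨v, rfl⟩ | ⟨s, rfl⟩
  · exact absurd hs (nf_val v _ _)
  · rcases step_reset_inv hs with ⟨r, hr, rfl⟩ | ⟨E, b, rfl, rfl, rfl⟩ | ⟨v, rfl, rfl, rfl⟩
    · exact .inr ⟨_, rfl⟩
    · exact .inr ⟨_, rfl⟩
    · exact .inl ⟨v, rfl⟩

theorem Safe.steps {s n : ℕ} {t t' : Tm} (h : Safe t) (hs : Steps s n t t') : Safe t' := by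
  induction hs with
  | refl => exact h
  | head hs _ ih => exact ih (h.step hs)

theorem not_safe_app (t s : Tm) : ¬ Safe (.app t s) := by
  rintro (⟨v, h⟩ | ⟨r, h⟩)
  · cases v <;> cases h
  · cases h

theorem not_safe_ctrl (E : PureCtx) (b : Tm) : ¬ Safe (E.plug (.shift b)) := by
  rintro (⟨v, h⟩ | ⟨r, h⟩)
  · cases E <;> cases v <;> cases h
  · cases E <;> cases h

/-- No reduction takes place: the top frame becomes the term under evaluation, with the returned
value added to its environment. This is the case that needs the height in the measure. -/
theorem Stk.pop {k : ℕ} {b : Bool} {F₀ F₁ : EvalCtx} (h : Stk k b F₀ F₁) {u₀ u₁ : Val}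
    (hu : ValClo u₀ u₁) :
    (F₀ = .hole ∧ F₁ = .hole) ∨ ∃ k' < k, Conf k' (F₀.plug u₀.toTm) (F₁.plug u₁.toTm) := by
  cases h with
  | nil => exact .inl ⟨rfl, rfl⟩
  | @pure k F₀ F₁ E₀ E₁ σ₀ σ₁ hF h hσ =>
    refine .inr ⟨k, by omega, true, F₀, F₁, _, _, _, _, hF, h, by simp, .scons hu hσ, ?_, ?_⟩ <;>
    simp only [EvalCtx.plug_comp, PureCtx.plug_toEval, PureCtx.body_subst_scons]
  | @gen k b F₀ F₁ G₀ G₁ σ₀ σ₁ hF h hs hσ =>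
    refine .inr ⟨k, by omega, b, F₀, F₁, _, _, _, _, hF, h, hs, .scons hu hσ, ?_, ?_⟩ <;>
    simp only [EvalCtx.plug_comp, EvalCtx.body_subst_scons]
  | @delim k F₀ F₁ E₀ E₁ σ₀ σ₁ hF h hσ =>
    refine .inr ⟨k, by omega, false, F₀, F₁, _, _, _, _, hF, h,
      fun _ => ⟨.inr ⟨_, rfl⟩, .inr ⟨_, rfl⟩⟩, .scons hu hσ, ?_, ?_⟩ <;>
    simp only [EvalCtx.plug_comp, EvalCtx.plug, PureCtx.plug_toEval, Tm.subst,
      PureCtx.body_subst_scons]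

theorem safe_body_of_safe_plug {G F : EvalCtx} {t : Tm}
    (h : Safe ((G.comp (.reset F)).plug t)) : Safe G.body := by
  cases G with
  | hole => exact .inl ⟨.var 0, rfl⟩
  | appR v G => exact absurd h (not_safe_app _ _)
  | appL G t => exact absurd h (not_safe_app _ _)
  | reset G => exact .inr ⟨_, rfl⟩

/-- A context with a reset contributes two frames, its outer part and its innermost delimited part.
A purely pure context cannot occur on a restricted stack, because the term plugged there would be an
application, which is not safe. -/
theorem Stk.push {k : ℕ} {b : Bool} {F₀ F₁ G₀ G₁ : EvalCtx} (h : Stk k b F₀ F₁)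
    (hG : CtxR RefinedBisimilar G₀ G₁) {t₀ t₁ s₀ s₁ : Tm}
    (hs : b = false → Safe (G₀.plug (.app t₀ s₀)) ∧ Safe (G₁.plug (.app t₁ s₁)))
    {σ₀ σ₁ : ℕ → Val} (hσ : EnvClo σ₀ σ₁) :
    ∃ k', Stk k' true (F₀.comp (G₀.subst σ₀)) (F₁.comp (G₁.subst σ₁)) := by
  rcases ctxR_iff.1 hG with ⟨E₀, E₁, rfl, rfl, hE⟩ | ⟨G₀, G₁, E₀, E₁, rfl, rfl, hG, hE⟩
  · simp only [← PureCtx.toEval_subst]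
    cases b with
    | true => exact ⟨_, .pure _ _ _ _ h hE hσ⟩
    | false =>
      have := (hs rfl).1
      rw [PureCtx.plug_toEval] at this
      cases E₀ <;> exact absurd this (not_safe_app _ _)
  · simp only [EvalCtx.comp_subst, EvalCtx.subst, ← PureCtx.toEval_subst, ← EvalCtx.comp_assoc]
    exact ⟨_, .delim _ _ _ _ (.gen _ _ _ _ h hG (fun hb =>
      ⟨safe_body_of_safe_plug (hs hb).1, safe_body_of_safe_plug (hs hb).2⟩) hσ) hE hσ⟩

/-- The pure part of a stack. -/
theorem Stk.pure_or_delimited {k : ℕ} {F₀ F₁ : EvalCtx} (h : Stk k true F₀ F₁) :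
    (∃ E₀ E₁, F₀ = PureCtx.toEval E₀ ∧ F₁ = PureCtx.toEval E₁ ∧
      ∀ m ρ, ContClo (.appR (.var m) (E₀.rename ρ)) (.appR (.var m) (E₁.rename ρ))) ∨
    ∃ k' G₀ G₁ E₀ E₁, F₀ = EvalCtx.comp G₀ (.reset (PureCtx.toEval E₀)) ∧
      F₁ = EvalCtx.comp G₁ (.reset (PureCtx.toEval E₁)) ∧ Stk k' false G₀ G₁ ∧
      ContClo E₀ E₁ := by
  generalize hb : true = b at h
  induction h with
  | nil =>
    exact .inl ⟨.hole, .hole, rfl, rfl, fun m ρ =>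
      .base (.appR (.var m) .hole) (.appR (.var m) .hole) Val.var Val.var (.refl _) .var⟩
  | pure E₀ E₁ σ₀ σ₁ _ h hσ ih =>
    rcases ih hb with ⟨K₀, K₁, rfl, rfl, hK⟩ | ⟨k', G₀, G₁, K₀, K₁, rfl, rfl, hG, hK⟩
    · simp only [← PureCtx.toEval_comp]
      refine .inl ⟨_, _, rfl, rfl, fun m ρ => ?_⟩
      simp only [PureCtx.comp_rename, PureCtx.rename_subst]
      exact .push _ _ _ _ _ _ (hK m ρ) h (hσ.rename ρ)
    · simp only [EvalCtx.comp_assoc, EvalCtx.comp, ← PureCtx.toEval_comp]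
      exact .inr ⟨k', _, _, _, _, rfl, rfl, hG, .push _ _ _ _ _ _ hK h hσ⟩
  | gen => cases hb
  | delim E₀ E₁ σ₀ σ₁ hF h hσ => exact .inr ⟨_, _, _, _, _, rfl, rfl, hF, .base _ _ _ _ h hσ⟩

/-- An empty general frame leaves the contexts unchanged but switches the flag, as `delim` requires
below it. -/
theorem Stk.generalize {k : ℕ} {F₀ F₁ : EvalCtx} (h : Stk k true F₀ F₁) :
    Stk (k + 1) false F₀ F₁ := by
  have := Stk.gen .hole .hole Val.var Val.var h (.refl _) (by simp) .var
  simpa only [EvalCtx.subst_var, EvalCtx.comp_hole] using this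

theorem Stk.conf_val {k : ℕ} {b : Bool} {F₀ F₁ : EvalCtx} (h : Stk k b F₀ F₁) {u₀ u₁ : Val}
    (hu : ValClo u₀ u₁) : Conf k (F₀.plug u₀.toTm) (F₁.plug u₁.toTm) :=
  ⟨b, F₀, F₁, .var 0, .var 0, scons u₀ .var, scons u₁ .var, h, .refl _,
    fun _ => ⟨.inl ⟨.var 0, rfl⟩, .inl ⟨.var 0, rfl⟩⟩, .scons hu .var, rfl, rfl⟩

theorem Stk.ctxR {k : ℕ} {F₀ F₁ : EvalCtx} (h : Stk k true F₀ F₁) : CtxR ConfB F₀ F₁ := by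
  rcases h.pure_or_delimited with ⟨E₀, E₁, rfl, rfl, -⟩ | ⟨k', G₀, G₁, E₀, E₁, rfl, rfl, hG, hE⟩
  · refine ctxR_iff.2 (.inl ⟨_, _, rfl, rfl, ?_⟩)
    have := (h.rename Nat.succ).conf_val (.var 0)
    simp only [PureCtx.toEval_rename, PureCtx.plug_toEval] at this
    exact this.confB
  · refine ctxR_iff.2 (.inr ⟨_, _, _, _, rfl, rfl, ((hG.rename Nat.succ).conf_val (.var 0)).confB,
      ?_⟩)
    obtain ⟨k', hk⟩ := (hE.rename Nat.succ).stk Stk.nil.generalize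
    have := hk.conf_val (.var 0)
    simp only [EvalCtx.comp, EvalCtx.plug, PureCtx.plug_toEval] at this
    exact this.confB

theorem refinedBisimilar_body_app (v : Val) :
    RefinedBisimilar v.body (.app (v.rename Nat.succ).toTm (.var 0)) := by
  cases v with
  | var n => exact .refl _
  | lam t =>
    refine (Adm.expand (.beta _ (.var 0)) ?_).refinedBisimilar
    rw [Tm.inst_var, Tm.rename_rename]
    have : unbindRen 0 ∘ upRen Nat.succ = id := by funext n; cases n <;> rfl
    rw [this, Tm.rename_id]
    exact .refl _

/-- Up to one β-step the body is the value applied to a fresh variable, which is the application of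
two variables under an environment. -/
theorem ValClo.body {v₀ v₁ : Val} (h : ValClo v₀ v₁) : ConfB v₀.body v₁.body :=
  ⟨0, _, _, refinedBisimilar_body_app v₀, ⟨true, .hole, .hole, .app (.var 0) (.var 1),
    .app (.var 0) (.var 1), scons (v₀.rename Nat.succ) .var, scons (v₁.rename Nat.succ) .var,
    .nil, .refl _, by simp, .scons (h.rename _) .var, rfl, rfl⟩,
    (refinedBisimilar_body_app v₁).symm⟩

/-! ### Evaluation of related configurations -/

theorem NF.val_left {R : Tm → Tm → Prop} {v : Val} {q : Tm} (hn : NF R v.toTm q) :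
    ∃ v', q = Val.toTm v' ∧ R v.body v'.body := by
  unfold NF at hn
  rw [decomp_val] at hn
  cases hq : decomp q <;> simp only [hq] at hn
  exact ⟨_, eq_of_decomp_val hq, hn⟩

theorem NF.ctrl_left {R : Tm → Tm → Prop} {E : PureCtx} {b q : Tm}
    (hn : NF R (E.plug (.shift b)) q) :
    ∃ E' b', q = PureCtx.plug E' (.shift b') ∧ R (ctrlBody E b) (ctrlBody E' b') := by
  unfold NF at hn
  rw [decomp_ctrl] at hn
  cases hq : decomp q <;> simp only [hq] at hn
  exact ⟨_, _, eq_of_decomp_ctrl hq, hn⟩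

theorem NF.opn_left {R : Tm → Tm → Prop} {F : EvalCtx} {x : ℕ} {v : Val} {q : Tm}
    (hn : NF R (F.plug (.app (.var x) v.toTm)) q) :
    ∃ F' v', q = EvalCtx.plug F' (.app (.var x) (Val.toTm v')) ∧ CtxR R F F' ∧
      R v.body v'.body := by
  unfold NF at hn
  rw [decomp_opn] at hn
  cases hq : decomp q <;> simp only [hq] at hn
  obtain ⟨rfl, hF, hv⟩ := hn
  exact ⟨_, _, eq_of_decomp_opn hq, hF, hv⟩

theorem CtxR.pure_left {R : Tm → Tm → Prop} {E : PureCtx} {F : EvalCtx}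
    (h : CtxR R E.toEval F) : ∃ E', F = PureCtx.toEval E' ∧ R E.body E'.body := by
  rcases F.pure_or_delimited with ⟨E', rfl⟩ | ⟨G, E', rfl⟩
  · simp only [CtxR, PureCtx.split_toEval] at h
    exact ⟨E', rfl, h⟩
  · simp [CtxR, PureCtx.split_toEval, EvalCtx.split_comp] at h

theorem steps_app_body (v : Val) (σ : ℕ → Val) (u : Val) :
    ∃ s n, Steps s n (.app (v.subst σ).toTm u.toTm) (v.body.subst (scons u σ)) := by
  cases v with
  | var n => exact ⟨0, 0, .refl _⟩
  | lam t =>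
    have := Steps.single (Step.beta (t.subst (upSub σ)) u)
    rw [Tm.inst_upSub] at this
    exact ⟨_, _, this⟩

/-- Application of related values in related stacks. -/
theorem ValClo.apply {w₀ w₁ : Val} : ValClo w₀ w₁ →
    ∀ {k : ℕ} {F₀ F₁ : EvalCtx} {u₀ u₁ : Val}, Stk k true F₀ F₁ → ValClo u₀ u₁ →
    (∃ y F₁' k' u₁' s n, w₀ = .var y ∧ Stk k' true F₀ F₁' ∧ ValClo u₀ u₁' ∧
      Steps s n (F₁.plug (.app w₁.toTm u₁.toTm)) (F₁'.plug (.app (.var y) u₁'.toTm))) ∨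
    (∃ b₀ q k' s n, w₀ = .lam b₀ ∧ Conf k' (F₀.plug (b₀.inst u₀)) q ∧
      Steps s n (F₁.plug (.app w₁.toTm u₁.toTm)) q)
  | .var y, k, F₀, F₁, u₀, u₁, hF, hu => .inl ⟨y, F₁, k, u₁, 0, 0, rfl, hF, hu, .refl _⟩
  | .clo (.lam b) v₁ σ₀ σ₁ hv hσ, k, F₀, F₁, u₀, u₁, hF, hu => by
    obtain ⟨s, n, hs⟩ := steps_app_body v₁ σ₁ u₁
    refine .inr ⟨_, _, k, s, n, rfl, ⟨true, F₀, F₁, b, v₁.body, _, _, hF, hv, by simp,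
      .scons hu hσ, ?_, rfl⟩, hs.plug F₁⟩
    rw [Tm.inst_upSub]
  | .clo (.var m) v₁ σ₀ σ₁ hv hσ, k, F₀, F₁, u₀, u₁, hF, hu => by
    -- A variable can be bisimilar to an abstraction, as with `y` and `λx. y x`. The right body then
    -- evaluates to `E[y v]`, with `E` bisimilar to the empty context and `v` to the argument
    -- variable.
    obtain ⟨q, hq, hn⟩ := hv.eval (nf_opn .hole (m + 1) (.var 0)).eval
    obtain ⟨F, v, rfl, hF', hv'⟩ := hn.opn_left
    obtain ⟨E, rfl, hE⟩ := CtxR.pure_left (E := .hole) hF'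
    obtain ⟨⟨s', n', hs'⟩, -⟩ := eval_iff.1 hq
    obtain ⟨s, n, hs⟩ := steps_app_body v₁ σ₁ u₁
    have h1 := (hs.plug F₁).trans ((hs'.subst (scons u₁ σ₁)).plug F₁)
    -- `E` is pushed on the right against the empty context on the left.
    have hst := Stk.pure .hole E _ _ hF hE (EnvClo.scons hu hσ)
    have hvc : ValClo u₀ (v.subst (scons u₁ σ₁)) := .clo (.var 0) v _ _ hv' (EnvClo.scons hu hσ)
    have e : F₀.comp (PureCtx.subst (scons u₀ σ₀) .hole).toEval = F₀ := EvalCtx.comp_hole F₀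
    rw [e] at hst
    have e' : F₁.plug ((E.toEval.plug (.app (.var (m + 1)) v.toTm)).subst (scons u₁ σ₁)) =
        (F₁.comp (E.subst (scons u₁ σ₁)).toEval).plug
          (.app (σ₁ m).toTm (v.subst (scons u₁ σ₁)).toTm) := by
      simp only [EvalCtx.plug_comp, PureCtx.plug_toEval, PureCtx.plug_subst, Tm.subst,
        Val.toTm_subst, scons_succ]
    rw [e'] at h1
    -- The left side has not moved, so termination comes from the derivation of relatedness: the
    -- looked-up values have a smaller one.
    rcases (hσ m).apply hst hvc with ⟨y, F₁', k', u₁', s, n, hy, h2, h3, h4⟩ |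
      ⟨b₀, q, k', s, n, hb, h2, h3⟩
    · exact .inl ⟨y, F₁', k', u₁', _, _, hy, h2, h3, h1.trans h4⟩
    · exact .inr ⟨b₀, q, k', _, _, hb, h2, h1.trans h3⟩
  | .cont E₀ E₁ hE, k, F₀, F₁, u₀, u₁, hF, hu => by
    obtain ⟨k', hk⟩ := hE.stk hF.generalize
    have h := hk.conf_val hu
    have h1 := (Steps.single (Step.beta (.reset E₁.body) u₁)).plug F₁
    simp only [EvalCtx.plug_comp, EvalCtx.plug, PureCtx.plug_toEval, ← PureCtx.body_inst] at h
    exact .inr ⟨_, _, k', _, _, rfl, h, h1⟩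

theorem Adm.plug {t s : Tm} (h : Adm t s) (F : EvalCtx) : Adm (F.plug t) (F.plug s) := by
  induction F with
  | hole => exact h
  | appR v F ih => exact .app (.refl _) ih
  | appL F t ih => exact .app ih (.refl _)
  | reset F ih => exact .reset ih

/-- Capturing a composed context at once or in two pieces. -/
theorem adm_capture (J E : PureCtx) (b : Tm) :
    Adm (.reset (b.inst (J.comp E).reify)) (.reset (b.inst (PureCtx.appR J.reify E).reify)) := by
  refine .reset ((Adm.refl b).inst (.lam ?_))
  change Adm (.reset (J.comp E).body) _
  rw [PureCtx.body_comp]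
  refine Adm.delay_any (e := J.body.rename (upRen Nat.succ)) ?_ (.refl _)
  rw [PureCtx.body_rename]
  exact .refl _

theorem ConfB.trans_left {p q r : Tm} (h : RefinedBisimilar p q) (h' : ConfB q r) : ConfB p r := by
  obtain ⟨k, a, b, h1, h2, h3⟩ := h'
  exact ⟨k, a, b, h.trans h1, h2, h3⟩

theorem ConfB.trans_right {p q r : Tm} (h : ConfB p q) (h' : RefinedBisimilar q r) : ConfB p r := by
  obtain ⟨k, a, b, h1, h2, h3⟩ := h
  exact ⟨k, a, b, h1, h2, h3.trans h'⟩

theorem NF.confB_trans {p q r s : Tm} (h₁ : NF RefinedBisimilar p q) (h₂ : NF ConfB q r)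
    (h₃ : NF RefinedBisimilar r s) : NF ConfB p s := by
  refine ((h₁.trans h₂).trans h₃).mono ?_
  rintro a d ⟨c, ⟨b, h1, h2⟩, h3⟩
  exact (ConfB.trans_left h1 h2).trans_right h3

/-- The surrounding pure context is passed in through `k'`, instantiated by the reified `k' J`. Up
to administrative redexes this is the continuation of the composed context. -/
theorem confB_ctrlBody {J₀ J₁ E₀ E₁ : PureCtx} {b₀ b₁ : Tm} {σ₀ σ₁ : ℕ → Val}
    (hJ : ContClo (.appR (.var 0) (J₀.rename Nat.succ)) (.appR (.var 0) (J₁.rename Nat.succ)))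
    (h : RefinedBisimilar (ctrlBody E₀ b₀) (ctrlBody E₁ b₁)) (hσ : EnvClo σ₀ σ₁) :
    ConfB (ctrlBody (J₀.comp (E₀.subst σ₀)) (b₀.subst (upSub σ₀)))
      (ctrlBody (J₁.comp (E₁.subst σ₁)) (b₁.subst (upSub σ₁))) := by
  have key : ∀ (J E : PureCtx) (b : Tm) (σ : ℕ → Val),
      RefinedBisimilar (ctrlBody (J.comp (E.subst σ)) (b.subst (upSub σ)))
        ((ctrlBody E b).subst (scons (PureCtx.appR (.var 0) (J.rename Nat.succ)).reify
          fun n => (σ n).rename Nat.succ)) := by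
    intro J E b σ
    have := adm_capture (.appR (.var 0) (J.rename Nat.succ)) ((E.subst σ).rename Nat.succ)
      ((b.subst (upSub σ)).rename (upRen Nat.succ))
    rw [ctrlBody_subst_scons, ← PureCtx.rename_subst, ← rename_comp_upSub, ← Tm.rename_subst,
      ctrlBody, PureCtx.comp_rename]
    exact this.refinedBisimilar
  exact ⟨0, _, _, key _ _ _ _, ⟨true, .hole, .hole, _, _, _, _, .nil, h, by simp,
    .scons (.cont _ _ hJ) (hσ.rename _), rfl, rfl⟩, (key _ _ _ _).symm⟩

theorem Steps.eq_of_nf {s n : ℕ} {t t' : Tm} (h : Steps s n t t') (ht : Nf t) : t' = t := by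
  cases h with
  | refl => rfl
  | head h _ => exact absurd h (ht _ _)

/-- The fundamental lemma. Each transition either consumes a capture, consumes a step with no extra
capture, or pops a frame. -/
theorem Conf.eval (s n k : ℕ) {p q p' : Tm} (h : Conf k p q) (hp : Steps s n p p') (hn : Nf p') :
    ∃ q', Eval q q' ∧ NF ConfB p' q' := by
  induction s using Nat.strong_induction_on generalizing n k p q p' with
  | _ s ihs =>
  induction n using Nat.strong_induction_on generalizing k p q p' with
  | _ n ihn =>
  induction k using Nat.strong_induction_on generalizing p q p' with
  | _ k ihk =>
  have IH : ∀ (s' n' k' : ℕ) (p q p' : Tm),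
      s' < s ∨ s' = s ∧ n' < n ∨ s' = s ∧ n' = n ∧ k' < k →
      Conf k' p q → Steps s' n' p p' → Nf p' → ∃ q', Eval q q' ∧ NF ConfB p' q' := by
    rintro s' n' k' p q p' (hlt | ⟨rfl, hlt⟩ | ⟨rfl, rfl, hlt⟩) h hp hn
    · exact ihs s' hlt n' k' h hp hn
    · exact ihn n' hlt k' h hp hn
    · exact ihk k' hlt h hp hn
  clear ihs ihn ihk
  obtain ⟨b, F₀, F₁, t₀, t₁, σ₀, σ₁, hF, ht, hsafe, hσ, rfl, rfl⟩ := h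
  -- The evaluation first normalizes the open term, where bisimilarity applies directly; environment
  -- and stack matter only afterwards.
  obtain ⟨s₁, n₁, s₂, n₂, t₀', h1, h2, h3, rfl, rfl⟩ :=
    Steps.reflect (f := fun t => F₀.plug (t.subst σ₀))
      (fun c t t' h => decomp_plug_red F₀ (h.subst σ₀)) hp hn
  obtain ⟨t₁', he, hN⟩ := ht.eval (eval_iff.2 ⟨⟨_, _, h1⟩, h2⟩)
  obtain ⟨⟨s₃, n₃, h4⟩, -⟩ := eval_iff.1 he
  have hsafe' : b = false → Safe t₀' ∧ Safe t₁' :=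
    fun hb => ⟨(hsafe hb).1.steps h1, (hsafe hb).2.steps h4⟩
  have hright := (h4.subst σ₁).plug F₁
  suffices ∃ q', Eval (F₁.plug (t₁'.subst σ₁)) q' ∧ NF ConfB p' q' by
    obtain ⟨q', hq, hN⟩ := this
    exact ⟨q', hright.eval hq, hN⟩
  clear hright hp
  rcases h2.cases with ⟨v₀, rfl⟩ | ⟨E₀, b₀, rfl⟩ | ⟨G₀, x, v₀, rfl⟩
  · obtain ⟨v₁, rfl, hv⟩ := hN.val_left
    have hv := ValClo.clo _ _ _ _ hv hσ
    simp only [← Val.toTm_subst] at h3 ⊢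
    rcases hF.pop hv with ⟨rfl, rfl⟩ | ⟨k', hk, hC⟩
    · obtain rfl := h3.eq_of_nf (nf_val _)
      exact ⟨_, (nf_val _).eval, .val hv.body⟩
    · exact IH _ _ _ _ _ _ (by omega) hC h3 hn
  · obtain ⟨E₁, b₁, rfl, hb⟩ := hN.ctrl_left
    cases b with
    | false => exact absurd (hsafe' rfl).1 (not_safe_ctrl _ _)
    | true =>
      simp only [PureCtx.plug_subst, Tm.subst] at h3 ⊢
      rcases hF.pure_or_delimited with ⟨J₀, J₁, rfl, rfl, hJ⟩ |
        ⟨k', G₀, G₁, J₀, J₁, rfl, rfl, hG, hJ⟩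
      · simp only [PureCtx.plug_toEval, ← PureCtx.plug_comp] at h3 ⊢
        obtain rfl := h3.eq_of_nf (nf_ctrl _ _)
        exact ⟨_, (nf_ctrl _ _).eval, .ctrl (confB_ctrlBody (hJ _ _) hb hσ)⟩
      · simp only [EvalCtx.plug_comp, EvalCtx.plug, PureCtx.plug_toEval] at h3 ⊢
        simp only [← PureCtx.plug_comp] at h3 ⊢
        have hL₀ := decomp_plug_red G₀ (.capture (J₀.comp (E₀.subst σ₀)) (b₀.subst (upSub σ₀)))
        have hL₁ := decomp_plug_red G₁ (.capture (J₁.comp (E₁.subst σ₁)) (b₁.subst (upSub σ₁)))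
        obtain ⟨s₄, n₄, h5, hs₄, -⟩ := (Steps.single hL₀).cancel h3 hn
        have hA₀ := (adm_capture J₀ (E₀.subst σ₀) (b₀.subst (upSub σ₀))).plug G₀
        have hA₁ := (adm_capture J₁ (E₁.subst σ₁) (b₁.subst (upSub σ₁))).plug G₁
        -- The term is replaced by its administrative variant, an instance of `ctrlBody`. The step
        -- count `n₅` is uncontrolled, but the capture count is one less than before the capture.
        obtain ⟨m', n₅, h6, hm, hNm⟩ := hA₀.eval h5 hn
        have hC : Conf k' (G₀.plug (.reset ((b₀.subst (upSub σ₀)).inst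
            (PureCtx.appR J₀.reify (E₀.subst σ₀)).reify)))
            (G₁.plug (.reset ((b₁.subst (upSub σ₁)).inst
            (PureCtx.appR J₁.reify (E₁.subst σ₁)).reify))) := by
          refine ⟨false, G₀, G₁, ctrlBody E₀ b₀, ctrlBody E₁ b₁, scons J₀.reify σ₀,
            scons J₁.reify σ₁, hG, hb, fun _ => ⟨.inr ⟨_, rfl⟩, .inr ⟨_, rfl⟩⟩,
            .scons (.cont _ _ hJ) hσ, ?_, ?_⟩ <;> rw [ctrlBody_subst_scons]
        obtain ⟨q₁, hq₁, hN₁⟩ := IH _ _ _ _ _ _ (by omega) hC h6 hm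
        -- On the right no count is needed, so plain bisimilarity suffices to return to the actual
        -- reduct.
        obtain ⟨q₂, hq₂, hN₂⟩ := hA₁.refinedBisimilar.symm.eval hq₁
        exact ⟨q₂, (Steps.single hL₁).eval hq₂,
          (hNm.mono fun _ _ h => h.refinedBisimilar).confB_trans hN₁ hN₂⟩
  · obtain ⟨G₁, v₁, rfl, hG, hv⟩ := hN.opn_left
    have hv := ValClo.clo _ _ _ _ hv hσ
    obtain ⟨k', hk⟩ := hF.push hG hsafe' hσ
    simp only [EvalCtx.plug_subst, Tm.subst, ← Val.toTm_subst, ← EvalCtx.plug_comp] at h3 ⊢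
    rcases (hσ x).apply hk hv with ⟨y, F₁', k'', u₁, s₄, n₄, hy, hF', hu, h5⟩ |
      ⟨b₀, q, k'', s₄, n₄, hb, hC, h5⟩
    · rw [hy] at h3
      obtain rfl := h3.eq_of_nf (nf_opn _ _ _)
      exact ⟨_, h5.eval (nf_opn _ _ _).eval, .opn hF'.ctxR hu.body⟩
    · rw [hb] at h3
      obtain ⟨s₅, n₅, h6, hs₅, hn₅⟩ :=
        (Steps.single (decomp_plug_red _ (.beta b₀ (v₀.subst σ₀)))).cancel h3 hn
      obtain ⟨q', hq, hN'⟩ := IH _ _ _ _ _ _ (by omega) hC h6 hn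
      exact ⟨q', h5.eval hq, hN'⟩

theorem ConfB.refinedBisimilar {p q : Tm} (h : ConfB p q) : RefinedBisimilar p q := by
  refine .of_symmetric confB_renClosed (fun _ _ h => h.symm) ?_ h
  rintro p q p' ⟨k, a, b, h1, h2, h3⟩ he
  obtain ⟨a', ha, hN₁⟩ := h1.eval he
  obtain ⟨⟨s, n, hs⟩, hn⟩ := eval_iff.1 ha
  obtain ⟨b', hb, hN₂⟩ := h2.eval s n k hs hn
  obtain ⟨q', hq, hN₃⟩ := h3.eval hb
  exact ⟨q', hq, hN₁.confB_trans hN₂ hN₃⟩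

/-! ### Bisimilarity is a congruence -/

namespace RefinedBisimilar

theorem subst {t₀ t₁ : Tm} (h : RefinedBisimilar t₀ t₁) {σ₀ σ₁ : ℕ → Val}
    (hσ : ∀ n, RefinedBisimilar (σ₀ n).body (σ₁ n).body) :
    RefinedBisimilar (t₀.subst σ₀) (t₁.subst σ₁) := by
  refine (Conf.confB (k := 0) ⟨true, .hole, .hole, t₀, t₁, σ₀, σ₁, .nil, h, by simp, fun n => ?_,
    rfl, rfl⟩).refinedBisimilar
  have := ValClo.clo _ _ Val.var Val.var (hσ n) .var
  simpa only [Val.subst_var] using this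

theorem plug_pure {E₀ E₁ : PureCtx} {t₀ t₁ : Tm} (hE : RefinedBisimilar E₀.body E₁.body)
    (h : RefinedBisimilar t₀ t₁) : RefinedBisimilar (E₀.plug t₀) (E₁.plug t₁) := by
  refine (Conf.confB ⟨true, _, _, t₀, t₁, _, _, .pure E₀ E₁ Val.var Val.var .nil hE .var, h,
    by simp, .var, ?_, ?_⟩).refinedBisimilar <;>
  simp [EvalCtx.comp]

theorem plug_delimited {F₀ F₁ : EvalCtx} {E₀ E₁ : PureCtx} {t₀ t₁ : Tm}
    (hF : RefinedBisimilar F₀.body F₁.body)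
    (hE : RefinedBisimilar (.reset E₀.body) (.reset E₁.body))
    (h : RefinedBisimilar t₀ t₁) :
    RefinedBisimilar (F₀.plug (.reset (E₀.plug t₀))) (F₁.plug (.reset (E₁.plug t₁))) := by
  refine (Conf.confB ⟨true, _, _, t₀, t₁, _, _, .delim E₀ E₁ Val.var Val.var
    (.gen F₀ F₁ Val.var Val.var .nil hF (by simp) .var) hE .var, h, by simp, .var, ?_,
    ?_⟩).refinedBisimilar <;>
  simp [EvalCtx.comp, EvalCtx.plug_comp, EvalCtx.plug]

theorem reset {t₀ t₁ : Tm} (h : RefinedBisimilar t₀ t₁) :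
    RefinedBisimilar (.reset t₀) (.reset t₁) :=
  plug_delimited (F₀ := .hole) (F₁ := .hole) (E₀ := .hole) (E₁ := .hole) (.refl _) (.refl _) h

/-- Plugging `t₀, t₁` into `□ s₀, □ s₁` requires `x s₀` and `x s₁` to be bisimilar, which is
plugging into `x □`. -/
theorem app {t₀ t₁ s₀ s₁ : Tm} (ht : RefinedBisimilar t₀ t₁) (hs : RefinedBisimilar s₀ s₁) :
    RefinedBisimilar (.app t₀ s₀) (.app t₁ s₁) := by
  refine plug_pure (E₀ := .appL .hole s₀) (E₁ := .appL .hole s₁) ?_ ht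
  exact plug_pure (E₀ := .appR (.var 0) .hole) (E₁ := .appR (.var 0) .hole) (.refl _)
    (refinedBisimilar_renClosed _ _ Nat.succ hs)

theorem lam {t₀ t₁ : Tm} (h : RefinedBisimilar t₀ t₁) : RefinedBisimilar (.lam t₀) (.lam t₁) :=
  .of_nf (nf_val (.lam t₀)) (nf_val (.lam t₁)) (NF.val (v₀ := .lam t₀) (v₁ := .lam t₁) h)

theorem shift {t₀ t₁ : Tm} (h : RefinedBisimilar t₀ t₁) :
    RefinedBisimilar (.shift t₀) (.shift t₁) := by
  refine .of_nf (nf_ctrl .hole t₀) (nf_ctrl .hole t₁) (NF.ctrl (E₀ := .hole) (E₁ := .hole) ?_)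
  refine reset ?_
  simp only [Tm.inst_eq]
  exact (refinedBisimilar_renClosed _ _ _ h).subst fun n => .refl _

theorem plug {t₀ t₁ : Tm} (h : RefinedBisimilar t₀ t₁) (C : Ctx) :
    RefinedBisimilar (C.plug t₀) (C.plug t₁) := by
  induction C with
  | hole => exact h
  | lam x C ih => exact lam (refinedBisimilar_renClosed _ _ _ ih)
  | appR t C ih => exact app (.refl _) ih
  | appL C t ih => exact app ih (.refl _)
  | shift k C ih => exact shift (refinedBisimilar_renClosed _ _ _ ih)
  | reset C ih => exact reset ih

theorem val_body {v₀ v₁ : Val} {x : ℕ} (h₀ : ¬ v₀.toTm.Free x) (h₁ : ¬ v₁.toTm.Free x)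
    (h : RefinedBisimilar (v₀.appVar x) (v₁.appVar x)) : RefinedBisimilar v₀.body v₁.body := by
  rw [← Val.appVar_rename_bindRen h₀, ← Val.appVar_rename_bindRen h₁]
  exact refinedBisimilar_renClosed _ _ _ h

theorem obsLe {p q : Tm} (h : RefinedBisimilar p q) : ObsLe p q := by
  constructor
  · rintro ⟨p', he, v, rfl⟩
    obtain ⟨q', hq, hn⟩ := h.eval he
    obtain ⟨v', rfl, -⟩ := hn.val_left
    exact ⟨_, hq, v', rfl⟩
  · rintro ⟨p', he, E, b, rfl⟩
    obtain ⟨q', hq, hn⟩ := h.eval he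
    obtain ⟨E', b', rfl, -⟩ := hn.ctrl_left
    exact ⟨_, hq, E', b', rfl⟩

theorem ctxEquiv {t₀ t₁ : Tm} (h : RefinedBisimilar t₀ t₁) : CtxEquiv t₀ t₁ :=
  fun C _ _ => ⟨(h.plug C).obsLe, (h.plug C).symm.obsLe⟩

end RefinedBisimilar

theorem isCongruence_refinedBisimilar : IsCongruence RefinedBisimilar :=
  ⟨⟨.refl, .symm, .trans⟩, fun C _ _ h => h.plug C⟩

theorem closure_le_refinedBisimilar {R : Tm → Tm → Prop} (hR : IsRefinedBisimulation R)
    {t₀ t₁ : Tm} (h : Closure R t₀ t₁) : RefinedBisimilar t₀ t₁ := by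
  induction h with
  | refl t => exact .refl t
  | base t₀ t₁ h => exact ⟨R, hR, h⟩
  | subst t₀ t₁ x v₀ v₁ y _ h₀ h₁ _ iht ihv =>
    refine iht.subst fun n => ?_
    by_cases hn : n = x
    · simp only [hn, if_true]
      exact .val_body h₀ h₁ ihv
    · simp only [hn, if_false]
      exact .refl _
  | pureCtx t₀ t₁ E₀ E₁ x _ h₀ h₁ _ iht ihE =>
    refine .plug_pure ?_ iht
    rw [← PureCtx.plug_var_rename_bindRen h₀, ← PureCtx.plug_var_rename_bindRen h₁]
    exact refinedBisimilar_renClosed _ _ _ ihE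
  | delimitedCtx t₀ t₁ F₀ F₁ E₀ E₁ x _ h₀ h₁ h₂ h₃ _ _ iht ihF ihE =>
    refine .plug_delimited ?_ ?_ iht
    · rw [← EvalCtx.plug_var_rename_bindRen h₀, ← EvalCtx.plug_var_rename_bindRen h₁]
      exact refinedBisimilar_renClosed _ _ _ ihF
    · rw [← PureCtx.plug_var_rename_bindRen h₂, ← PureCtx.plug_var_rename_bindRen h₃]
      exact refinedBisimilar_renClosed _ _ (bindRen x) ihE
  | lam x t₀ t₁ _ ih => exact ih.plug (.lam x .hole)
  | shift k t₀ t₁ _ ih => exact ih.plug (.shift k .hole)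
  | bisim t₀ t₀' t₁' t₁ h₀ _ h₁ ih => exact h₀.trans (ih.trans h₁)

/-- The closure does not depend on `R`: its `bisim` rule makes it contain all of bisimilarity, and
the compatibility results bound it from above. -/
theorem closure_eq_refinedBisimilar {R : Tm → Tm → Prop} (hR : IsRefinedBisimulation R) :
    Closure R = RefinedBisimilar := by
  funext t₀ t₁
  exact propext ⟨closure_le_refinedBisimilar hR,
    fun h => .bisim t₀ t₁ t₁ t₁ h (.refl t₁) (.refl t₁)⟩

/-! ### A contextual equivalence that is not a bisimilarity -/

/-- The term `(λx. x x) (λx. x x)`. -/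
def loopTm : Tm :=
  .app (.lam (.app (.var 0) (.var 0))) (.lam (.app (.var 0) (.var 0)))

theorem loopTm_step : Step 0 loopTm loopTm :=
  Step.beta (.app (.var 0) (.var 0)) (.lam (.app (.var 0) (.var 0)))

theorem loopTm_subst (σ : ℕ → Val) : loopTm.subst σ = loopTm := rfl

/-- Terms of the form `(λx. x x) (λx. x x)` or `⟨t⟩ ((λx. x x) (λx. x x))`; in evaluation
position of a closed term they diverge. -/
def Hopeless (d : Tm) : Prop := d = loopTm ∨ ∃ t, d = .app (.reset t) loopTm

theorem Hopeless.subst {d : Tm} (h : Hopeless d) (σ : ℕ → Val) : Hopeless (d.subst σ) := by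
  rcases h with rfl | ⟨t, rfl⟩
  · exact .inl rfl
  · exact .inr ⟨t.subst σ, rfl⟩

/-- Terms with a hopeless term in evaluation position. -/
def HopelessAt (p : Tm) : Prop := ∃ F d, p = EvalCtx.plug F d ∧ Hopeless d

theorem HopelessAt.plug {p : Tm} (h : HopelessAt p) (F : EvalCtx) : HopelessAt (F.plug p) := by
  obtain ⟨G, d, rfl, hd⟩ := h
  exact ⟨F.comp G, d, (EvalCtx.plug_comp _ _ _).symm, hd⟩

/-- Terms invariant under substitution. -/
def SubstInv (p : Tm) : Prop := ∀ σ, p.subst σ = p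

theorem Tm.subst_congr (t : Tm) {σ τ : ℕ → Val} (h : ∀ x, t.Free x → σ x = τ x) :
    t.subst σ = t.subst τ := by
  have key : ∀ (t : Tm) (σ τ : ℕ → Val), (∀ x, t.Free (x + 1) → σ x = τ x) →
      ∀ x, t.Free x → upSub σ x = upSub τ x := by
    intro t σ τ h x hx
    cases x with
    | zero => rfl
    | succ x => simp [h x hx]
  induction t generalizing σ τ with
  | var n => simp [Tm.subst, h n rfl]
  | lam t ih => simp only [Tm.subst]; rw [ih (key t σ τ h)]
  | shift t ih => simp only [Tm.subst]; rw [ih (key t σ τ h)]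
  | reset t ih => simp only [Tm.subst]; rw [ih h]
  | app t s iht ihs =>
    simp only [Tm.subst]
    rw [iht fun x hx => h x (.inl hx), ihs fun x hx => h x (.inr hx)]

theorem Tm.Closed.substInv {p : Tm} (h : p.Closed) : SubstInv p := by
  intro σ
  rw [p.subst_congr (τ := Val.var) fun x hx => absurd hx (h x), Tm.subst_var]

/-- Reduction commutes with substitution and is deterministic, so the invariance passes to the
reduct. No analysis of free variables along reduction is needed. -/
theorem SubstInv.step {c : ℕ} {p p' : Tm} (h : SubstInv p) (hs : Step c p p') : SubstInv p' := by
  intro σ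
  have := hs.subst σ
  rw [h σ] at this
  exact (this.det hs).2

/-- Substituting the identity for every variable turns an open-stuck term into a reducible one. -/
theorem SubstInv.ne_opn {p : Tm} (h : SubstInv p) (F : EvalCtx) (x : ℕ) (v : Val) :
    p ≠ F.plug (.app (.var x) v.toTm) := by
  rintro rfl
  have hs := decomp_plug_red (F.subst fun _ => .lam (.var 0))
    (.beta (.var 0) (v.subst fun _ => .lam (.var 0)))
  have := h fun _ => .lam (.var 0)
  simp only [EvalCtx.plug_subst, Tm.subst, ← Val.toTm_subst] at this
  rw [show (Val.lam (.var 0)).toTm = .lam (.var 0) from rfl] at this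
  rw [this] at hs
  exact nf_opn _ _ _ _ _ hs

/-- A reset is neither a value nor control stuck, and invariance excludes open stuckness. So `⟨t⟩`
steps: to another reset, or to a value, after which the loop is in evaluation position. -/
theorem HopelessAt.step {p : Tm} (h : HopelessAt p) (hi : SubstInv p) :
    ∃ c p', Step c p p' ∧ HopelessAt p' := by
  obtain ⟨F, d, rfl, rfl | ⟨t, rfl⟩⟩ := h
  · exact ⟨0, _, decomp_plug_red F loopTm_step, F, _, rfl, .inl rfl⟩
  · by_cases hn : Nf (.reset t)
    · rcases hn.cases with ⟨v, hv⟩ | ⟨E, b, hb⟩ | ⟨G, x, v, hG⟩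
      · cases v <;> cases hv
      · cases E <;> cases hb
      · rw [hG] at hi
        refine absurd ?_ (hi.ne_opn (F.comp (.appL G loopTm)) x v)
        rw [EvalCtx.plug_comp]; rfl
    · simp only [Nf, not_forall, not_not] at hn
      obtain ⟨c, r, hr⟩ := hn
      have hs := decomp_plug_red (F.comp (.appL .hole loopTm)) hr
      rw [EvalCtx.plug_comp, EvalCtx.plug_comp] at hs
      refine ⟨c, F.plug (.app r loopTm), hs, ?_⟩
      rcases step_reset_inv hr with ⟨r, -, rfl⟩ | ⟨E, b, -, -, rfl⟩ | ⟨v, rfl, -, rfl⟩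
      · exact ⟨F, _, rfl, .inr ⟨_, rfl⟩⟩
      · exact ⟨F, _, rfl, .inr ⟨_, rfl⟩⟩
      · exact ⟨F.comp (.appR v .hole), loopTm, by rw [EvalCtx.plug_comp]; rfl, .inl rfl⟩

theorem HopelessAt.not_eval {p p' : Tm} {s n : ℕ} (h : HopelessAt p) (hi : SubstInv p)
    (hs : Steps s n p p') (hn : Nf p') : False := by
  induction hs with
  | refl =>
    obtain ⟨c, p', hp, -⟩ := h.step hi
    exact hn _ _ hp
  | head hs _ ih =>
    obtain ⟨c, p', hp, hh⟩ := h.step hi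
    obtain ⟨-, rfl⟩ := hs.det hp
    exact ih hh (hi.step hp) hn

/-- Equality of terms up to hopeless subterms. -/
inductive HopelessEq : Tm → Tm → Prop
  | var (n : ℕ) : HopelessEq (.var n) (.var n)
  | lam {t s : Tm} : HopelessEq t s → HopelessEq (.lam t) (.lam s)
  | app {t s t' s' : Tm} : HopelessEq t s → HopelessEq t' s' → HopelessEq (.app t t') (.app s s')
  | shift {t s : Tm} : HopelessEq t s → HopelessEq (.shift t) (.shift s)
  | reset {t s : Tm} : HopelessEq t s → HopelessEq (.reset t) (.reset s)
  | hopeless {d d' : Tm} : Hopeless d → Hopeless d' → HopelessEq d d'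

namespace HopelessEq

theorem refl (t : Tm) : HopelessEq t t := by
  induction t with
  | var n => exact .var n
  | lam t ih => exact .lam ih
  | app t s iht ihs => exact .app iht ihs
  | shift t ih => exact .shift ih
  | reset t ih => exact .reset ih

theorem symm {t s : Tm} (h : HopelessEq t s) : HopelessEq s t := by
  induction h with
  | var n => exact .var n
  | lam _ ih => exact .lam ih
  | app _ _ ih ih' => exact .app ih ih'
  | shift _ ih => exact .shift ih
  | reset _ ih => exact .reset ih
  | hopeless h h' => exact .hopeless h' h

theorem subst_of_forall_rename {t s : Tm} (h : HopelessEq t s) {σ τ : ℕ → Val}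
    (hσ : ∀ n ρ, HopelessEq ((σ n).rename ρ).toTm ((τ n).rename ρ).toTm) :
    HopelessEq (t.subst σ) (s.subst τ) := by
  have up : ∀ σ τ : ℕ → Val, (∀ n ρ, HopelessEq ((σ n).rename ρ).toTm ((τ n).rename ρ).toTm) →
      ∀ n ρ, HopelessEq ((upSub σ n).rename ρ).toTm ((upSub τ n).rename ρ).toTm := by
    intro σ τ h n ρ
    cases n with
    | zero => exact .var _
    | succ n => simp only [upSub_succ, Val.rename_rename]; exact h _ _
  induction h generalizing σ τ with
  | var n =>
    have := hσ n id
    simp only [Val.toTm_rename, Tm.rename_id] at this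
    exact this
  | lam _ ih => exact .lam (ih (up _ _ hσ))
  | app _ _ ih ih' => exact .app (ih hσ) (ih' hσ)
  | shift _ ih => exact .shift (ih (up _ _ hσ))
  | reset _ ih => exact .reset (ih hσ)
  | hopeless h h' => exact .hopeless (h.subst _) (h'.subst _)

theorem rename {t s : Tm} (h : HopelessEq t s) (ρ : ℕ → ℕ) :
    HopelessEq (t.rename ρ) (s.rename ρ) := by
  simp only [Tm.rename_eq_subst]
  exact h.subst_of_forall_rename fun n ρ => refl _

theorem inst {t s : Tm} {v w : Val} (h : HopelessEq t s) (hv : HopelessEq v.toTm w.toTm) :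
    HopelessEq (t.inst v) (s.inst w) := by
  simp only [Tm.inst_eq]
  refine h.subst_of_forall_rename fun n ρ => ?_
  cases n with
  | zero => simp only [Val.toTm_rename]; exact hv.rename ρ
  | succ n => exact .var _

theorem plug {t s : Tm} (h : HopelessEq t s) (C : Ctx) :
    HopelessEq (C.plug t) (C.plug s) := by
  induction C with
  | hole => exact h
  | lam x C ih => exact .lam (ih.rename _)
  | appR t C ih => exact .app (refl _) ih
  | appL C t ih => exact .app ih (refl _)
  | shift k C ih => exact .shift (ih.rename _)
  | reset C ih => exact .reset ih

theorem lam_inv {t q : Tm} (h : HopelessEq (.lam t) q) : ∃ t', q = .lam t' ∧ HopelessEq t t' := by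
  cases h with
  | lam h => exact ⟨_, rfl, h⟩
  | hopeless h h' => rcases h with h | ⟨t, h⟩ <;> cases h

theorem val_inv {v : Val} {q : Tm} (h : HopelessEq v.toTm q) : ∃ v', q = Val.toTm v' := by
  cases v with
  | var x =>
    cases h with
    | var => exact ⟨.var x, rfl⟩
    | hopeless h h' => rcases h with h | ⟨t, h⟩ <;> cases h
  | lam t => obtain ⟨t', rfl, -⟩ := lam_inv h; exact ⟨.lam t', rfl⟩

theorem ctrl_inv {E : PureCtx} {b q : Tm} (h : HopelessEq (E.plug (.shift b)) q) :
    HopelessAt (E.plug (.shift b)) ∨ ∃ E' b', q = PureCtx.plug E' (.shift b') ∧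
      HopelessEq E.body E'.body ∧ HopelessEq b b' := by
  generalize hp : E.plug (.shift b) = p at h
  induction h generalizing E with
  | shift h _ =>
    cases E <;> simp only [PureCtx.plug, reduceCtorEq, Tm.shift.injEq] at hp
    subst hp
    exact .inr ⟨.hole, _, rfl, refl _, h⟩
  | @app t s t' s' h h' ih ih' =>
    cases E with
    | hole => cases hp
    | appR v E =>
      simp only [PureCtx.plug, Tm.app.injEq] at hp
      obtain ⟨rfl, hp⟩ := hp
      obtain ⟨v', rfl⟩ := val_inv h
      rcases ih' hp with hh | ⟨E', b', rfl, hE, hb⟩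
      · exact .inl (hh.plug (.appR v .hole))
      · refine .inr ⟨.appR v' E', b', rfl, .app ?_ hE, hb⟩
        simp only [Val.toTm_rename]
        exact h.rename _
    | appL E t =>
      simp only [PureCtx.plug, Tm.app.injEq] at hp
      obtain ⟨hp, rfl⟩ := hp
      rcases ih hp with hh | ⟨E', b', rfl, hE, hb⟩
      · exact .inl (hh.plug (.appL .hole _))
      · exact .inr ⟨.appL E' s', b', rfl, .app hE (h'.rename _), hb⟩
  | hopeless h h' => exact .inl ⟨.hole, _, rfl, h⟩
  | _ => cases E <;> cases hp

/-- The two sides reduce in lockstep as long as no hopeless subterm reaches evaluation position;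
once one does, a program invariant under substitution diverges. -/
theorem step {p q p' : Tm} {c : ℕ} (h : HopelessEq p q) (hp : Step c p p') :
    HopelessAt p ∨ ∃ q', Step c q q' ∧ HopelessEq p' q' := by
  induction h generalizing p' c with
  | var n => cases hp
  | lam h => cases hp
  | shift h => cases hp
  | @app t s t' s' h h' ih ih' =>
    rcases step_app_inv hp with ⟨r, hr, rfl⟩ | ⟨v, r, rfl, hr, rfl⟩ | ⟨b, v, rfl, rfl, rfl, rfl⟩
    · rcases ih hr with hh | ⟨q, hq, ha⟩
      · exact .inl (hh.plug (.appL .hole _))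
      · exact .inr ⟨_, decomp_plug_red (.appL .hole s') hq, .app ha h'⟩
    · obtain ⟨v', rfl⟩ := val_inv h
      rcases ih' hr with hh | ⟨q, hq, ha⟩
      · exact .inl (hh.plug (.appR v .hole))
      · exact .inr ⟨_, decomp_plug_red (.appR v' .hole) hq, .app h ha⟩
    · obtain ⟨b', rfl, hb⟩ := lam_inv h
      obtain ⟨v', rfl⟩ := val_inv h'
      exact .inr ⟨_, .beta b' v', hb.inst h'⟩
  | @reset t s h ih =>
    rcases step_reset_inv hp with ⟨r, hr, rfl⟩ | ⟨E, b, rfl, rfl, rfl⟩ | ⟨v, rfl, rfl, rfl⟩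
    · rcases ih hr with hh | ⟨q, hq, ha⟩
      · exact .inl (hh.plug (.reset .hole))
      · exact .inr ⟨_, decomp_plug_red (.reset .hole) hq, .reset ha⟩
    · rcases ctrl_inv h with hh | ⟨E', b', rfl, hE, hb⟩
      · exact .inl (hh.plug (.reset .hole))
      · exact .inr ⟨_, .capture E' b', .reset (hb.inst (.lam (.reset hE)))⟩
    · obtain ⟨v', rfl⟩ := val_inv h
      exact .inr ⟨_, .resetVal v', h⟩
  | hopeless h h' => exact .inl ⟨.hole, _, rfl, h⟩

theorem steps {p q p' : Tm} {s n : ℕ} (h : HopelessEq p q) (hi : SubstInv p)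
    (hp : Steps s n p p') (hn : Nf p') :
    ∃ q', Steps s n q q' ∧ HopelessEq p' q' ∧ SubstInv p' := by
  induction hp generalizing q with
  | refl t => exact ⟨q, .refl _, h, hi⟩
  | head hs hs' ih =>
    rcases h.step hs with hh | ⟨q₁, hq, h⟩
    · exact (hh.not_eval hi (.head hs hs') hn).elim
    · obtain ⟨q₂, hq', h⟩ := ih h (hi.step hs) hn
      exact ⟨q₂, .head hq hq', h⟩

theorem obsLe {p q : Tm} (h : HopelessEq p q) (hp : p.Closed) : ObsLe p q := by
  constructor
  · rintro ⟨p', he, v, rfl⟩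
    obtain ⟨⟨s, n, hs⟩, hn⟩ := eval_iff.1 he
    obtain ⟨q', hq, h, -⟩ := h.steps hp.substInv hs hn
    obtain ⟨v', rfl⟩ := val_inv h
    exact ⟨_, eval_iff.2 ⟨⟨_, _, hq⟩, nf_val v'⟩, v', rfl⟩
  · rintro ⟨p', he, E, b, rfl⟩
    obtain ⟨⟨s, n, hs⟩, hn⟩ := eval_iff.1 he
    obtain ⟨q', hq, h, hi⟩ := h.steps hp.substInv hs hn
    rcases ctrl_inv h with hh | ⟨E', b', rfl, -, -⟩
    · exact (hh.not_eval hi (.refl _) hn).elim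
    · exact ⟨_, eval_iff.2 ⟨⟨_, _, hq⟩, nf_ctrl E' b'⟩, E', b', rfl⟩

theorem ctxEquiv {t₀ t₁ : Tm} (h : HopelessEq t₀ t₁) : CtxEquiv t₀ t₁ :=
  fun C h₀ h₁ => ⟨(h.plug C).obsLe h₀, (h.plug C).symm.obsLe h₁⟩

end HopelessEq

theorem not_eval_loopTm {t : Tm} : ¬ Eval loopTm t := by
  intro h
  obtain ⟨⟨s, n, hs⟩, hn⟩ := eval_iff.1 h
  exact HopelessAt.not_eval ⟨.hole, loopTm, rfl, .inl rfl⟩ loopTm_subst hs hn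

theorem exists_ctxEquiv_not_refinedBisimilar :
    ∃ t₀ t₁ : Tm, CtxEquiv t₀ t₁ ∧ ¬ RefinedBisimilar t₀ t₁ := by
  -- The free variable makes the first term open stuck, an observation open to bisimilarity but not
  -- to closing contexts.
  refine ⟨.app (.reset (.app (.var 0) (.lam (.var 0)))) loopTm, loopTm,
    (HopelessEq.hopeless (.inr ⟨_, rfl⟩) (.inl rfl)).ctxEquiv, fun h => ?_⟩
  obtain ⟨q, hq, -⟩ := h.eval (nf_opn (.appL (.reset .hole) loopTm) 0 (.lam (.var 0))).eval
  exact not_eval_loopTm hq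

end ShiftReset

theorem mainTheorem3 :
    (∀ R : ShiftReset.Tm → ShiftReset.Tm → Prop,
      ShiftReset.IsRefinedBisimulation R →
        ShiftReset.IsRefinedBisimulation (ShiftReset.Closure R)) ∧
    ShiftReset.IsCongruence ShiftReset.RefinedBisimilar ∧
    (∀ t₀ t₁ : ShiftReset.Tm,
      ShiftReset.RefinedBisimilar t₀ t₁ → ShiftReset.CtxEquiv t₀ t₁) ∧
    (∃ t₀ t₁ : ShiftReset.Tm,
      ShiftReset.CtxEquiv t₀ t₁ ∧ ¬ ShiftReset.RefinedBisimilar t₀ t₁) := by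
  refine ⟨fun R hR => ?_, ShiftReset.isCongruence_refinedBisimilar, fun _ _ h => h.ctxEquiv,
    ShiftReset.exists_ctxEquiv_not_refinedBisimilar⟩
  rw [ShiftReset.closure_eq_refinedBisimilar hR]
  exact ShiftReset.refinedBisimilar_isGreatest.1
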